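/- Let $P_X$ be a fully supported probability mass function on a finite alphabet $\mathcal X$ and let $P_{Y|X}$ be a channel from $\mathcal X$ to a finite alphabet $\mathcal Y$. Write $d(x_1,x_2)=-\log\sum_{y}\sqrt{P_{Y|X}(y|x_1)P_{Y|X}(y|x_2)}\in[0,\infty]$ for the Bhattacharyya distance, $d(Q)=\sum_{x_1,x_2}Q(x_1,x_2)\,d(x_1,x_2)$ for a probability mass function $Q$ on $\mathcal X^2$, $H_2(P_X)=-\log\sum_x P_X(x)^2$ for the collision entropy, and $$\psi_2=\min_{Q}\Big\{\tfrac12 D_{\mathrm{KL}}(Q\,\|\,P_X\otimes P_X)+d(Q)\Big\},$$ the minimum being over all probability mass functions $Q$ on $\mathcal X^2$. Let $X(1),\dots,X(M)$ be fragments of length $L$ whose $ML$ letters are i.i.d. with law $P_X$, and let the reference sequence $Y=(Y(1),\dots,Y(M))$ be the output of the memoryless channel $P_{Y|X}$ with input $X=(X(1),\dots,X(M))$. From the multiset of the fragments and from $Y$, a maximum likelihood reconstruction algorithm outputs an ordering $\hat X=(\hat X(1),\dots,\hat X(M))$ of the fragments that maximizes the likelihood of $Y$ among all orderings, with ties resolved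 in any way that is a function of the observations. For $\xi\in[0,1)$, let $\mathsf{FP}(\xi)$ be the probability that $\hat X(i)\neq X(i)$ for at least one index $i$ and for at least $\xi M$ indices $i$. Let $M\to\infty$, and let $L=L_M$ be integers with $L_M/\log M\to\beta$. Assume that $d(x_1,x_2)<\infty$ for all $x_1,x_2\in\mathcal X$, that $0<\psi_2<\tfrac12H_2(P_X)$, and that $\beta>1/\psi_2$. Then $$\mathsf{FP}(0)\ \ge\ M^{2[1-\beta\psi_2]+o(1)},$$ and, for every fixed $\xi\in(0,1)$, $$\mathsf{FP}(\xi)\ \ge\ \exp\big[-\xi M\log M\cdot(\beta\psi_2+o(1))\big],$$ where the $o(1)$ terms tend to $0$ as $M\to\infty$ and do not depend on the choice of the maximum likelihood algorithm. -/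

import Mathlib

open Filter Topology

noncomputable section

namespace SeqReorder

variable {𝒳 𝒴 : Type*} [Fintype 𝒳] [Fintype 𝒴]

/-- The Bhattacharyya distance `d(a, b) = -log ∑_y √(W(y|a) W(y|b))` of two input letters of the
channel `W`, with values in the extended reals: it is `⊤` if the two output laws have disjoint
supports. -/
def bhattacharyyaDist (W : 𝒳 → 𝒴 → ℝ) (a b : 𝒳) : EReal :=
  -ENNReal.log (ENNReal.ofReal (∑ y, √(W a y * W b y)))

/-- The collision entropy (Rényi entropy of order two). -/
def collisionEntropy (P : 𝒳 → ℝ) : ℝ :=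
  -Real.log (∑ a, P a ^ 2)

/-- The Kullback-Leibler divergence `D(Q ‖ P ⊗ P)` of a joint law `Q` on pairs of letters from the
product law. It is used for fully supported `P`; the convention `0 log 0 = 0` is automatic. -/
def klProd (P : 𝒳 → ℝ) (Q : 𝒳 × 𝒳 → ℝ) : ℝ :=
  ∑ p, Q p * Real.log (Q p / (P p.1 * P p.2))

/-- The linear extension of the Bhattacharyya distance to joint laws on pairs of letters. It is
used for channels whose Bhattacharyya distances are finite. -/
def bhattacharyyaJoint (W : 𝒳 → 𝒴 → ℝ) (Q : 𝒳 × 𝒳 → ℝ) : ℝ :=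
  ∑ p, Q p * (bhattacharyyaDist W p.1 p.2).toReal

/-- `ψ₂ = min_Q ½ D(Q ‖ P ⊗ P) + d(Q)`, the minimum being over all probability mass functions `Q`
on pairs of letters. -/
def psi₂ (P : 𝒳 → ℝ) (W : 𝒳 → 𝒴 → ℝ) : ℝ :=
  sInf ((fun Q => 1 / 2 * klProd P Q + bhattacharyyaJoint W Q) '' stdSimplex ℝ (𝒳 × 𝒳))

/-! A sequence of length `N = M L` is given by its `M` consecutive fragments of length `L`, that
is, as `x : Fin M → Fin L → 𝒳`, where `x i j` is the `j`-th letter of the `i`-th fragment. -/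

/-- The observed multiset of fragments. -/
def fragments {M L : ℕ} (x : Fin M → Fin L → 𝒳) : Multiset (Fin L → 𝒳) :=
  Finset.univ.val.map x

/-- The probability of the IID source sequence `x`. -/
def sourceProb (P : 𝒳 → ℝ) {M L : ℕ} (x : Fin M → Fin L → 𝒳) : ℝ :=
  ∏ i, ∏ j, P (x i j)

/-- The probability of the reference sequence `y` given the source sequence `x`. -/
def likelihood (W : 𝒳 → 𝒴 → ℝ) {M L : ℕ} (x : Fin M → Fin L → 𝒳) (y : Fin M → Fin L → 𝒴) : ℝ :=
  ∏ i, ∏ j, W (x i j) (y i j)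

/-- A reconstruction algorithm maps the multiset of fragments and the reference sequence to an
ordered sequence of fragments. -/
abbrev Reconstruction (𝒳 𝒴 : Type*) (M L : ℕ) :=
  Multiset (Fin L → 𝒳) → (Fin M → Fin L → 𝒴) → (Fin M → Fin L → 𝒳)

/-- The algorithm `φ` is maximum likelihood: its output is a reordering of the observed fragments
which maximizes the likelihood of the reference sequence among all reorderings. Ties may be
resolved in any way. -/
def IsML (W : 𝒳 → 𝒴 → ℝ) {M L : ℕ} (φ : Reconstruction 𝒳 𝒴 M L) : Prop :=
  ∀ (x : Fin M → Fin L → 𝒳) (y : Fin M → Fin L → 𝒴),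
    (∃ π : Equiv.Perm (Fin M), φ (fragments x) y = x ∘ π) ∧
    ∀ π : Equiv.Perm (Fin M), likelihood W (x ∘ π) y ≤ likelihood W (φ (fragments x) y) y

open Classical in
/-- The fraction of the fragments of `x` that are not correctly reproduced by `x'`. -/
def failFraction {M L : ℕ} (x x' : Fin M → Fin L → 𝒳) : ℝ :=
  ((Finset.univ.filter fun i => x' i ≠ x i).card : ℝ) / M

open Classical in
/-- The reconstruction failure probability at zero distortion and failure level `ξ`: the
probability that at least one fragment, and at least a fraction `ξ` of all fragments, is not
correctly reconstructed. The first condition is automatic for `ξ > 0` and the second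
for `ξ = 0`. -/
def FP (P : 𝒳 → ℝ) (W : 𝒳 → 𝒴 → ℝ) {M L : ℕ} (φ : Reconstruction 𝒳 𝒴 M L) (ξ : ℝ) : ℝ :=
  ∑ x : Fin M → Fin L → 𝒳, ∑ y : Fin M → Fin L → 𝒴,
    if 0 < failFraction x (φ (fragments x) y) ∧ ξ ≤ failFraction x (φ (fragments x) y) then
      sourceProb P x * likelihood W x y
    else 0

end SeqReorder

end

/-! Let q be the joint law of a letter and its output. For two such letters, let R (`tiltedLaw`) be
the normalized geometric mean of their likelihoods before and after the two inputs are interchanged.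
Its normalizing constant is the mean squared Bhattacharyya coefficient, which by the Gibbs
variational principle equals exp(-2ψ₂) (`psi₂_eq`). Since R is invariant under the interchange, the
log-likelihood ratio of the interchange has mean zero under R, so for R-typical pairs of blocks it
is o(L). On the support of R the law q ⊗ q is exp(-2ψ₂ - ratio/2) R (`jointLaw_mul_eq`). Hence two
independent blocks can be interchanged at almost no loss of likelihood with probability at least
exp(-2ψ₂L - o(L)) = M^(-2βψ₂ + o(1)).

For failure level zero, a second moment argument over about M² pairs (`le_pmean_exists_pair`) yields
some confusable pair with probability at least M^(2 - 2βψ₂ + o(1)). Pairs of pairs sharing a block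
do no harm: given one block, another is confusable with it with probability at most exp(-(ψ₂ -
o(1))L), which is o(1/M) because βψ₂ > 1. The exponent ψ₂ bounds the divergence of the marginal of R
from q, by nonnegativity of mutual information (`sum_tiltedLaw_mul_marginalLogDensity_le`). A
reconstruction that is right before an interchange is wrong after it, since the observations are the
same (`pmean_exists_swap_le_pmean_fail`).

For a level ξ > 0, take K disjoint pairs of blocks, K slightly above ξM/2, and replace their law by
the tilted law conditioned on typical pairs (`pairLaw`). This costs exp((2ψ₂ + o(1))L) per pair,
which gives the claimed exponent. Interchanges within pairs now preserve both the law and the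
observations, and one of the 2^K patterns of interchanges makes both fragments wrong in every pair
that is not `Protected`; the factor 2^K is negligible (`pmean_card_protected_le`,
`le_FP_of_protected`).

It remains to show that protected pairs are few. Let H be the entropy of an input letter under R. If
βH > 1, fragments rarely coincide, whereas a protected pair forces a coincidence because the output
is a reordering of the fragments (`Protected.collision`). If βH ≤ 1, there are at most M^(1+o(1))
typical fragments, so their multiset takes only exp(o(M log M)) values. For each value the guess is
a function of the reference alone and hits a given fragment with probability exp(-cL), so a Chernoff
bound beats the union bound (`pmean_protected_le_of_frequent`). -/

namespace SeqReorder

/-! ### Means under product laws -/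

section ProductMean

open scoped Classical

variable {ι κ Z : Type*} [Fintype ι] [Fintype κ] [Fintype Z]

/-- The mean of `F` under the law on `ι → Z` of independent letters with weights `q`. -/
noncomputable def pmean (q : Z → ℝ) (F : (ι → Z) → ℝ) : ℝ :=
  ∑ z, (∏ i, q (z i)) * F z

/-- The mean as a sum with respect to any enumeration of the sequences. -/
theorem pmean_eq_sum (inst : Fintype (ι → Z)) (q : Z → ℝ) (F : (ι → Z) → ℝ) :
    pmean q F = ∑ z, (∏ i, q (z i)) * F z :=
  Finset.sum_congr (by ext; simp) fun _ _ => rfl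

theorem pmean_prod (q : Z → ℝ) (f : ι → Z → ℝ) :
    pmean q (fun z => ∏ i, f i (z i)) = ∏ i, ∑ a, q a * f i a := by
  unfold pmean
  rw [Finset.prod_univ_sum, Fintype.piFinset_univ]
  exact Finset.sum_congr rfl fun z _ => Finset.prod_mul_distrib.symm

theorem pmean_const {q : Z → ℝ} (hq : ∑ a, q a = 1) (c : ℝ) :
    pmean q (fun _ : ι → Z => c) = c := by
  have h := pmean_prod q (fun (_ : ι) (_ : Z) => (1 : ℝ))
  simp only [mul_one, hq, Finset.prod_const_one] at h
  unfold pmean at h ⊢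
  rw [← Finset.sum_mul]
  simp only [mul_one] at h
  rw [h, one_mul]

theorem pmean_mono {q : Z → ℝ} (hq : ∀ a, 0 ≤ q a) {F G : (ι → Z) → ℝ} (h : ∀ z, F z ≤ G z) :
    pmean q F ≤ pmean q G :=
  Finset.sum_le_sum fun z _ => mul_le_mul_of_nonneg_left (h z) (Finset.prod_nonneg fun _ _ => hq _)

theorem pmean_add (q : Z → ℝ) (F G : (ι → Z) → ℝ) :
    pmean q (fun z => F z + G z) = pmean q F + pmean q G := by
  simp only [pmean, mul_add, Finset.sum_add_distrib]

theorem pmean_sub (q : Z → ℝ) (F G : (ι → Z) → ℝ) :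
    pmean q (fun z => F z - G z) = pmean q F - pmean q G := by
  simp only [pmean, mul_sub, Finset.sum_sub_distrib]

theorem pmean_const_mul (q : Z → ℝ) (c : ℝ) (F : (ι → Z) → ℝ) :
    pmean q (fun z => c * F z) = c * pmean q F := by
  simp only [pmean, Finset.mul_sum]
  exact Finset.sum_congr rfl fun z _ => by ring

theorem pmean_mul_const (q : Z → ℝ) (c : ℝ) (F : (ι → Z) → ℝ) :
    pmean q (fun z => F z * c) = pmean q F * c := by
  simp only [pmean, Finset.sum_mul]
  exact Finset.sum_congr rfl fun z _ => by ring

theorem pmean_sum {α : Type*} (s : Finset α) (q : Z → ℝ) (F : α → (ι → Z) → ℝ) :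
    pmean q (fun z => ∑ a ∈ s, F a z) = ∑ a ∈ s, pmean q (F a) := by
  simp only [pmean, Finset.mul_sum]
  exact Finset.sum_comm

/-- Resampling one letter does not change the mean. -/
theorem pmean_resample {q : Z → ℝ} (hq : ∑ a, q a = 1) (i : ι) (F : (ι → Z) → ℝ) :
    pmean q F = pmean q (fun z => ∑ a, q a * F (Function.update z i a)) := by
  have hw : ∀ (z : ι → Z) (a : Z),
      (∏ j, q (Function.update z i a j)) * q (z i) = (∏ j, q (z j)) * q a := by
    intro z a
    rw [← Finset.mul_prod_erase _ _ (Finset.mem_univ i),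
      ← Finset.mul_prod_erase _ (fun j => q (z j)) (Finset.mem_univ i)]
    rw [Finset.prod_congr rfl (g := fun j => q (z j)) fun j hj => by
      rw [Function.update_of_ne (Finset.ne_of_mem_erase hj)]]
    simp only [Function.update_self]
    ring
  have h1 : pmean q F = ∑ p : (ι → Z) × Z, (∏ j, q (p.1 j)) * q p.2 * F p.1 := by
    rw [Fintype.sum_prod_type]
    refine Finset.sum_congr rfl fun z _ => ?_
    dsimp only
    rw [← Finset.sum_mul, ← Finset.mul_sum, hq, mul_one]
  have h2 : pmean q (fun z => ∑ a, q a * F (Function.update z i a))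
      = ∑ p : (ι → Z) × Z, (∏ j, q (p.1 j)) * q p.2 * F (Function.update p.1 i p.2) := by
    rw [Fintype.sum_prod_type]
    refine Finset.sum_congr rfl fun z _ => ?_
    rw [Finset.mul_sum]
    exact Finset.sum_congr rfl fun a _ => by ring
  rw [h1, h2]
  -- Exchanging the i-th letter with a spare independent letter is an involution that preserves the
  -- weights, by `hw`.
  let e : (ι → Z) × Z → (ι → Z) × Z := fun p => (Function.update p.1 i p.2, p.1 i)
  have he : Function.Involutive e := by
    rintro ⟨z, a⟩
    simp [e]
  rw [← Equiv.sum_comp he.toPerm]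
  refine Finset.sum_congr rfl fun p _ => ?_
  change (∏ j, q (Function.update p.1 i p.2 j)) * q (p.1 i) * F (Function.update p.1 i p.2) = _
  rw [hw]

theorem pmean_eval {q : Z → ℝ} (hq : ∑ a, q a = 1) (i : ι) (f : Z → ℝ) :
    pmean q (fun z : ι → Z => f (z i)) = ∑ a, q a * f a := by
  rw [pmean_resample hq i]
  simp only [Function.update_self]
  exact pmean_const hq _

theorem pmean_eval₂ {q : Z → ℝ} (hq : ∑ a, q a = 1) {i j : ι} (hij : i ≠ j) (f : Z → Z → ℝ) :
    pmean q (fun z : ι → Z => f (z i) (z j)) = ∑ a, q a * ∑ b, q b * f a b := by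
  rw [pmean_resample hq j]
  simp only [Function.update_self, Function.update_of_ne hij]
  exact pmean_eval hq i fun a => ∑ b, q b * f a b

/-- Chebyshev's inequality for sums of independent letters. -/
theorem pmean_chebyshev {q : Z → ℝ} (hq0 : ∀ a, 0 ≤ q a) (hq : ∑ a, q a = 1) (f : Z → ℝ)
    {δ : ℝ} (hδ : 0 < δ) (hι : 0 < Fintype.card ι) :
    pmean q (fun z : ι → Z =>
      if δ * Fintype.card ι ≤ |∑ i, f (z i) - Fintype.card ι * ∑ a, q a * f a| then 1 else 0)
      ≤ (∑ a, q a * (f a - ∑ b, q b * f b) ^ 2) / δ ^ 2 / Fintype.card ι := by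
  set m := ∑ b, q b * f b with hm
  set n : ℝ := ((Fintype.card ι : ℕ) : ℝ) with hn
  have hn0 : 0 < n := by rw [hn]; exact_mod_cast hι
  set g : Z → ℝ := fun a => f a - m with hg
  have hg0 : ∑ a, q a * g a = 0 := by
    simp only [hg, mul_sub, Finset.sum_sub_distrib, ← Finset.sum_mul, hq]
    rw [← hm]; ring
  have hcross : ∀ i j : ι, pmean q (fun z : ι → Z => g (z i) * g (z j))
      = if i = j then ∑ a, q a * g a ^ 2 else 0 := by
    intro i j
    split_ifs with h
    · subst h
      rw [pmean_eval hq i (fun a => g a * g a)]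
      exact Finset.sum_congr rfl fun a _ => by ring
    · rw [pmean_eval₂ hq h (fun a b => g a * g b)]
      refine Finset.sum_eq_zero fun a _ => ?_
      rw [Finset.sum_congr rfl (g := fun b => g a * (q b * g b)) fun b _ => by ring,
        ← Finset.mul_sum, hg0]
      ring
  have hsq : pmean q (fun z : ι → Z => (∑ i, g (z i)) ^ 2) = n * ∑ a, q a * g a ^ 2 := by
    simp only [sq (∑ i, g _), Finset.sum_mul_sum]
    rw [pmean_sum]
    simp only [pmean_sum, hcross]
    simp [hn]
  have hpt : ∀ z : ι → Z, (if δ * n ≤ |∑ i, f (z i) - n * m| then (1 : ℝ) else 0)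
      ≤ (δ * n)⁻¹ ^ 2 * (∑ i, g (z i)) ^ 2 := by
    intro z
    have hs : ∑ i, g (z i) = ∑ i, f (z i) - n * m := by
      simp [hg, Finset.sum_sub_distrib, hn]
    rw [hs]
    split_ifs with h
    · have h1 : 1 ≤ (δ * n)⁻¹ * |∑ i, f (z i) - n * m| := by
        rw [inv_mul_eq_div, le_div_iff₀ (by positivity)]; linarith
      calc (1 : ℝ) = 1 ^ 2 := by norm_num
        _ ≤ ((δ * n)⁻¹ * |∑ i, f (z i) - n * m|) ^ 2 := by gcongr
        _ = _ := by rw [mul_pow, sq_abs]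
    · positivity
  refine (pmean_mono hq0 hpt).trans (le_of_eq ?_)
  rw [pmean_const_mul, hsq]
  change _ = (∑ a, q a * g a ^ 2) / δ ^ 2 / n
  field_simp

theorem pmean_comp_equiv (e : ι ≃ κ) (q : Z → ℝ) (F : (ι → Z) → ℝ) :
    pmean q F = pmean q (fun z : κ → Z => F (z ∘ e)) := by
  unfold pmean
  rw [← Equiv.sum_comp (e.arrowCongr (Equiv.refl Z)).symm]
  refine Finset.sum_congr rfl fun z _ => ?_
  have : (e.arrowCongr (Equiv.refl Z)).symm z = z ∘ e := by ext i; simp [Equiv.arrowCongr]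
  rw [this, ← Equiv.prod_comp e fun i => q (z i)]
  rfl

theorem pmean_sum_type (q : Z → ℝ) (F : (ι ⊕ κ → Z) → ℝ) :
    pmean q F = pmean q (fun z₂ : κ → Z => pmean q (fun z₁ : ι → Z => F (Sum.elim z₁ z₂))) := by
  rw [pmean_eq_sum inferInstance,
    ← Equiv.sum_comp (Equiv.sumArrowEquivProdArrow ι κ Z).symm, Fintype.sum_prod_type,
    Finset.sum_comm]
  unfold pmean
  refine Finset.sum_congr rfl fun z₂ _ => ?_
  rw [Finset.mul_sum]
  refine Finset.sum_congr rfl fun z₁ _ => ?_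
  have : (Equiv.sumArrowEquivProdArrow ι κ Z).symm (z₁, z₂) = Sum.elim z₁ z₂ := rfl
  rw [this, Fintype.prod_sum_type]
  simp only [Sum.elim_inl, Sum.elim_inr]
  ring

theorem pmean_prod_type {Z' : Type*} [Fintype Z'] (q : Z × Z' → ℝ) (F : (ι → Z × Z') → ℝ) :
    pmean q F = ∑ z : ι → Z, ∑ z' : ι → Z', (∏ i, q (z i, z' i)) * F (fun i => (z i, z' i)) := by
  unfold pmean
  rw [← Equiv.sum_comp (Equiv.arrowProdEquivProdArrow ι (fun _ => Z) (fun _ => Z')).symm,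
    Fintype.sum_prod_type]
  rfl

theorem pmean_double (q : Z → ℝ) (F : (ι ⊕ ι → Z) → ℝ) :
    pmean q F = pmean (fun p : Z × Z => q p.1 * q p.2)
      (fun c : ι → Z × Z => F (Sum.elim (fun i => (c i).1) (fun i => (c i).2))) := by
  rw [pmean_sum_type, pmean_prod_type, Finset.sum_comm]
  unfold pmean
  refine Finset.sum_congr rfl fun z₂ _ => ?_
  rw [Finset.mul_sum]
  refine Finset.sum_congr rfl fun z₁ _ => ?_
  simp only [Finset.prod_mul_distrib]
  ring

end ProductMean

end SeqReorder

namespace SeqReorder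

/-! ### Second moments of pair events and single interchanges -/

section PairEvents

open scoped Classical

variable {ι Z U V : Type*} [Fintype ι] [Fintype Z] [Fintype U] [Fintype V]

/-- Two pairs coincide, share their first letter, share their second letter, or are disjoint. In the
mixed cases the letter not shared is averaged first, which costs at most κ. The bound adds the
contributions of all four cases, so that it can be summed over the indices term by term. The
conditions `i ≠ j'` and `i' ≠ j` exclude chains; they hold when first and second indices come from
disjoint sets. -/
theorem pmean_pair_mul_pair_le {q : Z → ℝ} (hq0 : ∀ a, 0 ≤ q a) (hq : ∑ a, q a = 1)
    (t : Z → Z → ℝ) (ht0 : ∀ a b, 0 ≤ t a b) (ht1 : ∀ a b, t a b ≤ 1) {κ : ℝ}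
    (h₁ : ∀ a, ∑ b, q b * t a b ≤ κ) (h₂ : ∀ b, ∑ a, q a * t a b ≤ κ) (hκ : 0 ≤ κ)
    {i j i' j' : ι} (hij : i ≠ j) (hij' : i' ≠ j') (hij₁ : i ≠ j') (hij₂ : i' ≠ j) :
    pmean q (fun z : ι → Z => t (z i) (z j) * t (z i') (z j')) ≤
      (if i = i' then if j = j' then ∑ a, q a * ∑ b, q b * t a b else 0 else 0) +
      (if i = i' then κ * ∑ a, q a * ∑ b, q b * t a b else 0) +
      (if j = j' then κ * ∑ a, q a * ∑ b, q b * t a b else 0) +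
      (∑ a, q a * ∑ b, q b * t a b) ^ 2 := by
  set τ := ∑ a, q a * ∑ b, q b * t a b with hτ
  have hτ0 : 0 ≤ τ := Finset.sum_nonneg fun a _ => mul_nonneg (hq0 a) <|
    Finset.sum_nonneg fun b _ => mul_nonneg (hq0 b) (ht0 a b)
  have hmean : ∀ {k l : ι}, k ≠ l → pmean q (fun z : ι → Z => t (z k) (z l)) = τ :=
    fun h => pmean_eval₂ hq h t
  by_cases hi : i = i'
  · subst hi
    by_cases hj : j = j'
    · subst hj
      have : pmean q (fun z : ι → Z => t (z i) (z j) * t (z i) (z j)) ≤ τ := by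
        rw [← hmean hij]
        exact pmean_mono hq0 fun z => mul_le_of_le_one_left (ht0 _ _) (ht1 _ _)
      simp only [if_true]
      nlinarith [mul_nonneg hκ hτ0, sq_nonneg τ]
    · have : pmean q (fun z : ι → Z => t (z i) (z j) * t (z i) (z j')) ≤ κ * τ := by
        rw [pmean_resample hq j', ← hmean hij, ← pmean_const_mul]
        refine pmean_mono hq0 fun z => ?_
        simp only [Function.update_self, Function.update_of_ne hij₁, Function.update_of_ne hj]
        rw [Finset.sum_congr rfl (g := fun b => t (z i) (z j) * (q b * t (z i) b))
          fun b _ => by ring, ← Finset.mul_sum, mul_comm κ]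
        exact mul_le_mul_of_nonneg_left (h₁ _) (ht0 _ _)
      simp only [if_true, hj, if_false]
      nlinarith [sq_nonneg τ]
  · by_cases hj : j = j'
    · subst hj
      have : pmean q (fun z : ι → Z => t (z i) (z j) * t (z i') (z j)) ≤ κ * τ := by
        rw [pmean_resample hq i', ← hmean hij, ← pmean_const_mul]
        refine pmean_mono hq0 fun z => ?_
        simp only [Function.update_self, Function.update_of_ne hij₂.symm, Function.update_of_ne hi]
        rw [Finset.sum_congr rfl (g := fun b => t (z i) (z j) * (q b * t b (z j)))
          fun b _ => by ring, ← Finset.mul_sum, mul_comm κ]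
        exact mul_le_mul_of_nonneg_left (h₂ _) (ht0 _ _)
      simp only [if_true, hi, if_false]
      nlinarith [sq_nonneg τ]
    · have : pmean q (fun z : ι → Z => t (z i) (z j) * t (z i') (z j')) = τ ^ 2 := by
        rw [pmean_resample hq j', pmean_resample hq i', sq, ← hmean hij, ← pmean_mul_const,
          hmean hij]
        congr 1
        ext z
        simp only [Function.update_self, Function.update_of_ne hij₁, Function.update_of_ne hj,
          Function.update_of_ne hij', Function.update_of_ne hij₂.symm, Function.update_of_ne hi]
        rw [hτ, Finset.mul_sum]
        refine Finset.sum_congr rfl fun a _ => ?_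
        simp only [Finset.mul_sum]
        exact Finset.sum_congr rfl fun b _ => by ring
      simp only [hi, hj, if_false]
      linarith

/-- A second moment lower bound for the probability that some pair of letters, one with index in
`I` and one with index in `J`, lies in `T`. -/
theorem le_pmean_exists_pair {q : Z → ℝ} (hq0 : ∀ a, 0 ≤ q a) (hq : ∑ a, q a = 1)
    (T : Z → Z → Prop) {κ τ : ℝ}
    (h₁ : ∀ a, ∑ b, q b * (if T a b then 1 else 0) ≤ κ)
    (h₂ : ∀ b, ∑ a, q a * (if T a b then 1 else 0) ≤ κ) (hκ : 0 ≤ κ)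
    (hτ : ∑ a, q a * ∑ b, q b * (if T a b then 1 else 0) = τ)
    {I J : Finset ι} (hIJ : Disjoint I J) :
    I.card * J.card * τ * (1 - (I.card + J.card) * κ - I.card * J.card * τ) ≤
      pmean q (fun z : ι → Z => if ∃ i ∈ I, ∃ j ∈ J, T (z i) (z j) then 1 else 0) := by
  set t : Z → Z → ℝ := fun a b => if T a b then 1 else 0 with ht
  have ht0 : ∀ a b, 0 ≤ t a b := fun a b => by simp only [ht]; split_ifs <;> norm_num
  have ht1 : ∀ a b, t a b ≤ 1 := fun a b => by simp only [ht]; split_ifs <;> norm_num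
  set N : (ι → Z) → ℝ := fun z => ∑ i ∈ I, ∑ j ∈ J, t (z i) (z j) with hN
  have hne : ∀ {i j}, i ∈ I → j ∈ J → i ≠ j := fun hi hj h =>
    Finset.disjoint_left.1 hIJ hi (h ▸ hj)
  -- For the number N of good pairs, 2N - N² ≤ 1 because (N - 1)² ≥ 0, and both sides vanish when N
  -- = 0. So twice the first moment minus the second bounds the probability from below.
  have hpt : ∀ z : ι → Z, 2 * N z - N z ^ 2 ≤
      if ∃ i ∈ I, ∃ j ∈ J, T (z i) (z j) then 1 else 0 := by
    intro z
    split_ifs with h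
    · nlinarith [sq_nonneg (N z - 1)]
    · have : N z = 0 := by
        refine Finset.sum_eq_zero fun i hi => Finset.sum_eq_zero fun j hj => ?_
        exact if_neg fun hT => h ⟨i, hi, j, hj, hT⟩
      rw [this]; norm_num
  have hE : pmean q N = I.card * J.card * τ := by
    rw [hN, pmean_sum, Finset.sum_congr rfl (g := fun _ => (J.card : ℝ) * τ)]
    · rw [Finset.sum_const, nsmul_eq_mul]; ring
    · intro i hi
      rw [pmean_sum, Finset.sum_congr rfl (g := fun _ => τ)]
      · rw [Finset.sum_const, nsmul_eq_mul]
      · intro j hj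
        rw [pmean_eval₂ hq (hne hi hj) t, ← hτ]
  have hE2 : pmean q (fun z => N z ^ 2) ≤ ∑ i ∈ I, ∑ i' ∈ I, ∑ j ∈ J, ∑ j' ∈ J,
      ((if i = i' then if j = j' then τ else 0 else 0) + (if i = i' then κ * τ else 0) +
      (if j = j' then κ * τ else 0) + τ ^ 2) := by
    simp only [hN, sq (∑ i ∈ I, _), Finset.sum_mul_sum]
    simp only [pmean_sum]
    refine Finset.sum_le_sum fun i hi => Finset.sum_le_sum fun i' hi' =>
      Finset.sum_le_sum fun j hj => Finset.sum_le_sum fun j' hj' => ?_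
    rw [← hτ]
    exact pmean_pair_mul_pair_le hq0 hq t ht0 ht1 h₁ h₂ hκ (hne hi hj) (hne hi' hj')
      (hne hi hj') (hne hi' hj)
  have hsum : ∑ i ∈ I, ∑ i' ∈ I, ∑ j ∈ J, ∑ j' ∈ J,
      ((if i = i' then if j = j' then τ else 0 else 0) + (if i = i' then κ * τ else 0) +
      (if j = j' then κ * τ else 0) + τ ^ 2) =
      I.card * J.card * τ + I.card * J.card ^ 2 * (κ * τ) + I.card ^ 2 * J.card * (κ * τ)
        + (I.card * J.card * τ) ^ 2 := by
    have e1 : ∀ c : ℝ, ∑ j ∈ J, ∑ j' ∈ J, (if j = j' then c else 0) = J.card * c := by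
      intro c
      rw [Finset.sum_congr rfl (g := fun _ => c) fun j hj => by simp [hj]]
      simp
    have e2 : ∀ c : ℝ, ∑ i ∈ I, ∑ i' ∈ I, (if i = i' then c else 0) = I.card * c := by
      intro c
      rw [Finset.sum_congr rfl (g := fun _ => c) fun j hj => by simp [hj]]
      simp
    have e3 : ∀ i i' : ι, ∑ j ∈ J, ∑ j' ∈ J,
        ((if i = i' then if j = j' then τ else 0 else 0) + (if i = i' then κ * τ else 0) +
        (if j = j' then κ * τ else 0) + τ ^ 2) = (if i = i' then J.card * τ else 0) +
        (if i = i' then (J.card : ℝ) ^ 2 * (κ * τ) else 0) + J.card * (κ * τ)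
          + (J.card : ℝ) ^ 2 * τ ^ 2 := by
      intro i i'
      simp only [Finset.sum_add_distrib, e1]
      by_cases h : i = i'
      · simp only [h, if_true, e1, Finset.sum_const, nsmul_eq_mul]; ring
      · simp only [h, if_false, Finset.sum_const, nsmul_eq_mul]; ring
    rw [Finset.sum_congr rfl fun i _ => Finset.sum_congr rfl fun i' _ => e3 i i']
    simp only [Finset.sum_add_distrib, e2, Finset.sum_const, nsmul_eq_mul]
    ring
  rw [hsum] at hE2
  have hfin : 2 * pmean q N - pmean q (fun z => N z ^ 2) ≤
      pmean q (fun z : ι → Z => if ∃ i ∈ I, ∃ j ∈ J, T (z i) (z j) then 1 else 0) := by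
    rw [← pmean_const_mul, ← pmean_sub]
    exact pmean_mono hq0 hpt
  rw [hE] at hfin
  refine le_trans (le_of_eq_of_le ?_ (sub_le_sub_left hE2 _)) hfin
  ring

/-- Interchanging the inputs, but not the outputs, with the indices `i` and `j`. -/
noncomputable def swapInput (i j : ι) (z : ι → U × V) : ι → U × V :=
  fun k => ((z (Equiv.swap i j k)).1, (z k).2)

omit [Fintype U] [Fintype V] in
theorem le_prod_swapInput {q : U × V → ℝ} (hq0 : ∀ a, 0 ≤ q a) {i j : ι} (hij : i ≠ j)
    (z : ι → U × V) {θ : ℝ}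
    (h : θ * (q (z i) * q (z j)) ≤ q ((z j).1, (z i).2) * q ((z i).1, (z j).2)) :
    θ * ∏ k, q (z k) ≤ ∏ k, q (swapInput i j z k) := by
  have hj : j ∈ Finset.univ.erase i := by simp [hij.symm]
  rw [← Finset.mul_prod_erase _ _ (Finset.mem_univ i), ← Finset.mul_prod_erase _ _ hj,
    ← Finset.mul_prod_erase _ (fun k => q (swapInput i j z k)) (Finset.mem_univ i),
    ← Finset.mul_prod_erase _ (fun k => q (swapInput i j z k)) hj]
  have hr : ∏ k ∈ (Finset.univ.erase i).erase j, q (swapInput i j z k) =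
      ∏ k ∈ (Finset.univ.erase i).erase j, q (z k) := by
    refine Finset.prod_congr rfl fun k hk => ?_
    simp only [Finset.mem_erase, Finset.mem_univ, and_true] at hk
    simp [swapInput, Equiv.swap_apply_of_ne_of_ne hk.2 hk.1]
  rw [hr]
  have h0 : 0 ≤ ∏ k ∈ (Finset.univ.erase i).erase j, q (z k) :=
    Finset.prod_nonneg fun _ _ => hq0 _
  have := mul_le_mul_of_nonneg_right h h0
  simp only [swapInput, Equiv.swap_apply_left, Equiv.swap_apply_right]
  calc _ = θ * (q (z i) * q (z j)) * ∏ k ∈ (Finset.univ.erase i).erase j, q (z k) := by ring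
    _ ≤ _ := this
    _ = _ := by ring

/-- If a guess `g` of the inputs is invariant under interchanging two inputs, then it fails with at
least the probability, up to a constant, that an interchange is nearly as likely. -/
theorem pmean_exists_swap_le_pmean_fail {q : U × V → ℝ} (hq0 : ∀ a, 0 ≤ q a)
    (T : U × V → U × V → Prop) {θ : ℝ} (hθ1 : θ ≤ 1)
    (hT : ∀ a b, T a b → a.1 ≠ b.1 ∧ θ * (q a * q b) ≤ q (b.1, a.2) * q (a.1, b.2))
    (g : (ι → U × V) → ι → U) (hg : ∀ i j z, g (swapInput i j z) = g z) :
    θ * pmean q (fun z : ι → U × V => if ∃ i j, T (z i) (z j) then 1 else 0) ≤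
      2 * pmean q (fun z : ι → U × V => if ∃ i, g z i ≠ (z i).1 then 1 else 0) := by
  set w : (ι → U × V) → ℝ := fun z => ∏ i, q (z i) with hw
  have hw0 : ∀ z, 0 ≤ w z := fun z => Finset.prod_nonneg fun _ _ => hq0 _
  set A := Finset.univ.filter fun z : ι → U × V => ∃ i j, T (z i) (z j) with hA
  set F := Finset.univ.filter fun z : ι → U × V => ∃ i, g z i ≠ (z i).1 with hF
  have eA : pmean q (fun z : ι → U × V => if ∃ i j, T (z i) (z j) then 1 else 0)
      = ∑ z ∈ A, w z := by
    rw [hA, Finset.sum_filter]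
    exact Finset.sum_congr rfl fun z _ => by simp [hw]
  have eF : pmean q (fun z : ι → U × V => if ∃ i, g z i ≠ (z i).1 then 1 else 0)
      = ∑ z ∈ F, w z := by
    rw [hF, Finset.sum_filter]
    exact Finset.sum_congr rfl fun z _ => by simp [hw]
  rw [eA, eF]
  -- Where the guess is right although an interchange is nearly as likely, interchanging makes the
  -- unchanged guess wrong. The map σ chosen from this carries the weight of A \ F into F.
  have hex : ∀ z : ι → U × V, ∃ z', z ∈ A \ F →
      z' ∈ F ∧ θ * w z ≤ w z' ∧ g z' = g z ∧ ∀ i, (z' i).2 = (z i).2 := by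
    intro z
    by_cases hz : z ∈ A \ F
    · obtain ⟨hzA, hzF⟩ := Finset.mem_sdiff.1 hz
      obtain ⟨i, j, h⟩ := (Finset.mem_filter.1 hzA).2
      obtain ⟨hne, hle⟩ := hT _ _ h
      have hij : i ≠ j := fun e => hne (by rw [e])
      have hgz : ∀ k, g z k = (z k).1 := by simpa [hF] using hzF
      refine ⟨swapInput i j z, fun _ => ⟨?_, le_prod_swapInput hq0 hij z hle, hg i j z,
        fun _ => rfl⟩⟩
      refine Finset.mem_filter.2 ⟨Finset.mem_univ _, i, ?_⟩
      rw [hg, hgz]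
      simpa [swapInput] using hne
    · exact ⟨z, fun h => absurd h hz⟩
  choose σ hσ using hex
  -- On A \ F the inputs are the guess, which σ does not change, and the outputs are kept; hence z
  -- can be recovered from σ z.
  have hinj : Set.InjOn σ (A \ F : Finset _) := by
    intro z hz z' hz' h
    obtain ⟨-, -, h1, h2⟩ := hσ z hz
    obtain ⟨-, -, h1', h2'⟩ := hσ z' hz'
    have hgz : ∀ k, g z k = (z k).1 := by simpa [hF] using (Finset.mem_sdiff.1 hz).2
    have hgz' : ∀ k, g z' k = (z' k).1 := by simpa [hF] using (Finset.mem_sdiff.1 hz').2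
    ext k
    · rw [← hgz, ← hgz', ← h1, ← h1', h]
    · rw [← h2, ← h2', h]
  have hsd : θ * ∑ z ∈ A \ F, w z ≤ ∑ z ∈ F, w z := by
    rw [Finset.mul_sum]
    calc ∑ z ∈ A \ F, θ * w z ≤ ∑ z ∈ A \ F, w (σ z) :=
          Finset.sum_le_sum fun z hz => (hσ z hz).2.1
      _ = ∑ z ∈ (A \ F).image σ, w z := (Finset.sum_image hinj).symm
      _ ≤ ∑ z ∈ F, w z := by
          refine Finset.sum_le_sum_of_subset_of_nonneg ?_ fun z _ _ => hw0 z
          intro z hz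
          obtain ⟨z', hz', rfl⟩ := Finset.mem_image.1 hz
          exact (hσ z' hz').1
  have hin : θ * ∑ z ∈ A ∩ F, w z ≤ ∑ z ∈ F, w z := by
    have h1 : ∑ z ∈ A ∩ F, w z ≤ ∑ z ∈ F, w z :=
      Finset.sum_le_sum_of_subset_of_nonneg Finset.inter_subset_right fun z _ _ => hw0 z
    have h2 : 0 ≤ ∑ z ∈ A ∩ F, w z := Finset.sum_nonneg fun z _ => hw0 z
    nlinarith
  rw [← Finset.sum_inter_add_sum_sdiff A F, mul_add, two_mul]
  exact add_le_add hin hsd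

end PairEvents

end SeqReorder

namespace SeqReorder

/-! ### Random interchanges within pairs, and two bounds for the pairs that resist them -/

section Orientation

open scoped Classical

variable {κ U V : Type*} [Fintype κ] [Fintype U] [Fintype V]

/-- Interchanging the two inputs, but not the outputs, of a pair. -/
def flipInput (ω : (U × V) × (U × V)) : (U × V) × (U × V) :=
  ((ω.2.1, ω.1.2), (ω.1.1, ω.2.2))

/-- Interchanging the two inputs of the pairs selected by `s`. -/
def flipInputOn (s : κ → Bool) (c : κ → (U × V) × (U × V)) : κ → (U × V) × (U × V) :=
  fun k => if s k then flipInput (c k) else c k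

/-- Both inputs of a pair differ from the guess. -/
def BothWrong (g : U × U) (ω : (U × V) × (U × V)) : Prop :=
  g.1 ≠ ω.1.1 ∧ g.2 ≠ ω.2.1

/-- In no order do both inputs of the pair differ from the guess. -/
def Protected (g : U × U) (ω : (U × V) × (U × V)) : Prop :=
  ¬ BothWrong g ω ∧ ¬ BothWrong g (flipInput ω)

omit [Fintype U] [Fintype V] in
theorem flipInput_flipInput (ω : (U × V) × (U × V)) : flipInput (flipInput ω) = ω := rfl

omit [Fintype κ] [Fintype U] [Fintype V] in
theorem flipInputOn_involutive (s : κ → Bool) :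
    Function.Involutive (flipInputOn (U := U) (V := V) s) := by
  intro c
  ext k : 1
  simp only [flipInputOn]
  split_ifs
  · rw [flipInput_flipInput]
  · rfl

theorem pmean_flipInputOn {ρ : (U × V) × (U × V) → ℝ} (hρ : ∀ ω, ρ (flipInput ω) = ρ ω)
    (s : κ → Bool) (F : (κ → (U × V) × (U × V)) → ℝ) :
    pmean ρ (fun c => F (flipInputOn s c)) = pmean ρ F := by
  unfold pmean
  rw [← Equiv.sum_comp (flipInputOn_involutive s).toPerm fun c => (∏ k, ρ (c k)) * F c]
  refine Finset.sum_congr rfl fun c _ => ?_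
  change _ = (∏ k, ρ (flipInputOn s c k)) * F (flipInputOn s c)
  congr 1
  refine Finset.prod_congr rfl fun k _ => ?_
  simp only [flipInputOn]
  split_ifs
  · rw [hρ]
  · rfl

/-- Random interchanges of the inputs of pairs make a guess fail on all unprotected pairs with
probability at least `2 ^ (-K)` for `K` pairs. -/
theorem pmean_card_protected_le {ρ : (U × V) × (U × V) → ℝ} (hρ0 : ∀ ω, 0 ≤ ρ ω)
    (hρ : ∀ ω, ρ (flipInput ω) = ρ ω)
    (g : (κ → (U × V) × (U × V)) → κ → U × U) (hg : ∀ s c, g (flipInputOn s c) = g c) (t : ℝ) :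
    pmean ρ (fun c => if ((Finset.univ.filter fun k => Protected (g c k) (c k)).card : ℝ) ≤ t
      then 1 else 0) ≤
    2 ^ Fintype.card κ * pmean ρ (fun c =>
      if Fintype.card κ - t ≤ ((Finset.univ.filter fun k => BothWrong (g c k) (c k)).card : ℝ)
      then 1 else 0) := by
  set H : (κ → (U × V) × (U × V)) → ℝ := fun c =>
    if Fintype.card κ - t ≤ ((Finset.univ.filter fun k => BothWrong (g c k) (c k)).card : ℝ)
      then 1 else 0 with hH
  have hH0 : ∀ c, 0 ≤ H c := fun c => by simp only [hH]; split_ifs <;> norm_num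
  -- Each of the 2^K patterns of interchanges preserves the law, so it is enough to find one good
  -- pattern for every configuration.
  have h1 : (2 : ℝ) ^ Fintype.card κ * pmean ρ H =
      pmean ρ (fun c => ∑ s : κ → Bool, H (flipInputOn s c)) := by
    rw [pmean_sum]
    simp only [pmean_flipInputOn hρ]
    rw [Finset.sum_const, nsmul_eq_mul, Finset.card_univ, Fintype.card_fun, Fintype.card_bool]
    push_cast
    rfl
  rw [h1]
  refine pmean_mono hρ0 fun c => ?_
  split_ifs with hc
  -- Flip exactly the pairs that are not already wrong twice. The guess does not react to flips, and
  -- an unprotected pair is wrong twice in at least one order.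
  · set s : κ → Bool := fun k => decide (¬ BothWrong (g c k) (c k)) with hs
    refine le_trans ?_ (Finset.single_le_sum (f := fun s => H (flipInputOn s c))
      (fun s _ => hH0 _) (Finset.mem_univ s))
    simp only [hH]
    rw [if_pos]
    have hsub : (Finset.univ.filter fun k => ¬ Protected (g c k) (c k)) ⊆
        Finset.univ.filter fun k =>
          BothWrong (g (flipInputOn s c) k) (flipInputOn s c k) := by
      intro k hk
      have hk' : BothWrong (g c k) (c k) ∨ BothWrong (g c k) (flipInput (c k)) := by
        have := (Finset.mem_filter.1 hk).2
        unfold Protected at this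
        tauto
      refine Finset.mem_filter.2 ⟨Finset.mem_univ _, ?_⟩
      rw [hg]
      by_cases hb : BothWrong (g c k) (c k)
      · simp [flipInputOn, hs, hb]
      · simpa [flipInputOn, hs, hb] using hk'
    have hcard := Finset.card_le_card hsub
    have hadd := Finset.card_filter_add_card_filter_not (s := (Finset.univ : Finset κ))
      (fun k => Protected (g c k) (c k))
    rw [Finset.card_univ] at hadd
    have hadd' : ((Finset.univ.filter fun k => Protected (g c k) (c k)).card : ℝ) +
      ((Finset.univ.filter fun k => ¬ Protected (g c k) (c k)).card : ℝ) = Fintype.card κ := by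
      exact_mod_cast hadd
    have hcard' : ((Finset.univ.filter fun k => ¬ Protected (g c k) (c k)).card : ℝ) ≤
      ((Finset.univ.filter fun k =>
          BothWrong (g (flipInputOn s c) k) (flipInputOn s c k)).card : ℝ) := by
      exact_mod_cast hcard
    linarith
  · exact Finset.sum_nonneg fun s _ => hH0 _

/-- One of the two inputs of the pair agrees with the guess. -/
def Hit (g : U × U) (ω : (U × V) × (U × V)) : Prop :=
  g.1 = ω.1.1 ∨ g.2 = ω.2.1

omit [Fintype U] [Fintype V] in
theorem Protected.hit {g : U × U} {ω : (U × V) × (U × V)} (h : Protected g ω) : Hit g ω := by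
  have := h.1
  unfold BothWrong at this
  unfold Hit
  tauto

theorem sum_pairs_eq (F : (κ → (U × V) × (U × V)) → ℝ) :
    ∑ c, F c = ∑ y : κ → V × V, ∑ x : κ → U × U,
      F (fun k => (((x k).1, (y k).1), ((x k).2, (y k).2))) := by
  rw [← Fintype.sum_prod_type']
  refine Fintype.sum_equiv
    ⟨fun c => (fun k => ((c k).1.2, (c k).2.2), fun k => ((c k).1.1, (c k).2.1)),
      fun p => fun k => (((p.2 k).1, (p.1 k).1), ((p.2 k).2, (p.1 k).2)),
      fun c => rfl, fun p => rfl⟩ _ _ fun c => rfl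

theorem sum_pair_eq (F : (U × V) × (U × V) → ℝ) :
    ∑ ω, F ω = ∑ y : V × V, ∑ x : U × U, F ((x.1, y.1), (x.2, y.2)) := by
  rw [← Fintype.sum_prod_type']
  exact Fintype.sum_equiv
    ⟨fun ω => ((ω.1.2, ω.2.2), (ω.1.1, ω.2.1)), fun p => ((p.2.1, p.1.1), (p.2.2, p.1.2)),
      fun c => rfl, fun p => rfl⟩ _ _ fun c => rfl

/-- A Chernoff bound for the number of pairs hit by a guess based on the outputs. -/
theorem pmean_many_hits_le {ρ : (U × V) × (U × V) → ℝ} (hρ0 : ∀ ω, 0 ≤ ρ ω)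
    (hρ1 : ∑ ω, ρ ω = 1) {h : V × V → ℝ} (hh0 : ∀ y, 0 ≤ h y)
    {γ : ℝ} (hγ0 : 0 < γ) (hγ1 : γ ≤ 1)
    (hh : ∀ (g : U × U) (y : V × V), ∑ x : U × U, ρ ((x.1, y.1), (x.2, y.2)) *
      (if Hit g ((x.1, y.1), (x.2, y.2)) then 1 else 0) ≤ h y)
    (hhγ : ∑ y, h y ≤ γ) (Γ : (κ → V × V) → κ → U × U) (t : ℝ) :
    pmean ρ (fun c => if t ≤ ((Finset.univ.filter fun k =>
      Hit (Γ (fun k => ((c k).1.2, (c k).2.2)) k) (c k)).card : ℝ) then 1 else 0) ≤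
    2 ^ Fintype.card κ * γ ^ t := by
  -- Chernoff's method: every hit carries the weight γ⁻¹, so on the event the product of the weights
  -- is at least γ^(-t).
  set e : U × U → (U × V) × (U × V) → ℝ := fun g ω => if Hit g ω then γ⁻¹ else 1 with he
  have he0 : ∀ g ω, 0 ≤ e g ω := fun g ω => by simp only [he]; split_ifs <;> positivity
  have hpt : ∀ c : κ → (U × V) × (U × V), (if t ≤ ((Finset.univ.filter fun k =>
      Hit (Γ (fun k => ((c k).1.2, (c k).2.2)) k) (c k)).card : ℝ) then (1 : ℝ) else 0) ≤
      γ ^ t * ∏ k, e (Γ (fun k => ((c k).1.2, (c k).2.2)) k) (c k) := by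
    intro c
    split_ifs with ht
    · simp only [he]
      rw [Finset.prod_ite, Finset.prod_const, Finset.prod_const_one, mul_one]
      set n := (Finset.univ.filter fun k =>
        Hit (Γ (fun k => ((c k).1.2, (c k).2.2)) k) (c k)).card
      rw [inv_pow, ← Real.rpow_natCast, ← Real.rpow_neg hγ0.le, ← Real.rpow_add hγ0]
      exact Real.one_le_rpow_of_pos_of_le_one_of_nonpos hγ0 hγ1 (by linarith)
    · exact mul_nonneg (Real.rpow_nonneg hγ0.le _) (Finset.prod_nonneg fun k _ => he0 _ _)
  refine (pmean_mono hρ0 hpt).trans ?_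
  rw [pmean_const_mul, mul_comm]
  refine mul_le_mul_of_nonneg_right ?_ (Real.rpow_nonneg hγ0.le _)
  unfold pmean
  rw [sum_pairs_eq]
  have hk : ∀ (y : V × V) (g : U × U), ∑ x : U × U, ρ ((x.1, y.1), (x.2, y.2)) *
      e g ((x.1, y.1), (x.2, y.2)) ≤
      ∑ x : U × U, ρ ((x.1, y.1), (x.2, y.2)) + γ⁻¹ * h y := by
    intro y g
    refine le_trans ?_ (add_le_add le_rfl (mul_le_mul_of_nonneg_left (hh g y)
      (inv_nonneg.2 hγ0.le)))
    rw [Finset.mul_sum, ← Finset.sum_add_distrib]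
    refine Finset.sum_le_sum fun x _ => ?_
    have := hρ0 ((x.1, y.1), (x.2, y.2))
    simp only [he]
    split_ifs
    · have h1 : 0 ≤ γ⁻¹ := inv_nonneg.2 hγ0.le
      nlinarith
    · simp
  -- Once the outputs are fixed the guess is a constant, so the sum over the inputs factorizes over
  -- the pairs. Summing over the outputs then bounds each factor by 1 + γ⁻¹ ∑ h ≤ 2.
  calc ∑ y : κ → V × V, ∑ x : κ → U × U,
        (∏ k, ρ (((x k).1, (y k).1), ((x k).2, (y k).2))) *
          ∏ k, e (Γ y k) (((x k).1, (y k).1), ((x k).2, (y k).2))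
      = ∑ y : κ → V × V, ∏ k, ∑ x : U × U, ρ ((x.1, (y k).1), (x.2, (y k).2)) *
          e (Γ y k) ((x.1, (y k).1), (x.2, (y k).2)) := by
        refine Finset.sum_congr rfl fun y _ => ?_
        rw [Finset.prod_univ_sum, Fintype.piFinset_univ]
        exact Finset.sum_congr rfl fun x _ => Finset.prod_mul_distrib.symm
    _ ≤ ∑ y : κ → V × V, ∏ k, (∑ x : U × U, ρ ((x.1, (y k).1), (x.2, (y k).2))
          + γ⁻¹ * h (y k)) := by
        refine Finset.sum_le_sum fun y _ => Finset.prod_le_prod (fun k _ => ?_) fun k _ => hk _ _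
        exact Finset.sum_nonneg fun x _ => mul_nonneg (hρ0 _) (he0 _ _)
    _ = ∏ _k : κ, ∑ y : V × V, (∑ x : U × U, ρ ((x.1, y.1), (x.2, y.2)) + γ⁻¹ * h y) := by
        rw [Finset.prod_univ_sum, Fintype.piFinset_univ]
    _ ≤ 2 ^ Fintype.card κ := by
        rw [Finset.prod_const, Finset.card_univ]
        rw [sum_pair_eq] at hρ1
        have h0 : 0 ≤ ∑ y, h y := Finset.sum_nonneg fun y _ => hh0 y
        rw [Finset.sum_add_distrib, hρ1, ← Finset.mul_sum]
        have h1 : γ⁻¹ * ∑ y, h y ≤ 1 := by rwa [inv_mul_eq_div, div_le_one hγ0]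
        have h2 : 0 ≤ γ⁻¹ * ∑ y, h y := by positivity
        exact pow_le_pow_left₀ (by linarith) (by linarith) _

/-- A union bound over the possible values of a label on which the guess depends. -/
theorem pmean_many_hits_le_of_label {α : Type*} {ρ : (U × V) × (U × V) → ℝ} (hρ0 : ∀ ω, 0 ≤ ρ ω)
    (hρ1 : ∑ ω, ρ ω = 1) {h : V × V → ℝ} (hh0 : ∀ y, 0 ≤ h y)
    {γ : ℝ} (hγ0 : 0 < γ) (hγ1 : γ ≤ 1)
    (hh : ∀ (g : U × U) (y : V × V), ∑ x : U × U, ρ ((x.1, y.1), (x.2, y.2)) *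
      (if Hit g ((x.1, y.1), (x.2, y.2)) then 1 else 0) ≤ h y)
    (hhγ : ∑ y, h y ≤ γ) (A : Finset α) (l : (κ → (U × V) × (U × V)) → α)
    (hl : ∀ c, (∀ k, ρ (c k) ≠ 0) → l c ∈ A) (Γ : α → (κ → V × V) → κ → U × U) (t : ℝ) :
    pmean ρ (fun c => if t ≤ ((Finset.univ.filter fun k =>
      Hit (Γ (l c) (fun k => ((c k).1.2, (c k).2.2)) k) (c k)).card : ℝ) then 1 else 0) ≤
    A.card * (2 ^ Fintype.card κ * γ ^ t) := by
  rw [← nsmul_eq_mul, ← Finset.sum_const]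
  refine le_trans ?_ (Finset.sum_le_sum fun a _ =>
    pmean_many_hits_le hρ0 hρ1 hh0 hγ0 hγ1 hh hhγ (Γ a) t)
  rw [← pmean_sum]
  refine Finset.sum_le_sum fun c _ => ?_
  by_cases hc : ∀ k, ρ (c k) ≠ 0
  · refine mul_le_mul_of_nonneg_left ?_ (Finset.prod_nonneg fun _ _ => hρ0 _)
    exact Finset.single_le_sum (f := fun a => if t ≤ ((Finset.univ.filter fun k =>
      Hit (Γ a (fun k => ((c k).1.2, (c k).2.2)) k) (c k)).card : ℝ) then (1 : ℝ) else 0)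
      (fun a _ => by split_ifs <;> norm_num) (hl c hc)
  · push Not at hc
    obtain ⟨k, hk⟩ := hc
    rw [Finset.prod_eq_zero (Finset.mem_univ k) hk, zero_mul, zero_mul]

/-- Markov's inequality for the number of pairs that have equal inputs or share an input with
another pair or with a given set. -/
theorem pmean_many_collisions_le [DecidableEq U] {ρ : (U × V) × (U × V) → ℝ} (hρ0 : ∀ ω, 0 ≤ ρ ω)
    (hρ1 : ∑ ω, ρ ω = 1) {p₀ p₁ : ℝ} (hp₁ : 0 ≤ p₁)
    (h₀ : ∑ ω, ρ ω * (if ω.1.1 = ω.2.1 then 1 else 0) ≤ p₀)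
    (h₁ : ∀ u, ∑ ω, ρ ω * (if ω.1.1 = u then 1 else 0) ≤ p₁)
    (h₂ : ∀ u, ∑ ω, ρ ω * (if ω.2.1 = u then 1 else 0) ≤ p₁)
    (S : Finset U) (B : (κ → (U × V) × (U × V)) → κ → Prop)
    (hB : ∀ c k, B c k → (c k).1.1 = (c k).2.1 ∨
      ∃ u, ((c k).1.1 = u ∨ (c k).2.1 = u) ∧
        (u ∈ S ∨ ∃ k' ≠ k, (c k').1.1 = u ∨ (c k').2.1 = u))
    {t : ℝ} (ht : 0 < t) :
    pmean ρ (fun c => if t ≤ ((Finset.univ.filter fun k => B c k).card : ℝ) then 1 else 0) ≤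
      Fintype.card κ * (p₀ + 2 * (S.card + 2 * Fintype.card κ) * p₁) / t := by
  have hpt : ∀ c : κ → (U × V) × (U × V),
      (if t ≤ ((Finset.univ.filter fun k => B c k).card : ℝ) then (1 : ℝ) else 0) ≤
      t⁻¹ * ∑ k, if B c k then 1 else 0 := by
    intro c
    rw [Finset.sum_boole]
    split_ifs with h
    · rwa [inv_mul_eq_div, le_div_iff₀ ht, one_mul]
    · positivity
  refine (pmean_mono hρ0 hpt).trans ?_
  rw [pmean_const_mul, pmean_sum, inv_mul_eq_div]
  refine div_le_div_of_nonneg_right ?_ ht.le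
  rw [← nsmul_eq_mul, ← Finset.card_univ, ← Finset.sum_const]
  refine Finset.sum_le_sum fun k _ => ?_
  rw [pmean_resample hρ1 k]
  refine le_trans (pmean_mono hρ0 fun c => ?_) (le_of_eq (pmean_const hρ1 _))
  -- Only the k-th pair is redrawn, so the inputs it must avoid form a fixed set. The old k-th pair
  -- is included as well, which does no harm.
  set S' : Finset U := S ∪ ((Finset.univ.image fun k => (c k).1.1) ∪
    (Finset.univ.image fun k => (c k).2.1)) with hS'
  have hcard : (S'.card : ℝ) ≤ S.card + 2 * (Finset.univ : Finset κ).card := by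
    have h1 := Finset.card_union_le S ((Finset.univ.image fun k => (c k).1.1) ∪
      (Finset.univ.image fun k => (c k).2.1))
    have h2 := Finset.card_union_le (Finset.univ.image fun k => (c k).1.1)
      (Finset.univ.image fun k => (c k).2.1)
    have h3 := Finset.card_image_le (s := Finset.univ) (f := fun k => (c k).1.1)
    have h4 := Finset.card_image_le (s := Finset.univ) (f := fun k => (c k).2.1)
    have : S'.card ≤ S.card + 2 * (Finset.univ : Finset κ).card := by
      rw [hS']; omega
    exact_mod_cast this
  have hb : ∀ ω, (if B (Function.update c k ω) k then (1 : ℝ) else 0) ≤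
      (if ω.1.1 = ω.2.1 then 1 else 0) +
      ((∑ u ∈ S', if ω.1.1 = u then 1 else 0) + ∑ u ∈ S', if ω.2.1 = u then 1 else 0) := by
    intro ω
    have n1 : (0 : ℝ) ≤ if ω.1.1 = ω.2.1 then 1 else 0 := by split_ifs <;> norm_num
    have n2 : (0 : ℝ) ≤ ∑ u ∈ S', if ω.1.1 = u then 1 else 0 :=
      Finset.sum_nonneg fun u _ => by split_ifs <;> norm_num
    have n3 : (0 : ℝ) ≤ ∑ u ∈ S', if ω.2.1 = u then 1 else 0 :=
      Finset.sum_nonneg fun u _ => by split_ifs <;> norm_num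
    split_ifs with h h'
    · linarith
    · have := hB _ _ h
      simp only [Function.update_self, h', false_or] at this
      obtain ⟨u, hu, hu'⟩ := this
      have huS : u ∈ S' := by
        rcases hu' with hu' | ⟨k', hk', hu'⟩
        · exact Finset.mem_union_left _ hu'
        · rw [Function.update_of_ne hk'] at hu'
          refine Finset.mem_union_right _ ?_
          rcases hu' with hu' | hu'
          · exact Finset.mem_union_left _ (Finset.mem_image.2 ⟨k', Finset.mem_univ _, hu'⟩)
          · exact Finset.mem_union_right _ (Finset.mem_image.2 ⟨k', Finset.mem_univ _, hu'⟩)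
      rcases hu with hu | hu
      · have : (1 : ℝ) ≤ ∑ u ∈ S', if ω.1.1 = u then 1 else 0 := by
          simp [hu, huS]
        linarith
      · have : (1 : ℝ) ≤ ∑ u ∈ S', if ω.2.1 = u then 1 else 0 := by
          simp [hu, huS]
        linarith
    · linarith
    · linarith
  refine (Finset.sum_le_sum fun ω _ => mul_le_mul_of_nonneg_left (hb ω) (hρ0 ω)).trans ?_
  simp only [mul_add, Finset.sum_add_distrib, Finset.mul_sum]
  rw [Finset.sum_comm (s := Finset.univ) (t := S'), Finset.sum_comm (s := Finset.univ) (t := S')]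
  have e1 := Finset.sum_le_sum fun u (_ : u ∈ S') => h₁ u
  have e2 := Finset.sum_le_sum fun u (_ : u ∈ S') => h₂ u
  rw [Finset.sum_const, nsmul_eq_mul] at e1 e2
  have e3 := mul_le_mul_of_nonneg_right hcard hp₁
  linarith

end Orientation

end SeqReorder

namespace SeqReorder

/-! ### The tilted law on pairs of letters and the formula for ψ₂ -/

section TiltedLaw

open scoped Classical

variable {𝒳 𝒴 : Type*} [Fintype 𝒳] [Fintype 𝒴]

/-- The Bhattacharyya coefficient of two input letters. -/
noncomputable def bhattacharyyaCoeff (W : 𝒳 → 𝒴 → ℝ) (a b : 𝒳) : ℝ :=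
  ∑ y, √(W a y * W b y)

/-- The mean squared Bhattacharyya coefficient of two independent letters. -/
noncomputable def meanSqCoeff (P : 𝒳 → ℝ) (W : 𝒳 → 𝒴 → ℝ) : ℝ :=
  ∑ p : 𝒳 × 𝒳, P p.1 * P p.2 * bhattacharyyaCoeff W p.1 p.2 ^ 2

/-- The joint law of an input letter and its output. -/
def jointLaw (P : 𝒳 → ℝ) (W : 𝒳 → 𝒴 → ℝ) (a : 𝒳 × 𝒴) : ℝ :=
  P a.1 * W a.1 a.2

/-- The law on two pairs of an input and an output under which the true and the interchanged
inputs are balanced. -/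
noncomputable def tiltedLaw (P : 𝒳 → ℝ) (W : 𝒳 → 𝒴 → ℝ) (ω : (𝒳 × 𝒴) × (𝒳 × 𝒴)) : ℝ :=
  √(jointLaw P W ω.1 * jointLaw P W ω.2 *
    (jointLaw P W (flipInput ω).1 * jointLaw P W (flipInput ω).2)) / meanSqCoeff P W

/-- The log-likelihood ratio of the interchanged and the true inputs. -/
noncomputable def flipLogRatio (P : 𝒳 → ℝ) (W : 𝒳 → 𝒴 → ℝ) (ω : (𝒳 × 𝒴) × (𝒳 × 𝒴)) :
    ℝ :=
  Real.log (jointLaw P W (flipInput ω).1 * jointLaw P W (flipInput ω).2) -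
    Real.log (jointLaw P W ω.1 * jointLaw P W ω.2)

/-- The marginal of the tilted law on one input and its output. -/
noncomputable def tiltedMarginal (P : 𝒳 → ℝ) (W : 𝒳 → 𝒴 → ℝ) (a : 𝒳 × 𝒴) : ℝ :=
  ∑ b, tiltedLaw P W (a, b)

/-- The marginal of the tilted law on one input. -/
noncomputable def tiltedInput (P : 𝒳 → ℝ) (W : 𝒳 → 𝒴 → ℝ) (a : 𝒳) : ℝ :=
  ∑ y, tiltedMarginal P W (a, y)

/-- The logarithm of the density of the tilted marginal. -/
noncomputable def marginalLogDensity (P : 𝒳 → ℝ) (W : 𝒳 → 𝒴 → ℝ) (a : 𝒳 × 𝒴) : ℝ :=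
  Real.log (tiltedMarginal P W a / jointLaw P W a)

variable {P : 𝒳 → ℝ} {W : 𝒳 → 𝒴 → ℝ}

omit [Fintype 𝒳] in
theorem bhattacharyyaCoeff_pos {a b : 𝒳} (h : bhattacharyyaDist W a b < ⊤) :
    0 < bhattacharyyaCoeff W a b := by
  unfold bhattacharyyaDist at h
  by_contra hn
  have : ENNReal.ofReal (∑ y, √(W a y * W b y)) = 0 := ENNReal.ofReal_eq_zero.2 (not_lt.1 hn)
  rw [this] at h
  simp at h

omit [Fintype 𝒳] in
theorem toReal_bhattacharyyaDist {a b : 𝒳} (h : bhattacharyyaDist W a b < ⊤) :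
    (bhattacharyyaDist W a b).toReal = -Real.log (bhattacharyyaCoeff W a b) := by
  have := bhattacharyyaCoeff_pos h
  unfold bhattacharyyaDist
  unfold bhattacharyyaCoeff at *
  rw [EReal.toReal_neg_eq, ENNReal.log_ofReal_of_pos this, EReal.toReal_coe]

omit [Fintype 𝒳] in
theorem bhattacharyyaCoeff_self (hW : ∀ a, W a ∈ stdSimplex ℝ 𝒴) (a : 𝒳) :
    bhattacharyyaCoeff W a a = 1 := by
  unfold bhattacharyyaCoeff
  rw [← (hW a).2]
  exact Finset.sum_congr rfl fun y _ => Real.sqrt_mul_self ((hW a).1 y)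

theorem meanSqCoeff_pos (hP : P ∈ stdSimplex ℝ 𝒳) (hPpos : ∀ a, 0 < P a)
    (hd : ∀ a b, bhattacharyyaDist W a b < ⊤) : 0 < meanSqCoeff P W := by
  have hne : Nonempty 𝒳 := by
    by_contra h
    rw [not_nonempty_iff] at h
    simpa using hP.2
  refine Finset.sum_pos (fun p _ => ?_) Finset.univ_nonempty
  have := bhattacharyyaCoeff_pos (hd p.1 p.2)
  have := hPpos p.1
  have := hPpos p.2
  positivity

/-- The objective in the definition of `psi₂` as a divergence. -/
theorem psi₂_objective_eq (hPpos : ∀ a, 0 < P a) (hd : ∀ a b, bhattacharyyaDist W a b < ⊤)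
    (Q : 𝒳 × 𝒳 → ℝ) : 1 / 2 * klProd P Q + bhattacharyyaJoint W Q =
      1 / 2 * ∑ p, Q p * Real.log (Q p / (P p.1 * P p.2 * bhattacharyyaCoeff W p.1 p.2 ^ 2)) := by
  unfold klProd bhattacharyyaJoint
  rw [Finset.mul_sum, Finset.mul_sum, ← Finset.sum_add_distrib]
  refine Finset.sum_congr rfl fun p _ => ?_
  have h1 := bhattacharyyaCoeff_pos (hd p.1 p.2)
  have h2 := hPpos p.1
  have h3 := hPpos p.2
  rw [toReal_bhattacharyyaDist (hd _ _)]
  by_cases hQ : Q p = 0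
  · simp [hQ]
  · rw [Real.log_div hQ (by positivity), Real.log_div hQ (by positivity),
      Real.log_mul (x := P p.1 * P p.2) (by positivity) (by positivity), Real.log_pow]
    push_cast
    ring

/-- By `psi₂_objective_eq` the objective is half the relative entropy of Q with respect to the
unnormalized weights P(a) P(b) BC(a, b)², BC being the Bhattacharyya coefficient. By Gibbs'
inequality the minimum is attained at the normalized weights. -/
theorem psi₂_eq (hP : P ∈ stdSimplex ℝ 𝒳) (hPpos : ∀ a, 0 < P a)
    (hd : ∀ a b, bhattacharyyaDist W a b < ⊤) :
    psi₂ P W = -(1 / 2) * Real.log (meanSqCoeff P W) := by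
  have hZ := meanSqCoeff_pos hP hPpos hd
  set Z := meanSqCoeff P W with hZdef
  set μ : 𝒳 × 𝒳 → ℝ := fun p => P p.1 * P p.2 * bhattacharyyaCoeff W p.1 p.2 ^ 2 with hμ
  have hμpos : ∀ p, 0 < μ p := fun p => by
    have h1 := bhattacharyyaCoeff_pos (hd p.1 p.2)
    have h2 := hPpos p.1
    have h3 := hPpos p.2
    simp only [hμ]; positivity
  have hμsum : ∑ p, μ p = Z := rfl
  have hlow : ∀ Q ∈ stdSimplex ℝ (𝒳 × 𝒳), -(1 / 2) * Real.log Z ≤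
      1 / 2 * klProd P Q + bhattacharyyaJoint W Q := by
    intro Q hQ
    rw [psi₂_objective_eq hPpos hd]
    -- This is log t ≤ t - 1 at t = μ / (Z Q); the correction terms cancel after summation.
    have hterm : ∀ p, Q p * (-Real.log Z) + (Q p - μ p / Z) ≤ Q p * Real.log (Q p / μ p) := by
      intro p
      have hm := hμpos p
      rcases (hQ.1 p).eq_or_lt with h0 | h0
      · rw [← h0]
        have : 0 < μ p / Z := by positivity
        simp only [zero_mul]; linarith
      · have hl := Real.log_le_sub_one_of_pos (x := μ p / (Z * Q p)) (by positivity)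
        rw [Real.log_div hm.ne' (by positivity), Real.log_mul hZ.ne' h0.ne'] at hl
        rw [Real.log_div h0.ne' hm.ne']
        have h2 := mul_le_mul_of_nonneg_left hl h0.le
        have h3 : Q p * (μ p / (Z * Q p) - 1) = μ p / Z - Q p := by field_simp
        rw [h3] at h2
        linarith
    have hs := Finset.sum_le_sum fun p (_ : p ∈ Finset.univ) => hterm p
    rw [Finset.sum_add_distrib, Finset.sum_sub_distrib, ← Finset.sum_mul, ← Finset.sum_div,
      hQ.2, hμsum, div_self hZ.ne'] at hs
    linarith
  have hmem : -(1 / 2) * Real.log Z ∈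
      (fun Q => 1 / 2 * klProd P Q + bhattacharyyaJoint W Q) '' stdSimplex ℝ (𝒳 × 𝒳) := by
    refine ⟨fun p => μ p / Z, ⟨fun p => (div_pos (hμpos p) hZ).le, ?_⟩, ?_⟩
    · rw [← Finset.sum_div, hμsum, div_self hZ.ne']
    · dsimp only
      rw [psi₂_objective_eq hPpos hd]
      have : ∀ p, μ p / Z * Real.log (μ p / Z / μ p) = μ p * (-Real.log Z / Z) := by
        intro p
        have hm := (hμpos p).ne'
        rw [div_div, div_mul_cancel_right₀ hm, Real.log_inv]
        ring
      rw [Finset.sum_congr rfl fun p _ => this p, ← Finset.sum_mul, hμsum]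
      field_simp
  exact le_antisymm (csInf_le ⟨_, fun _ ⟨Q, hQ, h⟩ => (hlow Q hQ).trans_eq h⟩ hmem)
    (le_csInf ⟨_, hmem⟩ fun _ ⟨Q, hQ, h⟩ => (hlow Q hQ).trans_eq h)

/-- With a single letter all Bhattacharyya coefficients are 1, so the normalizing constant is 1 and
ψ₂ vanishes. -/
theorem exists_ne_of_psi₂_pos (hP : P ∈ stdSimplex ℝ 𝒳) (hPpos : ∀ a, 0 < P a)
    (hW : ∀ a, W a ∈ stdSimplex ℝ 𝒴) (hd : ∀ a b, bhattacharyyaDist W a b < ⊤)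
    (hψ : 0 < psi₂ P W) : ∃ a b : 𝒳, a ≠ b := by
  by_contra h
  push Not at h
  rw [psi₂_eq hP hPpos hd] at hψ
  have : meanSqCoeff P W = 1 := by
    unfold meanSqCoeff
    rw [Fintype.sum_prod_type]
    have h1 : ∀ a b, bhattacharyyaCoeff W a b = 1 := fun a b => by
      rw [h b a, bhattacharyyaCoeff_self hW]
    simp only [h1, one_pow, mul_one, ← Finset.mul_sum, hP.2]
  rw [this] at hψ
  simp at hψ

omit [Fintype 𝒳] in
theorem jointLaw_nonneg (hPpos : ∀ a, 0 < P a) (hW : ∀ a, W a ∈ stdSimplex ℝ 𝒴) (a : 𝒳 × 𝒴) :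
    0 ≤ jointLaw P W a :=
  mul_nonneg (hPpos _).le ((hW _).1 _)

theorem sum_jointLaw (hP : P ∈ stdSimplex ℝ 𝒳) (hW : ∀ a, W a ∈ stdSimplex ℝ 𝒴) :
    ∑ a, jointLaw P W a = 1 := by
  rw [Fintype.sum_prod_type]
  simp only [jointLaw, ← Finset.mul_sum, (hW _).2, mul_one, hP.2]

theorem tiltedLaw_nonneg (hP : P ∈ stdSimplex ℝ 𝒳) (hPpos : ∀ a, 0 < P a)
    (hd : ∀ a b, bhattacharyyaDist W a b < ⊤) (ω) : 0 ≤ tiltedLaw P W ω :=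
  div_nonneg (Real.sqrt_nonneg _) (meanSqCoeff_pos hP hPpos hd).le

theorem tiltedLaw_flipInput (ω) : tiltedLaw P W (flipInput ω) = tiltedLaw P W ω := by
  unfold tiltedLaw
  rw [flipInput_flipInput, mul_comm (jointLaw P W (flipInput ω).1 * _)]

theorem tiltedLaw_swap (ω) : tiltedLaw P W ω.swap = tiltedLaw P W ω := by
  unfold tiltedLaw
  congr 2
  simp only [flipInput, Prod.swap]
  ring

theorem tiltedLaw_apply (hPpos : ∀ a, 0 < P a) (hW : ∀ a, W a ∈ stdSimplex ℝ 𝒴)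
    (a b : 𝒳) (y y' : 𝒴) : tiltedLaw P W ((a, y), (b, y')) =
      P a * P b * (√(W a y * W b y) * √(W a y' * W b y')) / meanSqCoeff P W := by
  unfold tiltedLaw
  congr 1
  have h := fun a y => (hW a).1 y
  rw [← Real.sqrt_mul (mul_nonneg (h _ _) (h _ _))]
  rw [← Real.sqrt_sq (mul_pos (hPpos a) (hPpos b)).le, ← Real.sqrt_mul (sq_nonneg _)]
  congr 1
  simp only [jointLaw, flipInput]
  ring

/-- The square root splits into one factor for each output. Summing each output separately gives the
Bhattacharyya coefficient twice, hence its square. -/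
theorem sum_tiltedLaw (hP : P ∈ stdSimplex ℝ 𝒳) (hPpos : ∀ a, 0 < P a)
    (hW : ∀ a, W a ∈ stdSimplex ℝ 𝒴) (hd : ∀ a b, bhattacharyyaDist W a b < ⊤) :
    ∑ ω, tiltedLaw P W ω = 1 := by
  rw [sum_pair_eq, Finset.sum_comm]
  simp only [tiltedLaw_apply hPpos hW, ← Finset.sum_div]
  rw [div_eq_one_iff_eq (meanSqCoeff_pos hP hPpos hd).ne']
  refine Finset.sum_congr rfl fun p _ => ?_
  rw [← Finset.mul_sum, Fintype.sum_prod_type, sq]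
  unfold bhattacharyyaCoeff
  rw [Finset.sum_mul_sum]

theorem jointLaw_pos_of_tiltedLaw (hPpos : ∀ a, 0 < P a) (hW : ∀ a, W a ∈ stdSimplex ℝ 𝒴)
    {ω} (h : tiltedLaw P W ω ≠ 0) :
    0 < jointLaw P W ω.1 ∧ 0 < jointLaw P W ω.2 ∧
    0 < jointLaw P W (flipInput ω).1 ∧ 0 < jointLaw P W (flipInput ω).2 := by
  have hq := jointLaw_nonneg hPpos hW
  unfold tiltedLaw at h
  have h1 := left_ne_zero_of_mul (div_eq_mul_inv _ (meanSqCoeff P W) ▸ h)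
  have h2 : jointLaw P W ω.1 * jointLaw P W ω.2 *
    (jointLaw P W (flipInput ω).1 * jointLaw P W (flipInput ω).2) ≠ 0 := fun h3 => h1 (by
      rw [h3, Real.sqrt_zero])
  simp only [mul_ne_zero_iff] at h2
  exact ⟨(hq _).lt_of_ne' h2.1.1, (hq _).lt_of_ne' h2.1.2, (hq _).lt_of_ne' h2.2.1,
    (hq _).lt_of_ne' h2.2.2⟩

/-- The exact change of measure. For the likelihoods A and A' before and after the interchange, A =
√(A A') · exp(-log(A'/A)/2), and the normalizing constant is exp(-2ψ₂). -/
theorem jointLaw_mul_eq (hP : P ∈ stdSimplex ℝ 𝒳) (hPpos : ∀ a, 0 < P a)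
    (hW : ∀ a, W a ∈ stdSimplex ℝ 𝒴) (hd : ∀ a b, bhattacharyyaDist W a b < ⊤)
    {ω} (h : tiltedLaw P W ω ≠ 0) :
    jointLaw P W ω.1 * jointLaw P W ω.2 =
      Real.exp (-2 * psi₂ P W - flipLogRatio P W ω / 2) * tiltedLaw P W ω := by
  obtain ⟨h1, h2, h3, h4⟩ := jointLaw_pos_of_tiltedLaw hPpos hW h
  have hZ := meanSqCoeff_pos hP hPpos hd
  rw [psi₂_eq hP hPpos hd]
  unfold flipLogRatio tiltedLaw
  set A := jointLaw P W ω.1 * jointLaw P W ω.2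
  set A' := jointLaw P W (flipInput ω).1 * jointLaw P W (flipInput ω).2
  have hA : 0 < A := mul_pos h1 h2
  have hA' : 0 < A' := mul_pos h3 h4
  rw [← Real.exp_log (div_pos (Real.sqrt_pos.2 (mul_pos hA hA')) hZ), ← Real.exp_add,
    Real.log_div (Real.sqrt_pos.2 (mul_pos hA hA')).ne' hZ.ne', Real.log_sqrt (mul_pos hA hA').le,
    Real.log_mul hA.ne' hA'.ne']
  rw [show -2 * (-(1 / 2) * Real.log (meanSqCoeff P W)) - (Real.log A' - Real.log A) / 2 +
    ((Real.log A + Real.log A') / 2 - Real.log (meanSqCoeff P W)) = Real.log A by ring,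
    Real.exp_log hA]

omit [Fintype 𝒳] [Fintype 𝒴] in
theorem flipLogRatio_flipInput (ω) : flipLogRatio P W (flipInput ω) = -flipLogRatio P W ω := by
  unfold flipLogRatio
  rw [flipInput_flipInput]
  ring

theorem sum_comp_flipInput (F : (𝒳 × 𝒴) × (𝒳 × 𝒴) → ℝ) :
    ∑ ω, F (flipInput ω) = ∑ ω, F ω :=
  Equiv.sum_comp (Function.Involutive.toPerm flipInput flipInput_flipInput) F

/-- The interchange preserves the tilted law and negates the ratio. Together with the law of large
numbers this makes the ratio of two typical blocks o(L). -/
theorem sum_tiltedLaw_mul_flipLogRatio :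
    ∑ ω, tiltedLaw P W ω * flipLogRatio P W ω = 0 := by
  have h := sum_comp_flipInput fun ω => tiltedLaw P W ω * flipLogRatio P W ω
  simp only [tiltedLaw_flipInput, flipLogRatio_flipInput, mul_neg, Finset.sum_neg_distrib] at h
  linarith

theorem sum_comp_swap (F : (𝒳 × 𝒴) × (𝒳 × 𝒴) → ℝ) :
    ∑ ω : (𝒳 × 𝒴) × (𝒳 × 𝒴), F ω.swap = ∑ ω, F ω :=
  Equiv.sum_comp (Equiv.prodComm _ _) F

theorem tiltedMarginal_pos_of_tiltedLaw (hP : P ∈ stdSimplex ℝ 𝒳) (hPpos : ∀ a, 0 < P a)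
    (hd : ∀ a b, bhattacharyyaDist W a b < ⊤) {ω} (h : tiltedLaw P W ω ≠ 0) :
    0 < tiltedMarginal P W ω.1 ∧ 0 < tiltedMarginal P W ω.2 := by
  have hR := tiltedLaw_nonneg hP hPpos hd
  constructor
  · exact Finset.sum_pos' (fun b _ => hR _) ⟨ω.2, Finset.mem_univ _, (hR ω).lt_of_ne' h⟩
  · refine Finset.sum_pos' (fun b _ => hR _) ⟨ω.1, Finset.mem_univ _, ?_⟩
    rw [show ((ω.2, ω.1) : (𝒳 × 𝒴) × (𝒳 × 𝒴)) = ω.swap from rfl, tiltedLaw_swap]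
    exact (hR ω).lt_of_ne' h

theorem sum_tiltedMarginal (hP : P ∈ stdSimplex ℝ 𝒳) (hPpos : ∀ a, 0 < P a)
    (hW : ∀ a, W a ∈ stdSimplex ℝ 𝒴) (hd : ∀ a b, bhattacharyyaDist W a b < ⊤) :
    ∑ a, tiltedMarginal P W a = 1 := by
  rw [← sum_tiltedLaw hP hPpos hW hd]
  exact (Fintype.sum_prod_type _).symm

/-- The divergence of the tilted marginal is at most `ψ₂`, since mutual information is
nonnegative. -/
theorem sum_tiltedLaw_mul_marginalLogDensity_le (hP : P ∈ stdSimplex ℝ 𝒳) (hPpos : ∀ a, 0 < P a)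
    (hW : ∀ a, W a ∈ stdSimplex ℝ 𝒴) (hd : ∀ a b, bhattacharyyaDist W a b < ⊤) :
    ∑ ω, tiltedLaw P W ω * marginalLogDensity P W ω.1 ≤ psi₂ P W := by
  have hR := tiltedLaw_nonneg hP hPpos hd
  have hsym : ∑ ω, tiltedLaw P W ω * marginalLogDensity P W ω.2 =
      ∑ ω, tiltedLaw P W ω * marginalLogDensity P W ω.1 := by
    rw [← sum_comp_swap]
    simp only [tiltedLaw_swap, Prod.snd_swap]
  -- Again log t ≤ t - 1, for t the ratio of the product of the marginals to the tilted law; this is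
  -- the nonnegativity of the mutual information. The log of the product of the joint laws is
  -- replaced by means of `jointLaw_mul_eq`.
  have hterm : ∀ ω, tiltedLaw P W ω * marginalLogDensity P W ω.1 +
      tiltedLaw P W ω * marginalLogDensity P W ω.2 ≤
      tiltedLaw P W ω * (2 * psi₂ P W) + tiltedLaw P W ω * flipLogRatio P W ω * (1 / 2) +
      (tiltedMarginal P W ω.1 * tiltedMarginal P W ω.2 - tiltedLaw P W ω) := by
    intro ω
    rcases (hR ω).eq_or_lt with h0 | h0
    · rw [← h0]
      have : 0 ≤ tiltedMarginal P W ω.1 * tiltedMarginal P W ω.2 :=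
        mul_nonneg (Finset.sum_nonneg fun _ _ => hR _) (Finset.sum_nonneg fun _ _ => hR _)
      simp only [zero_mul]; linarith
    · obtain ⟨h1, h2, -, -⟩ := jointLaw_pos_of_tiltedLaw hPpos hW h0.ne'
      obtain ⟨m1, m2⟩ := tiltedMarginal_pos_of_tiltedLaw hP hPpos hd h0.ne'
      have he := congrArg Real.log (jointLaw_mul_eq hP hPpos hW hd h0.ne')
      rw [Real.log_mul h1.ne' h2.ne', Real.log_mul (Real.exp_pos _).ne' h0.ne',
        Real.log_exp] at he
      have hl := Real.log_le_sub_one_of_pos (x := tiltedMarginal P W ω.1 *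
        tiltedMarginal P W ω.2 / tiltedLaw P W ω) (by positivity)
      rw [Real.log_div (by positivity) h0.ne', Real.log_mul m1.ne' m2.ne'] at hl
      unfold marginalLogDensity
      rw [Real.log_div m1.ne' h1.ne', Real.log_div m2.ne' h2.ne']
      have h3 := mul_le_mul_of_nonneg_left hl h0.le
      have h4 : tiltedLaw P W ω * (tiltedMarginal P W ω.1 *
        tiltedMarginal P W ω.2 / tiltedLaw P W ω - 1) = tiltedMarginal P W ω.1 *
        tiltedMarginal P W ω.2 - tiltedLaw P W ω := by field_simp
      rw [h4] at h3
      linear_combination h3 - tiltedLaw P W ω * he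
  have hs := Finset.sum_le_sum fun ω (_ : ω ∈ Finset.univ) => hterm ω
  simp only [Finset.sum_add_distrib, Finset.sum_sub_distrib, ← Finset.sum_mul] at hs
  have hprod : ∑ ω : (𝒳 × 𝒴) × (𝒳 × 𝒴), tiltedMarginal P W ω.1 * tiltedMarginal P W ω.2 = 1 := by
    rw [Fintype.sum_prod_type]
    simp only [← Finset.mul_sum]
    rw [sum_tiltedMarginal hP hPpos hW hd]
    simp only [mul_one]
    exact sum_tiltedMarginal hP hPpos hW hd
  rw [hsym, sum_tiltedLaw hP hPpos hW hd, sum_tiltedLaw_mul_flipLogRatio, hprod] at hs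
  linarith

/-- A finite Bhattacharyya distance means that some output is possible for both letters. This is the
source of strictness in the two bounds by one below. -/
theorem exists_tiltedLaw_pos (hP : P ∈ stdSimplex ℝ 𝒳) (hPpos : ∀ a, 0 < P a)
    (hW : ∀ a, W a ∈ stdSimplex ℝ 𝒴) (hd : ∀ a b, bhattacharyyaDist W a b < ⊤) (a b : 𝒳) :
    ∃ y, 0 < tiltedLaw P W ((a, y), (b, y)) := by
  have hb := bhattacharyyaCoeff_pos (hd a b)
  unfold bhattacharyyaCoeff at hb
  obtain ⟨y, -, hy⟩ := Finset.exists_lt_of_sum_lt (s := Finset.univ) (f := fun _ : 𝒴 => (0 : ℝ))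
    (g := fun y => √(W a y * W b y)) (by simpa using hb)
  refine ⟨y, ?_⟩
  rw [tiltedLaw_apply hPpos hW]
  have := hPpos a
  have := hPpos b
  have := meanSqCoeff_pos hP hPpos hd
  positivity

theorem tiltedInput_pos (hP : P ∈ stdSimplex ℝ 𝒳) (hPpos : ∀ a, 0 < P a)
    (hW : ∀ a, W a ∈ stdSimplex ℝ 𝒴) (hd : ∀ a b, bhattacharyyaDist W a b < ⊤) (a : 𝒳) :
    0 < tiltedInput P W a := by
  have hR := tiltedLaw_nonneg hP hPpos hd
  obtain ⟨y, hy⟩ := exists_tiltedLaw_pos hP hPpos hW hd a a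
  exact Finset.sum_pos' (fun y _ => Finset.sum_nonneg fun b _ => hR _)
    ⟨y, Finset.mem_univ _, Finset.sum_pos' (fun b _ => hR _) ⟨(a, y), Finset.mem_univ _, hy⟩⟩

theorem sum_tiltedInput (hP : P ∈ stdSimplex ℝ 𝒳) (hPpos : ∀ a, 0 < P a)
    (hW : ∀ a, W a ∈ stdSimplex ℝ 𝒴) (hd : ∀ a b, bhattacharyyaDist W a b < ⊤) :
    ∑ a, tiltedInput P W a = 1 := by
  rw [← sum_tiltedMarginal hP hPpos hW hd]
  exact (Fintype.sum_prod_type _).symm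

/-- The two inputs differ with positive probability under the tilted law. -/
theorem sum_tiltedLaw_diag_lt_one (hP : P ∈ stdSimplex ℝ 𝒳) (hPpos : ∀ a, 0 < P a)
    (hW : ∀ a, W a ∈ stdSimplex ℝ 𝒴) (hd : ∀ a b, bhattacharyyaDist W a b < ⊤)
    (hne : ∃ a b : 𝒳, a ≠ b) :
    ∑ ω, tiltedLaw P W ω * (if ω.1.1 = ω.2.1 then 1 else 0) < 1 := by
  have hR := tiltedLaw_nonneg hP hPpos hd
  obtain ⟨a, b, hab⟩ := hne
  obtain ⟨y, hy⟩ := exists_tiltedLaw_pos hP hPpos hW hd a b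
  refine lt_of_lt_of_eq ?_ (sum_tiltedLaw hP hPpos hW hd)
  refine Finset.sum_lt_sum (fun ω _ => mul_le_of_le_one_right (hR ω) (by split_ifs <;> norm_num))
    ⟨((a, y), (b, y)), Finset.mem_univ _, ?_⟩
  simpa [hab] using hy

/-- The weight of the best guess of one input based on the two outputs. -/
noncomputable def bestGuess (P : 𝒳 → ℝ) (W : 𝒳 → 𝒴 → ℝ) (y : 𝒴 × 𝒴) : ℝ :=
  ⨆ a, ∑ b, tiltedLaw P W ((a, y.1), (b, y.2))

theorem le_bestGuess (a : 𝒳) (y : 𝒴 × 𝒴) :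
    ∑ b, tiltedLaw P W ((a, y.1), (b, y.2)) ≤ bestGuess P W y :=
  le_ciSup (f := fun a => ∑ b, tiltedLaw P W ((a, y.1), (b, y.2)))
    (Set.finite_range _).bddAbove a

theorem bestGuess_nonneg (hP : P ∈ stdSimplex ℝ 𝒳) (hPpos : ∀ a, 0 < P a)
    (hd : ∀ a b, bhattacharyyaDist W a b < ⊤) (y : 𝒴 × 𝒴) : 0 ≤ bestGuess P W y :=
  Real.iSup_nonneg fun _ => Finset.sum_nonneg fun _ _ => tiltedLaw_nonneg hP hPpos hd _

/-- If a ≠ b can both produce y, then the inputs (a, b) and (b, a) both have positive weight with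
the outputs (y, y). No guess of the first input is certain there, so some mass is lost. -/
theorem sum_bestGuess_lt_one (hP : P ∈ stdSimplex ℝ 𝒳) (hPpos : ∀ a, 0 < P a)
    (hW : ∀ a, W a ∈ stdSimplex ℝ 𝒴) (hd : ∀ a b, bhattacharyyaDist W a b < ⊤)
    (hne : ∃ a b : 𝒳, a ≠ b) : ∑ y, bestGuess P W y < 1 := by
  have hR := tiltedLaw_nonneg hP hPpos hd
  obtain ⟨a, b, hab⟩ := hne
  have : Nonempty 𝒳 := ⟨a⟩
  obtain ⟨y, hy⟩ := exists_tiltedLaw_pos hP hPpos hW hd a b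
  have hy' : 0 < tiltedLaw P W ((b, y), (a, y)) := by
    rwa [← tiltedLaw_swap]
  rw [← sum_tiltedLaw hP hPpos hW hd, sum_pair_eq]
  simp only [Fintype.sum_prod_type (γ := ℝ) (α₁ := 𝒳)]
  have hle : ∀ (y : 𝒴 × 𝒴) (a : 𝒳), ∑ b, tiltedLaw P W ((a, y.1), (b, y.2)) ≤
      ∑ a, ∑ b, tiltedLaw P W ((a, y.1), (b, y.2)) := fun y a =>
    Finset.single_le_sum (f := fun a => ∑ b, tiltedLaw P W ((a, y.1), (b, y.2)))
      (fun a _ => Finset.sum_nonneg fun b _ => hR _) (Finset.mem_univ a)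
  refine Finset.sum_lt_sum (fun y _ => ciSup_le (hle y)) ⟨(y, y), Finset.mem_univ _, ?_⟩
  obtain ⟨a₀, ha₀⟩ := exists_eq_ciSup_of_finite
    (f := fun a => ∑ b, tiltedLaw P W ((a, y), (b, y)))
  change (⨆ a, ∑ b, tiltedLaw P W ((a, y), (b, y))) < _
  rw [← ha₀]
  have hp : ∃ a' ≠ a₀, 0 < ∑ b, tiltedLaw P W ((a', y), (b, y)) := by
    by_cases h : a = a₀
    · exact ⟨b, h ▸ hab.symm, Finset.sum_pos' (fun _ _ => hR _) ⟨a, Finset.mem_univ _, hy'⟩⟩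
    · exact ⟨a, h, Finset.sum_pos' (fun _ _ => hR _) ⟨b, Finset.mem_univ _, hy⟩⟩
  obtain ⟨a', hne, hpos⟩ := hp
  exact Finset.single_lt_sum (f := fun a => ∑ b, tiltedLaw P W ((a, y), (b, y))) hne
    (Finset.mem_univ _) (Finset.mem_univ _) hpos
    fun a _ _ => Finset.sum_nonneg fun b _ => hR _

end TiltedLaw

end SeqReorder

namespace SeqReorder

/-! ### Products of the tilted law over blocks of length L -/

section Blocks

open scoped Classical

variable {𝒳 𝒴 : Type*} [Fintype 𝒳] [Fintype 𝒴] {L : ℕ}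

/-- A fragment and the corresponding part of the reference sequence. -/
abbrev Block (𝒳 𝒴 : Type*) (L : ℕ) := (Fin L → 𝒳) × (Fin L → 𝒴)

/-- The law of a fragment and the corresponding part of the reference sequence. -/
noncomputable def blockLaw (P : 𝒳 → ℝ) (W : 𝒳 → 𝒴 → ℝ) (a : Block 𝒳 𝒴 L) : ℝ :=
  ∏ j, jointLaw P W (a.1 j, a.2 j)

/-- The letters of a pair of blocks. -/
def letters (ω : Block 𝒳 𝒴 L × Block 𝒳 𝒴 L) (j : Fin L) : (𝒳 × 𝒴) × (𝒳 × 𝒴) :=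
  ((ω.1.1 j, ω.1.2 j), (ω.2.1 j, ω.2.2 j))

/-- The product of tilted laws on pairs of blocks. -/
noncomputable def blockTilted (P : 𝒳 → ℝ) (W : 𝒳 → 𝒴 → ℝ) (ω : Block 𝒳 𝒴 L × Block 𝒳 𝒴 L) : ℝ :=
  ∏ j, tiltedLaw P W (letters ω j)

variable {P : 𝒳 → ℝ} {W : 𝒳 → 𝒴 → ℝ}

theorem sum_blockTilted_mul (F : (Fin L → (𝒳 × 𝒴) × (𝒳 × 𝒴)) → ℝ) :
    ∑ ω : Block 𝒳 𝒴 L × Block 𝒳 𝒴 L, blockTilted P W ω * F (letters ω) =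
      pmean (tiltedLaw P W) F := by
  rw [pmean_eq_sum inferInstance]
  exact Fintype.sum_equiv ⟨letters, fun z => ((fun j => (z j).1.1, fun j => (z j).1.2),
    (fun j => (z j).2.1, fun j => (z j).2.2)), fun _ => rfl, fun _ => rfl⟩ _ _ fun _ => rfl

theorem sum_blockTilted_mul_prod (f : Fin L → (𝒳 × 𝒴) × (𝒳 × 𝒴) → ℝ) :
    ∑ ω : Block 𝒳 𝒴 L × Block 𝒳 𝒴 L, blockTilted P W ω * ∏ j, f j (letters ω j) =
      ∏ j, ∑ ω, tiltedLaw P W ω * f j ω := by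
  rw [← pmean_prod, ← sum_blockTilted_mul]

/-- The mass of a product event under the product of tilted laws. -/
theorem sum_blockTilted_mul_ite (p : Block 𝒳 𝒴 L × Block 𝒳 𝒴 L → Prop) [DecidablePred p]
    (p' : Fin L → (𝒳 × 𝒴) × (𝒳 × 𝒴) → Prop) [∀ j, DecidablePred (p' j)]
    (h : ∀ ω, p ω ↔ ∀ j, p' j (letters ω j)) :
    ∑ ω : Block 𝒳 𝒴 L × Block 𝒳 𝒴 L, blockTilted P W ω * (if p ω then 1 else 0) =
      ∏ j, ∑ ω, tiltedLaw P W ω * (if p' j ω then 1 else 0) := by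
  rw [← sum_blockTilted_mul_prod]
  refine Finset.sum_congr rfl fun ω _ => ?_
  rw [Finset.prod_ite_zero]
  simp [h]

theorem blockTilted_nonneg (hP : P ∈ stdSimplex ℝ 𝒳) (hPpos : ∀ a, 0 < P a)
    (hd : ∀ a b, bhattacharyyaDist W a b < ⊤) (ω : Block 𝒳 𝒴 L × Block 𝒳 𝒴 L) :
    0 ≤ blockTilted P W ω :=
  Finset.prod_nonneg fun _ _ => tiltedLaw_nonneg hP hPpos hd _

theorem sum_blockTilted (hP : P ∈ stdSimplex ℝ 𝒳) (hPpos : ∀ a, 0 < P a)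
    (hW : ∀ a, W a ∈ stdSimplex ℝ 𝒴) (hd : ∀ a b, bhattacharyyaDist W a b < ⊤) :
    ∑ ω : Block 𝒳 𝒴 L × Block 𝒳 𝒴 L, blockTilted P W ω = 1 := by
  have := sum_blockTilted_mul (P := P) (W := W) (L := L) fun _ => 1
  simpa [pmean_const (sum_tiltedLaw hP hPpos hW hd)] using this

omit [Fintype 𝒳] in
theorem blockLaw_nonneg (hPpos : ∀ a, 0 < P a) (hW : ∀ a, W a ∈ stdSimplex ℝ 𝒴)
    (a : Block 𝒳 𝒴 L) : 0 ≤ blockLaw P W a :=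
  Finset.prod_nonneg fun _ _ => jointLaw_nonneg hPpos hW _

theorem sum_blockLaw (hP : P ∈ stdSimplex ℝ 𝒳) (hW : ∀ a, W a ∈ stdSimplex ℝ 𝒴) :
    ∑ a : Block 𝒳 𝒴 L, blockLaw P W a = 1 := by
  have h := Finset.prod_univ_sum (fun _ : Fin L => (Finset.univ : Finset (𝒳 × 𝒴)))
    (fun _ a => jointLaw P W a)
  rw [Finset.prod_const, sum_jointLaw hP hW, one_pow, Fintype.piFinset_univ] at h
  rw [h]
  exact Fintype.sum_equiv (Equiv.arrowProdEquivProdArrow (Fin L) (fun _ => 𝒳) (fun _ => 𝒴)).symm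
    _ _ fun _ => rfl

omit [Fintype 𝒳] [Fintype 𝒴] in
theorem letters_flipInput (ω : Block 𝒳 𝒴 L × Block 𝒳 𝒴 L) (j : Fin L) :
    letters (flipInput ω) j = flipInput (letters ω j) := rfl

omit [Fintype 𝒳] [Fintype 𝒴] in
theorem letters_swap (ω : Block 𝒳 𝒴 L × Block 𝒳 𝒴 L) (j : Fin L) :
    letters ω.swap j = (letters ω j).swap := rfl

theorem blockTilted_flipInput (ω : Block 𝒳 𝒴 L × Block 𝒳 𝒴 L) :
    blockTilted P W (flipInput ω) = blockTilted P W ω := by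
  simp only [blockTilted, letters_flipInput, tiltedLaw_flipInput]

theorem blockTilted_swap (ω : Block 𝒳 𝒴 L × Block 𝒳 𝒴 L) :
    blockTilted P W ω.swap = blockTilted P W ω := by
  simp only [blockTilted, letters_swap, tiltedLaw_swap]

theorem tiltedLaw_ne_zero_of_blockTilted {ω : Block 𝒳 𝒴 L × Block 𝒳 𝒴 L}
    (h : blockTilted P W ω ≠ 0) (j : Fin L) : tiltedLaw P W (letters ω j) ≠ 0 :=
  Finset.prod_ne_zero_iff.1 h j (Finset.mem_univ j)

/-- The log-likelihood ratio of the interchanged and the true fragments. -/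
noncomputable def blockFlipLogRatio (P : 𝒳 → ℝ) (W : 𝒳 → 𝒴 → ℝ)
    (ω : Block 𝒳 𝒴 L × Block 𝒳 𝒴 L) : ℝ :=
  ∑ j, flipLogRatio P W (letters ω j)

omit [Fintype 𝒳] [Fintype 𝒴] in
theorem blockFlipLogRatio_flipInput (ω : Block 𝒳 𝒴 L × Block 𝒳 𝒴 L) :
    blockFlipLogRatio P W (flipInput ω) = -blockFlipLogRatio P W ω := by
  simp only [blockFlipLogRatio, letters_flipInput, flipLogRatio_flipInput, Finset.sum_neg_distrib]

theorem blockLaw_mul_eq (hP : P ∈ stdSimplex ℝ 𝒳) (hPpos : ∀ a, 0 < P a)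
    (hW : ∀ a, W a ∈ stdSimplex ℝ 𝒴) (hd : ∀ a b, bhattacharyyaDist W a b < ⊤)
    {ω : Block 𝒳 𝒴 L × Block 𝒳 𝒴 L} (h : blockTilted P W ω ≠ 0) :
    blockLaw P W ω.1 * blockLaw P W ω.2 =
      Real.exp (-2 * psi₂ P W * L - blockFlipLogRatio P W ω / 2) * blockTilted P W ω := by
  unfold blockLaw
  have e : ∏ j, jointLaw P W (ω.1.1 j, ω.1.2 j) * jointLaw P W (ω.2.1 j, ω.2.2 j) =
      ∏ j, Real.exp (-2 * psi₂ P W - flipLogRatio P W (letters ω j) / 2) *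
        tiltedLaw P W (letters ω j) :=
    Finset.prod_congr rfl fun j _ =>
      jointLaw_mul_eq hP hPpos hW hd (tiltedLaw_ne_zero_of_blockTilted h j)
  rw [← Finset.prod_mul_distrib, e, Finset.prod_mul_distrib, ← Real.exp_sum, Finset.sum_sub_distrib]
  congr 2
  simp only [Finset.sum_const, Finset.card_univ, Fintype.card_fin, nsmul_eq_mul,
    blockFlipLogRatio, Finset.sum_div]
  ring

theorem blockLaw_mul_flipInput_eq (hP : P ∈ stdSimplex ℝ 𝒳) (hPpos : ∀ a, 0 < P a)
    (hW : ∀ a, W a ∈ stdSimplex ℝ 𝒴) (hd : ∀ a b, bhattacharyyaDist W a b < ⊤)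
    {ω : Block 𝒳 𝒴 L × Block 𝒳 𝒴 L} (h : blockTilted P W ω ≠ 0) :
    blockLaw P W (flipInput ω).1 * blockLaw P W (flipInput ω).2 =
      Real.exp (-2 * psi₂ P W * L + blockFlipLogRatio P W ω / 2) * blockTilted P W ω := by
  rw [blockLaw_mul_eq hP hPpos hW hd (by rwa [blockTilted_flipInput]), blockTilted_flipInput,
    blockFlipLogRatio_flipInput]
  ring_nf

/-- The weak law of large numbers for pairs of blocks under the product of tilted laws. -/
theorem eventually_sum_blockTilted_deviation_le (hP : P ∈ stdSimplex ℝ 𝒳)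
    (hPpos : ∀ a, 0 < P a) (hW : ∀ a, W a ∈ stdSimplex ℝ 𝒴)
    (hd : ∀ a b, bhattacharyyaDist W a b < ⊤) (f : (𝒳 × 𝒴) × (𝒳 × 𝒴) → ℝ) {δ η : ℝ}
    (hδ : 0 < δ) (hη : 0 < η) :
    ∀ᶠ L : ℕ in atTop, ∑ ω : Block 𝒳 𝒴 L × Block 𝒳 𝒴 L, blockTilted P W ω *
      (if δ * L ≤ |∑ j, f (letters ω j) - L * ∑ ω, tiltedLaw P W ω * f ω| then 1 else 0) ≤ η := by
  have hlim := tendsto_const_div_atTop_nhds_zero_nat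
    ((∑ a, tiltedLaw P W a * (f a - ∑ b, tiltedLaw P W b * f b) ^ 2) / δ ^ 2)
  filter_upwards [hlim.eventually_le_const hη, eventually_gt_atTop 0] with L hL hL0
  have := pmean_chebyshev (ι := Fin L) (tiltedLaw_nonneg hP hPpos hd)
    (sum_tiltedLaw hP hPpos hW hd) f hδ (by simpa using hL0)
  rw [← sum_blockTilted_mul, Fintype.card_fin] at this
  exact this.trans hL

/-- The letters are independent, so equality of the fragments has the L-th power of a probability
below one. -/
theorem eventually_sum_blockTilted_diag_le (hP : P ∈ stdSimplex ℝ 𝒳)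
    (hPpos : ∀ a, 0 < P a) (hW : ∀ a, W a ∈ stdSimplex ℝ 𝒴)
    (hd : ∀ a b, bhattacharyyaDist W a b < ⊤) (hne : ∃ a b : 𝒳, a ≠ b) {η : ℝ} (hη : 0 < η) :
    ∀ᶠ L : ℕ in atTop, ∑ ω : Block 𝒳 𝒴 L × Block 𝒳 𝒴 L, blockTilted P W ω *
      (if ω.1.1 = ω.2.1 then 1 else 0) ≤ η := by
  have h0 : 0 ≤ ∑ ω, tiltedLaw P W ω * (if ω.1.1 = ω.2.1 then 1 else 0) :=
    Finset.sum_nonneg fun ω _ => mul_nonneg (tiltedLaw_nonneg hP hPpos hd ω)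
      (by split_ifs <;> norm_num)
  have hlim := tendsto_pow_atTop_nhds_zero_of_lt_one h0
    (sum_tiltedLaw_diag_lt_one hP hPpos hW hd hne)
  filter_upwards [hlim.eventually_le_const hη] with L hL
  rw [sum_blockTilted_mul_ite (fun ω => ω.1.1 = ω.2.1) (fun _ ω => ω.1.1 = ω.2.1) fun ω => funext_iff,
    Finset.prod_const, Finset.card_univ, Fintype.card_fin]
  exact hL

theorem sum_blockTilted_fst (a : Block 𝒳 𝒴 L) :
    ∑ b, blockTilted P W (a, b) = ∏ j, tiltedMarginal P W (a.1 j, a.2 j) := by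
  have h := sum_blockTilted_mul_ite (P := P) (W := W) (fun ω : Block 𝒳 𝒴 L × Block 𝒳 𝒴 L => ω.1 = a)
    (fun j ω => ω.1 = (a.1 j, a.2 j)) fun ω => by
      simp [letters, Prod.ext_iff, funext_iff, forall_and]
  rw [Fintype.sum_prod_type, Finset.sum_comm] at h
  simp only [mul_ite, mul_one, mul_zero, Finset.sum_ite_eq', Finset.mem_univ, if_true] at h
  rw [h]
  refine Finset.prod_congr rfl fun j _ => ?_
  rw [Fintype.sum_prod_type, Finset.sum_comm]
  simp [tiltedMarginal]

theorem sum_blockTilted_input (u : Fin L → 𝒳) :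
    ∑ ω : Block 𝒳 𝒴 L × Block 𝒳 𝒴 L, blockTilted P W ω * (if ω.1.1 = u then 1 else 0) =
      ∏ j, tiltedInput P W (u j) := by
  rw [sum_blockTilted_mul_ite (fun ω => ω.1.1 = u) (fun j ω => ω.1.1 = u j) fun ω => funext_iff]
  refine Finset.prod_congr rfl fun j _ => ?_
  simp only [Fintype.sum_prod_type, tiltedInput, tiltedMarginal]
  rw [Finset.sum_eq_single (u j)]
  · simp
  · intro a _ ha; simp [ha]
  · simp

/-- For fixed outputs the weight of a guessed fragment is a product over its letters, and the best
guess can be taken letter by letter. -/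
theorem sum_blockTilted_guess_le (hP : P ∈ stdSimplex ℝ 𝒳) (hPpos : ∀ a, 0 < P a)
    (hd : ∀ a b, bhattacharyyaDist W a b < ⊤) (u : Fin L → 𝒳) (y : (Fin L → 𝒴) × (Fin L → 𝒴)) :
    ∑ v : Fin L → 𝒳, blockTilted P W ((u, y.1), (v, y.2)) ≤
      ∏ j, bestGuess P W (y.1 j, y.2 j) := by
  calc ∑ v : Fin L → 𝒳, blockTilted P W ((u, y.1), (v, y.2))
      = ∏ j, ∑ b, tiltedLaw P W ((u j, y.1 j), (b, y.2 j)) := by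
        rw [Finset.prod_univ_sum, Fintype.piFinset_univ]
        rfl
    _ ≤ _ := Finset.prod_le_prod
        (fun j _ => Finset.sum_nonneg fun _ _ => tiltedLaw_nonneg hP hPpos hd _)
        fun j _ => le_bestGuess _ (y.1 j, y.2 j)

theorem sum_prod_bestGuess :
    ∑ y : (Fin L → 𝒴) × (Fin L → 𝒴), ∏ j, bestGuess P W (y.1 j, y.2 j) =
      (∑ y, bestGuess P W y) ^ L := by
  have h := Finset.prod_univ_sum (fun _ : Fin L => (Finset.univ : Finset (𝒴 × 𝒴)))
    (fun _ y => bestGuess P W y)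
  rw [Finset.prod_const, Finset.card_univ, Fintype.card_fin, Fintype.piFinset_univ] at h
  rw [h]
  exact Fintype.sum_equiv (Equiv.arrowProdEquivProdArrow (Fin L) (fun _ => 𝒴) (fun _ => 𝒴)).symm
    _ _ fun _ => rfl

end Blocks

end SeqReorder

namespace SeqReorder

/-! ### Confusable blocks, typical pairs and the conditioned pair law -/

section TypicalPairs

open scoped Classical

variable {𝒳 𝒴 : Type*} [Fintype 𝒳] [Fintype 𝒴] {P : 𝒳 → ℝ} {W : 𝒳 → 𝒴 → ℝ}

omit [Fintype 𝒳] [Fintype 𝒴] in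
theorem flipLogRatio_swap (ω : (𝒳 × 𝒴) × (𝒳 × 𝒴)) :
    flipLogRatio P W ω.swap = flipLogRatio P W ω := by
  simp only [flipLogRatio, flipInput, Prod.swap]
  rw [mul_comm, mul_comm (jointLaw P W ω.2)]

omit [Fintype 𝒳] [Fintype 𝒴] in
theorem blockFlipLogRatio_swap {L : ℕ} (ω : Block 𝒳 𝒴 L × Block 𝒳 𝒴 L) :
    blockFlipLogRatio P W ω.swap = blockFlipLogRatio P W ω := by
  simp only [blockFlipLogRatio, letters_swap, flipLogRatio_swap]

/-- The two fragments differ, and the blocks and their log-likelihood ratios are typical for the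
tilted law. -/
def Confusable (P : 𝒳 → ℝ) (W : 𝒳 → 𝒴 → ℝ) {L : ℕ} (δ : ℝ) (a b : Block 𝒳 𝒴 L) : Prop :=
  blockTilted P W (a, b) ≠ 0 ∧ a.1 ≠ b.1 ∧ |blockFlipLogRatio P W (a, b)| < δ * L ∧
  ∑ j, marginalLogDensity P W (a.1 j, a.2 j) < (psi₂ P W + δ) * L ∧
  ∑ j, marginalLogDensity P W (b.1 j, b.2 j) < (psi₂ P W + δ) * L

theorem Confusable.symm {L : ℕ} {δ : ℝ} {a b : Block 𝒳 𝒴 L} (h : Confusable P W δ a b) :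
    Confusable P W δ b a := by
  obtain ⟨h1, h2, h3, h4, h5⟩ := h
  refine ⟨?_, h2.symm, ?_, h5, h4⟩
  · rwa [show ((b, a) : Block 𝒳 𝒴 L × Block 𝒳 𝒴 L) = (a, b).swap from rfl, blockTilted_swap]
  · rwa [show ((b, a) : Block 𝒳 𝒴 L × Block 𝒳 𝒴 L) = (a, b).swap from rfl, blockFlipLogRatio_swap]

theorem Confusable.blockLaw_mul_mem (hP : P ∈ stdSimplex ℝ 𝒳) (hPpos : ∀ a, 0 < P a)
    (hW : ∀ a, W a ∈ stdSimplex ℝ 𝒴) (hd : ∀ a b, bhattacharyyaDist W a b < ⊤)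
    {L : ℕ} {δ : ℝ} {a b : Block 𝒳 𝒴 L} (h : Confusable P W δ a b) :
    Real.exp (-(2 * psi₂ P W + δ) * L) * blockTilted P W (a, b) ≤ blockLaw P W a * blockLaw P W b ∧
    blockLaw P W a * blockLaw P W b ≤
      Real.exp (-(2 * psi₂ P W - δ) * L) * blockTilted P W (a, b) := by
  obtain ⟨h1, -, h3, -, -⟩ := h
  have he := blockLaw_mul_eq hP hPpos hW hd h1
  have h0 := blockTilted_nonneg hP hPpos hd (a, b)
  have h3' := abs_lt.1 h3
  rw [he]
  constructor <;> refine mul_le_mul_of_nonneg_right (Real.exp_le_exp.2 ?_) h0 <;> nlinarith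

theorem Confusable.le_blockLaw_flip (hP : P ∈ stdSimplex ℝ 𝒳) (hPpos : ∀ a, 0 < P a)
    (hW : ∀ a, W a ∈ stdSimplex ℝ 𝒴) (hd : ∀ a b, bhattacharyyaDist W a b < ⊤)
    {L : ℕ} {δ : ℝ} {a b : Block 𝒳 𝒴 L} (h : Confusable P W δ a b) :
    Real.exp (-δ * L) * (blockLaw P W a * blockLaw P W b) ≤
      blockLaw P W (b.1, a.2) * blockLaw P W (a.1, b.2) := by
  obtain ⟨h1, -, h3, -, -⟩ := h
  have he := blockLaw_mul_eq hP hPpos hW hd h1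
  have he' := blockLaw_mul_flipInput_eq hP hPpos hW hd h1
  have h0 := blockTilted_nonneg hP hPpos hd (a, b)
  have h3' := abs_lt.1 h3
  simp only [flipInput] at he he'
  rw [he, he', ← mul_assoc, ← Real.exp_add]
  refine mul_le_mul_of_nonneg_right (Real.exp_le_exp.2 ?_) h0
  linarith

/-- If any block is confusable with `a`, then `a` is typical, so its tilted marginal is at most
exp((ψ₂ + δ)L) times its law. Passing to the tilted law gains exp(-(2ψ₂ - δ)L), and summing over `b`
leaves this marginal; the net exponent is ψ₂ - 2δ. -/
theorem Confusable.sum_blockLaw_le (hP : P ∈ stdSimplex ℝ 𝒳) (hPpos : ∀ a, 0 < P a)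
    (hW : ∀ a, W a ∈ stdSimplex ℝ 𝒴) (hd : ∀ a b, bhattacharyyaDist W a b < ⊤)
    {L : ℕ} {δ : ℝ} (a : Block 𝒳 𝒴 L) :
    ∑ b, blockLaw P W b * (if Confusable P W δ a b then 1 else 0) ≤
      Real.exp (-(psi₂ P W - 2 * δ) * L) := by
  by_cases hex : ∃ b, Confusable P W δ a b
  · obtain ⟨b₀, hb₀⟩ := hex
    have hj := fun j => jointLaw_pos_of_tiltedLaw hPpos hW
      (tiltedLaw_ne_zero_of_blockTilted hb₀.1 j)
    have hm := fun j => tiltedMarginal_pos_of_tiltedLaw hP hPpos hd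
      (tiltedLaw_ne_zero_of_blockTilted hb₀.1 j)
    have hq : 0 < blockLaw P W a := Finset.prod_pos fun j _ => (hj j).1
    have hmarg : ∏ j, tiltedMarginal P W (a.1 j, a.2 j) =
        Real.exp (∑ j, marginalLogDensity P W (a.1 j, a.2 j)) * blockLaw P W a := by
      rw [Real.exp_sum, blockLaw, ← Finset.prod_mul_distrib]
      refine Finset.prod_congr rfl fun j _ => ?_
      have h1 := (hj j).1
      have h2 := (hm j).1
      simp only [letters] at h1 h2
      rw [marginalLogDensity, Real.exp_log (div_pos h2 h1), div_mul_cancel₀ _ h1.ne']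
    refine le_of_mul_le_mul_left ?_ hq
    calc blockLaw P W a * ∑ b, blockLaw P W b * (if Confusable P W δ a b then 1 else 0)
        ≤ ∑ b, Real.exp (-(2 * psi₂ P W - δ) * L) * blockTilted P W (a, b) := by
          rw [Finset.mul_sum]
          refine Finset.sum_le_sum fun b _ => ?_
          split_ifs with h
          · rw [mul_one]
            exact (h.blockLaw_mul_mem hP hPpos hW hd).2
          · rw [mul_zero, mul_zero]
            exact mul_nonneg (Real.exp_pos _).le (blockTilted_nonneg hP hPpos hd _)
      _ = Real.exp (-(2 * psi₂ P W - δ) * L) *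
          (Real.exp (∑ j, marginalLogDensity P W (a.1 j, a.2 j)) * blockLaw P W a) := by
          rw [← Finset.mul_sum, sum_blockTilted_fst, hmarg]
      _ ≤ Real.exp (-(2 * psi₂ P W - δ) * L) *
          (Real.exp ((psi₂ P W + δ) * L) * blockLaw P W a) := by
          gcongr
          exact hb₀.2.2.2.1.le
      _ = blockLaw P W a * Real.exp (-(psi₂ P W - 2 * δ) * L) := by
          rw [← mul_assoc, ← Real.exp_add, mul_comm]
          ring_nf
  · push Not at hex
    simp only [hex, if_false, mul_zero, Finset.sum_const_zero]
    exact (Real.exp_pos _).le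

theorem sum_blockTilted_mul_swap {L : ℕ} (p : Block 𝒳 𝒴 L × Block 𝒳 𝒴 L → ℝ) :
    ∑ ω : Block 𝒳 𝒴 L × Block 𝒳 𝒴 L, blockTilted P W ω * p ω.swap =
      ∑ ω, blockTilted P W ω * p ω := by
  rw [← Equiv.sum_comp (Equiv.prodComm _ _) fun ω => blockTilted P W ω * p ω]
  simp only [Equiv.prodComm_apply, blockTilted_swap]

/-- Four exceptional events, each of mass at most 1/8: equal fragments, an atypical likelihood
ratio, and an atypical marginal density of either block. -/
theorem eventually_half_le_sum_confusable (hP : P ∈ stdSimplex ℝ 𝒳) (hPpos : ∀ a, 0 < P a)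
    (hW : ∀ a, W a ∈ stdSimplex ℝ 𝒴) (hd : ∀ a b, bhattacharyyaDist W a b < ⊤)
    (hne : ∃ a b : 𝒳, a ≠ b) {δ : ℝ} (hδ : 0 < δ) :
    ∀ᶠ L : ℕ in atTop, 1 / 2 ≤ ∑ ω : Block 𝒳 𝒴 L × Block 𝒳 𝒴 L, blockTilted P W ω *
      (if Confusable P W δ ω.1 ω.2 then 1 else 0) := by
  have h8 : (0 : ℝ) < 1 / 8 := by norm_num
  filter_upwards [eventually_sum_blockTilted_diag_le hP hPpos hW hd hne h8,
    eventually_sum_blockTilted_deviation_le hP hPpos hW hd (flipLogRatio P W) hδ h8,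
    eventually_sum_blockTilted_deviation_le hP hPpos hW hd
      (fun ω => marginalLogDensity P W ω.1) hδ h8] with L h1 h2 h3
  have h4 := h3
  rw [← sum_blockTilted_mul_swap] at h4
  rw [sum_tiltedLaw_mul_flipLogRatio, mul_zero] at h2
  simp only [sub_zero] at h2
  have hle := sum_tiltedLaw_mul_marginalLogDensity_le hP hPpos hW hd
  set D := ∑ ω, tiltedLaw P W ω * marginalLogDensity P W ω.1 with hD
  have hL : (0 : ℝ) ≤ L := Nat.cast_nonneg L
  have hpt : ∀ ω : Block 𝒳 𝒴 L × Block 𝒳 𝒴 L, blockTilted P W ω ≤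
      blockTilted P W ω * (if Confusable P W δ ω.1 ω.2 then 1 else 0) +
      (blockTilted P W ω * (if ω.1.1 = ω.2.1 then 1 else 0) +
      (blockTilted P W ω * (if δ * L ≤ |∑ j, flipLogRatio P W (letters ω j)| then 1 else 0) +
      (blockTilted P W ω * (if δ * L ≤ |∑ j, marginalLogDensity P W (letters ω j).1 - L * D|
        then 1 else 0) +
      blockTilted P W ω * (if δ * L ≤ |∑ j, marginalLogDensity P W (letters ω.swap j).1 - L * D|
        then 1 else 0)))) := by
    intro ω
    have h0 := blockTilted_nonneg hP hPpos hd ω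
    by_cases hz : blockTilted P W ω = 0
    · simp [hz]
    rw [← mul_add, ← mul_add, ← mul_add, ← mul_add]
    refine le_mul_of_one_le_right h0 ?_
    by_cases c1 : ω.1.1 = ω.2.1
    · rw [if_pos c1]; split_ifs <;> norm_num
    by_cases c2 : δ * L ≤ |∑ j, flipLogRatio P W (letters ω j)|
    · rw [if_pos c2]; split_ifs <;> norm_num
    by_cases c3 : δ * L ≤ |∑ j, marginalLogDensity P W (letters ω j).1 - L * D|
    · rw [if_pos c3]; split_ifs <;> norm_num
    by_cases c4 : δ * L ≤ |∑ j, marginalLogDensity P W (letters ω.swap j).1 - L * D|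
    · rw [if_pos c4]; split_ifs <;> norm_num
    have hc : Confusable P W δ ω.1 ω.2 := by
      refine ⟨hz, c1, not_le.1 c2, ?_, ?_⟩
      · have h5 := (abs_lt.1 (not_le.1 c3)).2
        have h6 := mul_le_mul_of_nonneg_left hle hL
        simp only [letters] at h5
        linarith
      · have h5 := (abs_lt.1 (not_le.1 c4)).2
        have h6 := mul_le_mul_of_nonneg_left hle hL
        simp only [letters, Prod.swap] at h5
        linarith
    rw [if_pos hc]
    split_ifs
    all_goals norm_num
  have hs := Finset.sum_le_sum fun ω (_ : ω ∈ Finset.univ) => hpt ω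
  rw [sum_blockTilted hP hPpos hW hd] at hs
  simp only [Finset.sum_add_distrib] at hs
  linarith

/-- The probability that two independent blocks are confusable. -/
theorem Confusable.sum_sum_blockLaw_mem (hP : P ∈ stdSimplex ℝ 𝒳) (hPpos : ∀ a, 0 < P a)
    (hW : ∀ a, W a ∈ stdSimplex ℝ 𝒴) (hd : ∀ a b, bhattacharyyaDist W a b < ⊤)
    {L : ℕ} {δ : ℝ} (h : 1 / 2 ≤ ∑ ω : Block 𝒳 𝒴 L × Block 𝒳 𝒴 L, blockTilted P W ω *
      (if Confusable P W δ ω.1 ω.2 then 1 else 0)) :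
    1 / 2 * Real.exp (-(2 * psi₂ P W + δ) * L) ≤ ∑ a : Block 𝒳 𝒴 L, blockLaw P W a *
      ∑ b, blockLaw P W b * (if Confusable P W δ a b then 1 else 0) ∧
    ∑ a : Block 𝒳 𝒴 L, blockLaw P W a *
      ∑ b, blockLaw P W b * (if Confusable P W δ a b then 1 else 0) ≤
      Real.exp (-(2 * psi₂ P W - δ) * L) := by
  have hR := blockTilted_nonneg (L := L) hP hPpos hd
  have e : ∑ a : Block 𝒳 𝒴 L, blockLaw P W a *
      ∑ b, blockLaw P W b * (if Confusable P W δ a b then 1 else 0) =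
      ∑ ω : Block 𝒳 𝒴 L × Block 𝒳 𝒴 L, blockLaw P W ω.1 * blockLaw P W ω.2 *
        (if Confusable P W δ ω.1 ω.2 then 1 else 0) := by
    symm
    rw [Fintype.sum_prod_type]
    simp only [Finset.mul_sum, mul_assoc]
  rw [e]
  constructor
  · rw [mul_comm]
    refine (mul_le_mul_of_nonneg_left h (Real.exp_pos _).le).trans ?_
    rw [Finset.mul_sum]
    refine Finset.sum_le_sum fun ω _ => ?_
    split_ifs with hc
    · simpa using (hc.blockLaw_mul_mem hP hPpos hW hd).1
    · simp
  · refine le_of_le_of_eq ?_ (mul_one (Real.exp _))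
    refine le_of_le_of_eq ?_ (congrArg _ (sum_blockTilted (L := L) hP hPpos hW hd))
    rw [Finset.mul_sum]
    refine Finset.sum_le_sum fun ω _ => ?_
    split_ifs with hc
    · simpa using (hc.blockLaw_mul_mem hP hPpos hW hd).2
    · rw [mul_zero]
      exact mul_nonneg (Real.exp_pos _).le (hR ω)

/-- The entropy of one input under the tilted law. -/
noncomputable def tiltedEntropy (P : 𝒳 → ℝ) (W : 𝒳 → 𝒴 → ℝ) : ℝ :=
  ∑ ω, tiltedLaw P W ω * -Real.log (tiltedInput P W ω.1.1)

/-- The typical fragments for the tilted law of one input. -/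
noncomputable def typicalInputs (P : 𝒳 → ℝ) (W : 𝒳 → 𝒴 → ℝ) (L : ℕ) (δ : ℝ) :
    Finset (Fin L → 𝒳) :=
  Finset.univ.filter fun u =>
    |∑ j, -Real.log (tiltedInput P W (u j)) - L * tiltedEntropy P W| < δ * L

theorem prod_tiltedInput_eq (hP : P ∈ stdSimplex ℝ 𝒳) (hPpos : ∀ a, 0 < P a)
    (hW : ∀ a, W a ∈ stdSimplex ℝ 𝒴) (hd : ∀ a b, bhattacharyyaDist W a b < ⊤)
    {L : ℕ} (u : Fin L → 𝒳) : ∏ j, tiltedInput P W (u j) =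
      Real.exp (-∑ j, -Real.log (tiltedInput P W (u j))) := by
  rw [Finset.sum_neg_distrib, neg_neg, Real.exp_sum]
  exact Finset.prod_congr rfl fun j _ => (Real.exp_log (tiltedInput_pos hP hPpos hW hd _)).symm

theorem prod_tiltedInput_mem_of_typical (hP : P ∈ stdSimplex ℝ 𝒳) (hPpos : ∀ a, 0 < P a)
    (hW : ∀ a, W a ∈ stdSimplex ℝ 𝒴) (hd : ∀ a b, bhattacharyyaDist W a b < ⊤)
    {L : ℕ} {δ : ℝ} {u : Fin L → 𝒳} (hu : u ∈ typicalInputs P W L δ) :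
    Real.exp (-(tiltedEntropy P W + δ) * L) ≤ ∏ j, tiltedInput P W (u j) ∧
    ∏ j, tiltedInput P W (u j) ≤ Real.exp (-(tiltedEntropy P W - δ) * L) := by
  have h := abs_lt.1 (Finset.mem_filter.1 hu).2
  rw [prod_tiltedInput_eq hP hPpos hW hd]
  constructor <;> refine Real.exp_le_exp.2 ?_ <;> linarith

/-- Every typical fragment has probability at least exp(-(H + δ)L) under a law of total mass one. -/
theorem card_typicalInputs_le (hP : P ∈ stdSimplex ℝ 𝒳) (hPpos : ∀ a, 0 < P a)
    (hW : ∀ a, W a ∈ stdSimplex ℝ 𝒴) (hd : ∀ a b, bhattacharyyaDist W a b < ⊤)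
    (L : ℕ) (δ : ℝ) :
    ((typicalInputs P W L δ).card : ℝ) ≤ Real.exp ((tiltedEntropy P W + δ) * L) := by
  have h1 : ∑ u : Fin L → 𝒳, ∏ j, tiltedInput P W (u j) = 1 := by
    have h := Finset.prod_univ_sum (fun _ : Fin L => (Finset.univ : Finset 𝒳))
      (fun _ a => tiltedInput P W a)
    rw [Finset.prod_const, sum_tiltedInput hP hPpos hW hd, one_pow, Fintype.piFinset_univ] at h
    exact h.symm
  have h2 : ((typicalInputs P W L δ).card : ℝ) * Real.exp (-(tiltedEntropy P W + δ) * L) ≤ 1 := by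
    rw [← h1, ← nsmul_eq_mul, ← Finset.sum_const]
    refine (Finset.sum_le_sum fun u hu =>
      (prod_tiltedInput_mem_of_typical hP hPpos hW hd hu).1).trans ?_
    exact Finset.sum_le_sum_of_subset_of_nonneg (Finset.subset_univ _) fun u _ _ =>
      Finset.prod_nonneg fun j _ => (tiltedInput_pos hP hPpos hW hd _).le
  rw [← le_div_iff₀ (Real.exp_pos _), one_div, ← Real.exp_neg] at h2
  refine h2.trans (le_of_eq ?_)
  ring_nf

/-- The log-likelihood ratio of the interchanged fragments and both fragments are typical. -/
def TypicalPair (P : 𝒳 → ℝ) (W : 𝒳 → 𝒴 → ℝ) {L : ℕ} (δ : ℝ)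
    (ω : Block 𝒳 𝒴 L × Block 𝒳 𝒴 L) : Prop :=
  |blockFlipLogRatio P W ω| < δ * L ∧ ω.1.1 ∈ typicalInputs P W L δ ∧
    ω.2.1 ∈ typicalInputs P W L δ

theorem typicalPair_flipInput {L : ℕ} {δ : ℝ} (ω : Block 𝒳 𝒴 L × Block 𝒳 𝒴 L) :
    TypicalPair P W δ (flipInput ω) ↔ TypicalPair P W δ ω := by
  unfold TypicalPair
  rw [blockFlipLogRatio_flipInput, abs_neg]
  simp only [flipInput]
  tauto

theorem eventually_half_le_sum_typicalPair (hP : P ∈ stdSimplex ℝ 𝒳) (hPpos : ∀ a, 0 < P a)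
    (hW : ∀ a, W a ∈ stdSimplex ℝ 𝒴) (hd : ∀ a b, bhattacharyyaDist W a b < ⊤)
    {δ : ℝ} (hδ : 0 < δ) :
    ∀ᶠ L : ℕ in atTop, 1 / 2 ≤ ∑ ω : Block 𝒳 𝒴 L × Block 𝒳 𝒴 L, blockTilted P W ω *
      (if TypicalPair P W δ ω then 1 else 0) := by
  have h8 : (0 : ℝ) < 1 / 8 := by norm_num
  filter_upwards [
    eventually_sum_blockTilted_deviation_le hP hPpos hW hd (flipLogRatio P W) hδ h8,
    eventually_sum_blockTilted_deviation_le hP hPpos hW hd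
      (fun ω => -Real.log (tiltedInput P W ω.1.1)) hδ h8] with L h2 h3
  have h4 := h3
  rw [← sum_blockTilted_mul_swap] at h4
  rw [sum_tiltedLaw_mul_flipLogRatio, mul_zero] at h2
  simp only [sub_zero] at h2
  have hpt : ∀ ω : Block 𝒳 𝒴 L × Block 𝒳 𝒴 L, blockTilted P W ω ≤
      blockTilted P W ω * (if TypicalPair P W δ ω then 1 else 0) +
      (blockTilted P W ω * (if δ * L ≤ |∑ j, flipLogRatio P W (letters ω j)| then 1 else 0) +
      (blockTilted P W ω * (if δ * L ≤ |∑ j, -Real.log (tiltedInput P W (letters ω j).1.1) -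
        L * ∑ ω, tiltedLaw P W ω * -Real.log (tiltedInput P W ω.1.1)| then 1 else 0) +
      blockTilted P W ω * (if δ * L ≤ |∑ j, -Real.log (tiltedInput P W (letters ω.swap j).1.1) -
        L * ∑ ω, tiltedLaw P W ω * -Real.log (tiltedInput P W ω.1.1)| then 1 else 0))) := by
    intro ω
    have h0 := blockTilted_nonneg hP hPpos hd ω
    rw [← mul_add, ← mul_add, ← mul_add]
    refine le_mul_of_one_le_right h0 ?_
    by_cases c2 : δ * L ≤ |∑ j, flipLogRatio P W (letters ω j)|
    · rw [if_pos c2]; split_ifs <;> norm_num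
    by_cases c3 : δ * L ≤ |∑ j, -Real.log (tiltedInput P W (letters ω j).1.1) -
        L * ∑ ω, tiltedLaw P W ω * -Real.log (tiltedInput P W ω.1.1)|
    · rw [if_pos c3]; split_ifs <;> norm_num
    by_cases c4 : δ * L ≤ |∑ j, -Real.log (tiltedInput P W (letters ω.swap j).1.1) -
        L * ∑ ω, tiltedLaw P W ω * -Real.log (tiltedInput P W ω.1.1)|
    · rw [if_pos c4]; split_ifs <;> norm_num
    have hc : TypicalPair P W δ ω :=
      ⟨not_le.1 c2, Finset.mem_filter.2 ⟨Finset.mem_univ _, not_le.1 c3⟩,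
        Finset.mem_filter.2 ⟨Finset.mem_univ _, not_le.1 c4⟩⟩
    rw [if_pos hc]
    split_ifs
    all_goals norm_num
  have hs := Finset.sum_le_sum fun ω (_ : ω ∈ Finset.univ) => hpt ω
  rw [sum_blockTilted hP hPpos hW hd] at hs
  simp only [Finset.sum_add_distrib] at hs
  linarith

/-- The product of tilted laws, conditioned on typical pairs. -/
noncomputable def pairLaw (P : 𝒳 → ℝ) (W : 𝒳 → 𝒴 → ℝ) {L : ℕ} (δ : ℝ)
    (ω : Block 𝒳 𝒴 L × Block 𝒳 𝒴 L) : ℝ :=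
  blockTilted P W ω * (if TypicalPair P W δ ω then 1 else 0) /
    ∑ ω : Block 𝒳 𝒴 L × Block 𝒳 𝒴 L, blockTilted P W ω * (if TypicalPair P W δ ω then 1 else 0)

section PairLaw

variable {L : ℕ} {δ : ℝ}

theorem pairLaw_nonneg (hP : P ∈ stdSimplex ℝ 𝒳) (hPpos : ∀ a, 0 < P a)
    (hd : ∀ a b, bhattacharyyaDist W a b < ⊤) (ω : Block 𝒳 𝒴 L × Block 𝒳 𝒴 L) :
    0 ≤ pairLaw P W δ ω := by
  have h : ∀ ω : Block 𝒳 𝒴 L × Block 𝒳 𝒴 L,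
      0 ≤ blockTilted P W ω * (if TypicalPair P W δ ω then 1 else 0) := fun ω =>
    mul_nonneg (blockTilted_nonneg hP hPpos hd ω) (by split_ifs <;> norm_num)
  exact div_nonneg (h ω) (Finset.sum_nonneg fun ω _ => h ω)

theorem pairLaw_flipInput (ω : Block 𝒳 𝒴 L × Block 𝒳 𝒴 L) :
    pairLaw P W δ (flipInput ω) = pairLaw P W δ ω := by
  simp only [pairLaw, blockTilted_flipInput, typicalPair_flipInput]

theorem typicalPair_of_pairLaw {ω : Block 𝒳 𝒴 L × Block 𝒳 𝒴 L} (h : pairLaw P W δ ω ≠ 0) :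
    blockTilted P W ω ≠ 0 ∧ TypicalPair P W δ ω := by
  unfold pairLaw at h
  constructor
  · rintro h0; simp [h0] at h
  · by_contra h0; simp [h0] at h

theorem sum_pairLaw (h : 1 / 2 ≤ ∑ ω : Block 𝒳 𝒴 L × Block 𝒳 𝒴 L, blockTilted P W ω *
      (if TypicalPair P W δ ω then 1 else 0)) :
    ∑ ω : Block 𝒳 𝒴 L × Block 𝒳 𝒴 L, pairLaw P W δ ω = 1 := by
  unfold pairLaw
  rw [← Finset.sum_div, div_self]
  linarith

theorem pairLaw_le (hP : P ∈ stdSimplex ℝ 𝒳) (hPpos : ∀ a, 0 < P a)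
    (hd : ∀ a b, bhattacharyyaDist W a b < ⊤)
    (h : 1 / 2 ≤ ∑ ω : Block 𝒳 𝒴 L × Block 𝒳 𝒴 L, blockTilted P W ω *
      (if TypicalPair P W δ ω then 1 else 0)) (ω : Block 𝒳 𝒴 L × Block 𝒳 𝒴 L) :
    pairLaw P W δ ω ≤ 2 * blockTilted P W ω := by
  have h0 := blockTilted_nonneg hP hPpos hd ω
  unfold pairLaw
  rw [div_le_iff₀ (by linarith)]
  have h1 : blockTilted P W ω * (if TypicalPair P W δ ω then 1 else 0) ≤ blockTilted P W ω :=
    mul_le_of_le_one_right h0 (by split_ifs <;> norm_num)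
  nlinarith

/-- The price of the change of measure for one pair. The factor 2 pays for conditioning on an event
of mass at least 1/2. -/
theorem pairLaw_le_blockLaw_mul (hP : P ∈ stdSimplex ℝ 𝒳) (hPpos : ∀ a, 0 < P a)
    (hW : ∀ a, W a ∈ stdSimplex ℝ 𝒴) (hd : ∀ a b, bhattacharyyaDist W a b < ⊤)
    (h : 1 / 2 ≤ ∑ ω : Block 𝒳 𝒴 L × Block 𝒳 𝒴 L, blockTilted P W ω *
      (if TypicalPair P W δ ω then 1 else 0)) (ω : Block 𝒳 𝒴 L × Block 𝒳 𝒴 L) :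
    pairLaw P W δ ω ≤
      2 * Real.exp ((2 * psi₂ P W + δ) * L) * (blockLaw P W ω.1 * blockLaw P W ω.2) := by
  have hq : 0 ≤ blockLaw P W ω.1 * blockLaw P W ω.2 :=
    mul_nonneg (blockLaw_nonneg hPpos hW _) (blockLaw_nonneg hPpos hW _)
  by_cases h0 : pairLaw P W δ ω = 0
  · rw [h0]; positivity
  obtain ⟨h1, h2, -, -⟩ := typicalPair_of_pairLaw h0
  refine (pairLaw_le hP hPpos hd h ω).trans ?_
  rw [mul_assoc]
  refine mul_le_mul_of_nonneg_left ?_ zero_le_two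
  rw [blockLaw_mul_eq hP hPpos hW hd h1, ← mul_assoc, ← Real.exp_add]
  refine le_mul_of_one_le_left (blockTilted_nonneg hP hPpos hd ω) (Real.one_le_exp ?_)
  have := abs_lt.1 h2
  nlinarith

theorem sum_pairLaw_mul_le (hP : P ∈ stdSimplex ℝ 𝒳) (hPpos : ∀ a, 0 < P a)
    (hd : ∀ a b, bhattacharyyaDist W a b < ⊤)
    (h : 1 / 2 ≤ ∑ ω : Block 𝒳 𝒴 L × Block 𝒳 𝒴 L, blockTilted P W ω *
      (if TypicalPair P W δ ω then 1 else 0)) {f : Block 𝒳 𝒴 L × Block 𝒳 𝒴 L → ℝ}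
    (hf : ∀ ω, 0 ≤ f ω) :
    ∑ ω, pairLaw P W δ ω * f ω ≤ 2 * ∑ ω, blockTilted P W ω * f ω := by
  rw [Finset.mul_sum]
  refine Finset.sum_le_sum fun ω _ => ?_
  rw [← mul_assoc]
  exact mul_le_mul_of_nonneg_right (pairLaw_le hP hPpos hd h ω) (hf ω)

/-- Conditioning on typical fragments turns an average statement into a bound uniform in `u`, since
atypical fragments have no mass at all. -/
theorem sum_pairLaw_input_le (hP : P ∈ stdSimplex ℝ 𝒳) (hPpos : ∀ a, 0 < P a)
    (hW : ∀ a, W a ∈ stdSimplex ℝ 𝒴) (hd : ∀ a b, bhattacharyyaDist W a b < ⊤)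
    (h : 1 / 2 ≤ ∑ ω : Block 𝒳 𝒴 L × Block 𝒳 𝒴 L, blockTilted P W ω *
      (if TypicalPair P W δ ω then 1 else 0)) (u : Fin L → 𝒳) :
    ∑ ω : Block 𝒳 𝒴 L × Block 𝒳 𝒴 L, pairLaw P W δ ω * (if ω.1.1 = u then 1 else 0) ≤
      2 * Real.exp (-(tiltedEntropy P W - δ) * L) := by
  by_cases hu : u ∈ typicalInputs P W L δ
  · refine (sum_pairLaw_mul_le hP hPpos hd h fun ω => by split_ifs <;> norm_num).trans ?_
    rw [sum_blockTilted_input]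
    exact mul_le_mul_of_nonneg_left (prod_tiltedInput_mem_of_typical hP hPpos hW hd hu).2
      zero_le_two
  · rw [Finset.sum_eq_zero]
    · positivity
    · intro ω _
      by_cases h0 : pairLaw P W δ ω = 0
      · rw [h0, zero_mul]
      · rw [if_neg, mul_zero]
        rintro rfl
        exact hu (typicalPair_of_pairLaw h0).2.2.1

theorem sum_pairLaw_input_snd (u : Fin L → 𝒳) :
    ∑ ω : Block 𝒳 𝒴 L × Block 𝒳 𝒴 L, pairLaw P W δ ω * (if ω.2.1 = u then 1 else 0) =
    ∑ ω : Block 𝒳 𝒴 L × Block 𝒳 𝒴 L, pairLaw P W δ ω * (if ω.1.1 = u then 1 else 0) := by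
  rw [← sum_comp_flipInput fun ω : Block 𝒳 𝒴 L × Block 𝒳 𝒴 L =>
    pairLaw P W δ ω * (if ω.1.1 = u then 1 else 0)]
  refine Finset.sum_congr rfl fun ω _ => ?_
  rw [pairLaw_flipInput]
  rfl

/-- Of the factor 4, one factor 2 comes from the conditioning and one from the union bound over the
two components of the guess. -/
theorem sum_pairLaw_hit_le (hP : P ∈ stdSimplex ℝ 𝒳) (hPpos : ∀ a, 0 < P a)
    (hd : ∀ a b, bhattacharyyaDist W a b < ⊤)
    (h : 1 / 2 ≤ ∑ ω : Block 𝒳 𝒴 L × Block 𝒳 𝒴 L, blockTilted P W ω *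
      (if TypicalPair P W δ ω then 1 else 0))
    (g : (Fin L → 𝒳) × (Fin L → 𝒳)) (y : (Fin L → 𝒴) × (Fin L → 𝒴)) :
    ∑ x : (Fin L → 𝒳) × (Fin L → 𝒳), pairLaw P W δ ((x.1, y.1), (x.2, y.2)) *
      (if Hit g ((x.1, y.1), (x.2, y.2)) then 1 else 0) ≤
      4 * ∏ j, bestGuess P W (y.1 j, y.2 j) := by
  have hR := blockTilted_nonneg (L := L) hP hPpos hd
  -- By this symmetry, guessing the second input is the same as guessing the first, so `bestGuess`
  -- is only needed for one of them.
  have hflip : ∀ u v : Fin L → 𝒳, blockTilted P W ((u, y.1), (v, y.2)) =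
      blockTilted P W ((v, y.1), (u, y.2)) := fun u v =>
    blockTilted_flipInput ((v, y.1), (u, y.2))
  have hpt : ∀ x : (Fin L → 𝒳) × (Fin L → 𝒳), pairLaw P W δ ((x.1, y.1), (x.2, y.2)) *
      (if Hit g ((x.1, y.1), (x.2, y.2)) then 1 else 0) ≤
      2 * ((if x.1 = g.1 then blockTilted P W ((x.1, y.1), (x.2, y.2)) else 0) +
        (if x.2 = g.2 then blockTilted P W ((x.1, y.1), (x.2, y.2)) else 0)) := by
    intro x
    have h1 := pairLaw_le hP hPpos hd h ((x.1, y.1), (x.2, y.2))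
    have h2 := hR ((x.1, y.1), (x.2, y.2))
    by_cases c1 : x.1 = g.1
    · rw [if_pos c1]
      have h3 := pairLaw_nonneg (δ := δ) hP hPpos hd ((x.1, y.1), (x.2, y.2))
      split_ifs <;> linarith
    · by_cases c2 : x.2 = g.2
      · rw [if_pos c2, if_neg c1]
        have h3 := pairLaw_nonneg (δ := δ) hP hPpos hd ((x.1, y.1), (x.2, y.2))
        split_ifs <;> linarith
      · rw [if_neg c1, if_neg c2, if_neg]
        · simp
        · rintro (h | h)
          · exact c1 h.symm
          · exact c2 h.symm
  refine (Finset.sum_le_sum fun x _ => hpt x).trans ?_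
  rw [← Finset.mul_sum, Finset.sum_add_distrib]
  have e1 : ∑ x : (Fin L → 𝒳) × (Fin L → 𝒳),
      (if x.1 = g.1 then blockTilted P W ((x.1, y.1), (x.2, y.2)) else 0) =
      ∑ v, blockTilted P W ((g.1, y.1), (v, y.2)) := by
    rw [Fintype.sum_prod_type, Finset.sum_comm]
    simp
  have e2 : ∑ x : (Fin L → 𝒳) × (Fin L → 𝒳),
      (if x.2 = g.2 then blockTilted P W ((x.1, y.1), (x.2, y.2)) else 0) =
      ∑ v, blockTilted P W ((g.2, y.1), (v, y.2)) := by
    rw [Fintype.sum_prod_type]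
    simp only [Finset.sum_ite_eq', Finset.mem_univ, if_true]
    exact Finset.sum_congr rfl fun v _ => hflip v g.2
  rw [e1, e2]
  have h1 := sum_blockTilted_guess_le (W := W) hP hPpos hd g.1 y
  have h2 := sum_blockTilted_guess_le (W := W) hP hPpos hd g.2 y
  linarith

end PairLaw

end TypicalPairs

end SeqReorder

namespace SeqReorder

/-! ### The failure probability at level zero -/

section FailureProbability

open scoped Classical

variable {𝒳 𝒴 : Type*} [Fintype 𝒳] [Fintype 𝒴] {P : 𝒳 → ℝ} {W : 𝒳 → 𝒴 → ℝ} {M L : ℕ}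

theorem pmean_ite_mono {ι Z : Type*} [Fintype ι] [Fintype Z] {q : Z → ℝ} (hq : ∀ a, 0 ≤ q a)
    {p p' : (ι → Z) → Prop} {_ : DecidablePred p} {_ : DecidablePred p'} (h : ∀ z, p z → p' z) :
    pmean q (fun z => if p z then 1 else 0) ≤ pmean q (fun z => if p' z then 1 else 0) := by
  refine pmean_mono hq fun z => ?_
  by_cases hz : p z
  · rw [if_pos hz, if_pos (h z hz)]
  · rw [if_neg hz]
    split_ifs <;> norm_num

/-- The reconstruction from the fragments and the reference sequence of the blocks `z`. -/
def reconstruct (φ : Reconstruction 𝒳 𝒴 M L) (z : Fin M → Block 𝒳 𝒴 L) : Fin M → Fin L → 𝒳 :=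
  φ (fragments fun i => (z i).1) fun i => (z i).2

theorem FP_eq_pmean (φ : Reconstruction 𝒳 𝒴 M L) (ξ : ℝ) :
    FP P W φ ξ = pmean (blockLaw P W) fun z : Fin M → Block 𝒳 𝒴 L =>
      if 0 < failFraction (fun i => (z i).1) (reconstruct φ z) ∧
        ξ ≤ failFraction (fun i => (z i).1) (reconstruct φ z) then 1 else 0 := by
  rw [pmean_prod_type]
  unfold FP
  refine Finset.sum_congr (by ext; simp) fun x _ => Finset.sum_congr (by ext; simp) fun y _ => ?_
  have hw : ∏ i, blockLaw P W (x i, y i) = sourceProb P x * likelihood W x y := by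
    simp only [sourceProb, likelihood, blockLaw, jointLaw, Finset.prod_mul_distrib]
  rw [hw]
  change _ = _ * (if 0 < failFraction x (φ (fragments x) y) ∧
    ξ ≤ failFraction x (φ (fragments x) y) then 1 else 0)
  split_ifs <;> simp

theorem pmean_le_FP (hPpos : ∀ a, 0 < P a) (hW : ∀ a, W a ∈ stdSimplex ℝ 𝒴)
    (φ : Reconstruction 𝒳 𝒴 M L) (ξ : ℝ) (p : (Fin M → Block 𝒳 𝒴 L) → Prop)
    [DecidablePred p] (h : ∀ z, p z → 0 < (Finset.univ.filter fun i => reconstruct φ z i ≠ (z i).1).card ∧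
      ξ * M ≤ (Finset.univ.filter fun i => reconstruct φ z i ≠ (z i).1).card) :
    pmean (blockLaw P W) (fun z : Fin M → Block 𝒳 𝒴 L => if p z then 1 else 0) ≤ FP P W φ ξ := by
  rw [FP_eq_pmean]
  refine pmean_mono (blockLaw_nonneg hPpos hW) fun z => ?_
  by_cases hz : p z
  · obtain ⟨h1, h2⟩ := h z hz
    have hM : 0 < M := by
      rcases Nat.eq_zero_or_pos M with rfl | h0
      · simp at h1
      · exact h0
    have hM' : (0 : ℝ) < M := by exact_mod_cast hM
    rw [if_pos hz, if_pos]
    unfold failFraction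
    refine ⟨div_pos ?_ hM', ?_⟩
    · convert! (Nat.cast_pos (α := ℝ)).2 h1
    · rw [le_div_iff₀ hM']
      convert! h2
  · rw [if_neg hz]
    split_ifs <;> norm_num

omit [Fintype 𝒳] in
theorem fragments_eq_sum (x : Fin M → Fin L → 𝒳) :
    fragments x = ∑ i, ({x i} : Multiset (Fin L → 𝒳)) := by
  rw [Finset.sum_eq_multiset_sum, fragments, ← Multiset.sum_map_singleton (Multiset.map x _),
    Multiset.map_map]
  rfl

omit [Fintype 𝒳] in
theorem fragments_comp_perm (x : Fin M → Fin L → 𝒳) (π : Equiv.Perm (Fin M)) :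
    fragments (fun i => x (π i)) = fragments x := by
  rw [fragments_eq_sum, fragments_eq_sum]
  exact Equiv.sum_comp π fun i => ({x i} : Multiset (Fin L → 𝒳))

omit [Fintype 𝒳] [Fintype 𝒴] in
-- An interchange of inputs permutes the fragments and keeps the reference, so the observations are
-- unchanged.
theorem reconstruct_swapInput (φ : Reconstruction 𝒳 𝒴 M L) (i j : Fin M)
    (z : Fin M → Block 𝒳 𝒴 L) : reconstruct φ (swapInput i j z) = reconstruct φ z := by
  unfold reconstruct
  congr 1
  exact fragments_comp_perm (fun i => (z i).1)
    -- The interchange is defined with classical decidable equality, which differs from the instance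
    -- found for `Fin M`.
    (@Equiv.swap _ (fun _ _ => Classical.propDecidable _) i j)

/-- The second moment bound combined with one interchange. The constant 48 is 6 · 2 · 2 · 2: the
halves have product at least M²/6, the second moment loses a factor 2, the confusable mass another,
and the passage to failures the last. -/
theorem le_FP_zero (hP : P ∈ stdSimplex ℝ 𝒳) (hPpos : ∀ a, 0 < P a)
    (hW : ∀ a, W a ∈ stdSimplex ℝ 𝒴) (hd : ∀ a b, bhattacharyyaDist W a b < ⊤)
    {δ : ℝ} (hδ : 0 ≤ δ) (h : 1 / 2 ≤ ∑ ω : Block 𝒳 𝒴 L × Block 𝒳 𝒴 L, blockTilted P W ω *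
      (if Confusable P W δ ω.1 ω.2 then 1 else 0)) (hM : 2 ≤ M)
    (hκ : M * Real.exp (-(psi₂ P W - 2 * δ) * L) ≤ 1 / 4) (φ : Reconstruction 𝒳 𝒴 M L) :
    (M : ℝ) ^ 2 / 48 * Real.exp (-(2 * psi₂ P W + 2 * δ) * L) ≤ FP P W φ 0 := by
  set q : Block 𝒳 𝒴 L → ℝ := blockLaw P W with hq
  have hq0 : ∀ a, 0 ≤ q a := blockLaw_nonneg hPpos hW
  set T : Block 𝒳 𝒴 L → Block 𝒳 𝒴 L → Prop := Confusable P W δ with hT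
  obtain ⟨hτ1, hτ2⟩ := Confusable.sum_sum_blockLaw_mem hP hPpos hW hd h
  set τ := ∑ a : Block 𝒳 𝒴 L, q a * ∑ b, q b * (if T a b then 1 else 0) with hτ
  set κ := Real.exp (-(psi₂ P W - 2 * δ) * L) with hκdef
  have hκ0 : 0 < κ := Real.exp_pos _
  have hM0 : (2 : ℝ) ≤ M := by exact_mod_cast hM
  have hL0 : (0 : ℝ) ≤ L := Nat.cast_nonneg L
  have hτκ : τ ≤ κ ^ 2 := by
    refine hτ2.trans ?_
    rw [hκdef, ← Real.exp_nat_mul]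
    refine Real.exp_le_exp.2 ?_
    push_cast
    nlinarith [mul_nonneg hδ hL0]
  -- Pairs are taken between the two halves of the positions, so that two pairs can share only a
  -- first or only a second block unless they coincide.
  set I : Finset (Fin M) := Finset.univ.filter fun i => i.val < M / 2 with hI
  set J : Finset (Fin M) := Finset.univ.filter fun i => ¬ i.val < M / 2 with hJ
  have hIJ : Disjoint I J := Finset.disjoint_filter_filter_not _ _ _
  have hcard : I.card + J.card = M := by
    rw [hI, hJ, Finset.card_filter_add_card_filter_not, Finset.card_univ, Fintype.card_fin]
  have hIc : I.card = M / 2 := by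
    rw [hI, Fin.card_filter_val_lt]
    omega
  have hIr : (M : ℝ) ≤ 3 * I.card := by
    have : M ≤ 3 * I.card := by omega
    exact_mod_cast this
  have hJr : (M : ℝ) ≤ 2 * J.card := by
    have : M ≤ 2 * J.card := by omega
    exact_mod_cast this
  have hsum : (I.card : ℝ) + J.card = M := by exact_mod_cast hcard
  have hlow := le_pmean_exists_pair hq0 (sum_blockLaw hP hW) T (κ := κ) (τ := τ)
    (Confusable.sum_blockLaw_le hP hPpos hW hd)
    (fun b => by
      refine le_of_eq_of_le ?_ (Confusable.sum_blockLaw_le hP hPpos hW hd b)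
      refine Finset.sum_congr rfl fun a _ => ?_
      congr 1
      exact if_congr ⟨Confusable.symm, Confusable.symm⟩ rfl rfl)
    hκ0.le rfl hIJ
  have hθ1 : Real.exp (-δ * L) ≤ 1 := Real.exp_le_one_iff.2 (by nlinarith)
  have hfail := pmean_exists_swap_le_pmean_fail (ι := Fin M) hq0 T hθ1
    (fun a b hab => ⟨hab.2.1, hab.le_blockLaw_flip hP hPpos hW hd⟩)
    (reconstruct φ) (fun i j z => reconstruct_swapInput φ i j z)
  have hFP := pmean_le_FP hPpos hW φ 0 (fun z => ∃ i, reconstruct φ z i ≠ (z i).1)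
    fun z ⟨i, hi⟩ => ⟨Finset.card_pos.2 ⟨i, Finset.mem_filter.2 ⟨Finset.mem_univ _, hi⟩⟩, by simp⟩
  have hτ0 : 0 ≤ τ := le_trans (by positivity) hτ1
  have hIJ1 : (M : ℝ) ^ 2 / 6 ≤ I.card * J.card := by nlinarith
  have hIJ2 : (I.card : ℝ) * J.card * τ ≤ 1 / 4 := by
    have h1 : (I.card : ℝ) * J.card ≤ M ^ 2 := by
      have : (0 : ℝ) ≤ I.card := Nat.cast_nonneg _
      have : (0 : ℝ) ≤ J.card := Nat.cast_nonneg _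
      nlinarith
    have h2 : (M : ℝ) ^ 2 * τ ≤ (M * κ) ^ 2 := by
      rw [mul_pow]; exact mul_le_mul_of_nonneg_left hτκ (sq_nonneg _)
    have h3 : (M * κ) ^ 2 ≤ (1 / 4) ^ 2 := pow_le_pow_left₀ (by positivity) hκ 2
    have h4 := mul_le_mul_of_nonneg_right h1 hτ0
    linarith
  -- The monotonicity step with the identity implication only reconciles two decidability instances
  -- of the same event.
  have hchain := (mul_le_mul_of_nonneg_left (hlow.trans
    (pmean_ite_mono hq0 fun z ⟨i, _, j, _, h⟩ => ⟨i, j, h⟩)) (Real.exp_pos (-δ * L)).le).trans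
    (hfail.trans (mul_le_mul_of_nonneg_left
      ((pmean_ite_mono hq0 fun _ h => h).trans hFP) zero_le_two))
  have hmid : (M : ℝ) ^ 2 / 12 * τ ≤
      I.card * J.card * τ * (1 - (I.card + J.card) * κ - I.card * J.card * τ) := by
    rw [hsum]
    have h1 : (M : ℝ) ^ 2 / 6 * τ ≤ I.card * J.card * τ := mul_le_mul_of_nonneg_right hIJ1 hτ0
    have h2 : 1 / 2 ≤ 1 - M * κ - I.card * J.card * τ := by linarith
    have h3 : 0 ≤ (I.card : ℝ) * J.card * τ := by positivity
    nlinarith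
  have hexp : Real.exp (-(2 * psi₂ P W + 2 * δ) * L) =
      Real.exp (-δ * L) * Real.exp (-(2 * psi₂ P W + δ) * L) := by
    rw [← Real.exp_add]; ring_nf
  have h5 := (mul_le_mul_of_nonneg_left hmid (Real.exp_pos (-δ * L)).le).trans hchain
  have h6 := mul_le_mul_of_nonneg_left hτ1
    (mul_nonneg (Real.exp_pos (-δ * L)).le (by positivity : (0 : ℝ) ≤ M ^ 2 / 12))
  rw [hexp]
  nlinarith

end FailureProbability

end SeqReorder

namespace SeqReorder

/-! ### Splitting the blocks into disjoint pairs and a remainder -/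

section PairedBlocks

open scoped Classical

variable {𝒳 𝒴 : Type*} [Fintype 𝒳] [Fintype 𝒴] {P : 𝒳 → ℝ} {W : 𝒳 → 𝒴 → ℝ} {M L K R : ℕ}

/-- The sequence of blocks made up of the pairs `c` and the remaining blocks `r`. -/
def joinBlocks {α : Type*} (e : (Fin K ⊕ Fin K) ⊕ Fin R ≃ Fin M) (c : Fin K → α × α)
    (r : Fin R → α) (i : Fin M) : α :=
  Sum.elim (Sum.elim (fun k => (c k).1) (fun k => (c k).2)) r (e.symm i)

theorem pmean_eq_pmean_joinBlocks {Z : Type*} [Fintype Z] (q : Z → ℝ)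
    (e : (Fin K ⊕ Fin K) ⊕ Fin R ≃ Fin M) (F : (Fin M → Z) → ℝ) :
    pmean q F = pmean q fun r : Fin R → Z =>
      pmean (fun p : Z × Z => q p.1 * q p.2) fun c : Fin K → Z × Z => F (joinBlocks e c r) := by
  rw [pmean_comp_equiv e.symm, pmean_sum_type]
  congr 1
  ext r
  rw [pmean_double]
  rfl

/-- The reconstructed fragments at the positions of the pairs. -/
def pairGuess (φ : Reconstruction 𝒳 𝒴 M L) (e : (Fin K ⊕ Fin K) ⊕ Fin R ≃ Fin M)
    (r : Fin R → Block 𝒳 𝒴 L) (c : Fin K → Block 𝒳 𝒴 L × Block 𝒳 𝒴 L) (k : Fin K) :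
    (Fin L → 𝒳) × (Fin L → 𝒳) :=
  (reconstruct φ (joinBlocks e c r) (e (.inl (.inl k))),
    reconstruct φ (joinBlocks e c r) (e (.inl (.inr k))))

omit [Fintype 𝒳] [Fintype 𝒴] in
theorem fragments_joinBlocks (e : (Fin K ⊕ Fin K) ⊕ Fin R ≃ Fin M)
    (r : Fin R → Block 𝒳 𝒴 L) (c : Fin K → Block 𝒳 𝒴 L × Block 𝒳 𝒴 L) :
    fragments (fun i => (joinBlocks e c r i).1) =
      ∑ k, (({(c k).1.1} : Multiset (Fin L → 𝒳)) + {(c k).2.1}) + ∑ j, {(r j).1} := by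
  rw [fragments_eq_sum, ← Equiv.sum_comp e, Fintype.sum_sum_type, Fintype.sum_sum_type,
    Finset.sum_add_distrib]
  simp [joinBlocks]

omit [Fintype 𝒳] [Fintype 𝒴] in
-- Flips reorder the fragments only within pairs and do not touch the reference, so the algorithm
-- sees the same data.
theorem pairGuess_flipInputOn (φ : Reconstruction 𝒳 𝒴 M L)
    (e : (Fin K ⊕ Fin K) ⊕ Fin R ≃ Fin M) (r : Fin R → Block 𝒳 𝒴 L) (s : Fin K → Bool)
    (c : Fin K → Block 𝒳 𝒴 L × Block 𝒳 𝒴 L) :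
    pairGuess φ e r (flipInputOn s c) = pairGuess φ e r c := by
  have h1 : fragments (fun i => (joinBlocks e (flipInputOn s c) r i).1) =
      fragments (fun i => (joinBlocks e c r i).1) := by
    rw [fragments_joinBlocks, fragments_joinBlocks]
    congr 1
    refine Finset.sum_congr rfl fun k _ => ?_
    simp only [flipInputOn]
    split_ifs
    · simp only [flipInput]; exact add_comm _ _
    · rfl
  have h2 : (fun i => (joinBlocks e (flipInputOn s c) r i).2) =
      fun i => (joinBlocks e c r i).2 := by
    ext i : 1
    unfold joinBlocks
    rcases e.symm i with (k | k) | j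
    · simp only [Sum.elim_inl, flipInputOn]; split_ifs <;> rfl
    · simp only [Sum.elim_inl, Sum.elim_inr, flipInputOn]; split_ifs <;> rfl
    · rfl
  have h : reconstruct φ (joinBlocks e (flipInputOn s c) r) =
      reconstruct φ (joinBlocks e c r) := by
    unfold reconstruct
    rw [h1, h2]
  unfold pairGuess
  rw [h]

omit [Fintype 𝒳] [Fintype 𝒴] in
theorem two_mul_card_bothWrong_le (φ : Reconstruction 𝒳 𝒴 M L)
    (e : (Fin K ⊕ Fin K) ⊕ Fin R ≃ Fin M) (r : Fin R → Block 𝒳 𝒴 L)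
    (c : Fin K → Block 𝒳 𝒴 L × Block 𝒳 𝒴 L) :
    2 * (Finset.univ.filter fun k => BothWrong (pairGuess φ e r c k) (c k)).card ≤
      (Finset.univ.filter fun i =>
        reconstruct φ (joinBlocks e c r) i ≠ (joinBlocks e c r i).1).card := by
  set B := Finset.univ.filter fun k => BothWrong (pairGuess φ e r c k) (c k) with hB
  have hcard : ((B.disjSum B).image fun k => e (.inl k)).card = 2 * B.card := by
    rw [Finset.card_image_of_injective (f := fun k => e (.inl k)) _
      (e.injective.comp Sum.inl_injective), Finset.card_disjSum, two_mul]
  rw [← hcard]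
  refine Finset.card_le_card fun i hi => ?_
  obtain ⟨k, hk, rfl⟩ := Finset.mem_image.1 hi
  refine Finset.mem_filter.2 ⟨Finset.mem_univ _, ?_⟩
  rcases Finset.mem_disjSum.1 hk with ⟨k, hB, rfl⟩ | ⟨k, hB, rfl⟩
  · have := (Finset.mem_filter.1 hB).2.1
    simpa [joinBlocks, pairGuess] using this
  · have := (Finset.mem_filter.1 hB).2.2
    simpa [joinBlocks, pairGuess] using this

theorem pmean_le_pow_mul_pmean {ι Z : Type*} [Fintype ι] [Fintype Z] {q q' : Z → ℝ} {C : ℝ}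
    (hq' : ∀ a, 0 ≤ q' a) (h : ∀ a, q' a ≤ C * q a) {F : (ι → Z) → ℝ} (hF : ∀ z, 0 ≤ F z) :
    pmean q' F ≤ C ^ Fintype.card ι * pmean q F := by
  unfold pmean
  rw [Finset.mul_sum]
  refine Finset.sum_le_sum fun z _ => ?_
  rw [← mul_assoc]
  refine mul_le_mul_of_nonneg_right ?_ (hF z)
  rw [← Finset.card_univ, ← Finset.prod_const, ← Finset.prod_mul_distrib]
  exact Finset.prod_le_prod (fun _ _ => hq' _) fun _ _ => h _

/-- If a guess rarely protects more than `t` of `K` disjoint pairs from a double failure, then it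
fails at more than `2 (K - t)` fragments with about the probability that all pairs are
confusable. -/
theorem le_FP_of_protected (hP : P ∈ stdSimplex ℝ 𝒳) (hPpos : ∀ a, 0 < P a)
    (hW : ∀ a, W a ∈ stdSimplex ℝ 𝒴) (hd : ∀ a b, bhattacharyyaDist W a b < ⊤) {δ ξ t : ℝ}
    (h : 1 / 2 ≤ ∑ ω : Block 𝒳 𝒴 L × Block 𝒳 𝒴 L, blockTilted P W ω *
      (if TypicalPair P W δ ω then 1 else 0))
    (φ : Reconstruction 𝒳 𝒴 M L) (e : (Fin K ⊕ Fin K) ⊕ Fin R ≃ Fin M)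
    (hprot : ∀ r, pmean (pairLaw P W δ) (fun c : Fin K → Block 𝒳 𝒴 L × Block 𝒳 𝒴 L =>
      if t ≤ ((Finset.univ.filter fun k => Protected (pairGuess φ e r c k) (c k)).card : ℝ)
        then 1 else 0) ≤ 1 / 2)
    (ht : t < K) (hξ : ξ * M ≤ 2 * (K - t)) :
    1 / 2 ≤ (4 * Real.exp ((2 * psi₂ P W + δ) * L)) ^ K * FP P W φ ξ := by
  set q : Block 𝒳 𝒴 L → ℝ := blockLaw P W with hq
  have hq0 : ∀ a, 0 ≤ q a := blockLaw_nonneg hPpos hW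
  have hρ0 := pairLaw_nonneg (W := W) (L := L) (δ := δ) hP hPpos hd
  have hρ1 := sum_pairLaw h
  set G : (Fin M → Block 𝒳 𝒴 L) → Prop := fun z =>
    2 * ((K : ℝ) - t) ≤ ((Finset.univ.filter fun i => reconstruct φ z i ≠ (z i).1).card : ℝ) with hG
  have hFP : pmean q (fun z => if G z then 1 else 0) ≤ FP P W φ ξ := by
    refine pmean_le_FP hPpos hW φ ξ G fun z hz => ?_
    simp only [hG] at hz
    refine ⟨?_, hξ.trans hz⟩
    have : (0 : ℝ) < ((Finset.univ.filter fun i => reconstruct φ z i ≠ (z i).1).card : ℝ) := by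
      linarith
    exact_mod_cast this
  -- The remaining blocks are frozen and keep their original law; the change of measure acts on the
  -- pairs alone.
  have hrest : ∀ r : Fin R → Block 𝒳 𝒴 L, 1 / 2 ≤
      (4 * Real.exp ((2 * psi₂ P W + δ) * L)) ^ K *
      pmean (fun p : Block 𝒳 𝒴 L × Block 𝒳 𝒴 L => q p.1 * q p.2)
        (fun c : Fin K → Block 𝒳 𝒴 L × Block 𝒳 𝒴 L =>
          if G (joinBlocks e c r) then 1 else 0) := by
    intro r
    have h1 := pmean_card_protected_le hρ0 pairLaw_flipInput (pairGuess φ e r)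
      (pairGuess_flipInputOn φ e r) t
    have h2 : 1 / 2 ≤ pmean (pairLaw P W δ) (fun c : Fin K → Block 𝒳 𝒴 L × Block 𝒳 𝒴 L =>
        if ((Finset.univ.filter fun k => Protected (pairGuess φ e r c k) (c k)).card : ℝ) ≤ t
        then 1 else 0) := by
      have h3 : (1 : ℝ) ≤ pmean (pairLaw P W δ)
          (fun c : Fin K → Block 𝒳 𝒴 L × Block 𝒳 𝒴 L =>
          (if ((Finset.univ.filter fun k => Protected (pairGuess φ e r c k) (c k)).card : ℝ) ≤ t
            then 1 else 0) + (if t ≤ ((Finset.univ.filter fun k =>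
              Protected (pairGuess φ e r c k) (c k)).card : ℝ) then 1 else 0)) := by
        refine (pmean_const (ι := Fin K) hρ1 1).symm.le.trans (pmean_mono hρ0 fun c => ?_)
        rcases le_total ((Finset.univ.filter fun k =>
          Protected (pairGuess φ e r c k) (c k)).card : ℝ) t with h4 | h4
        · rw [if_pos h4]; split_ifs <;> norm_num
        · rw [if_pos h4]; split_ifs <;> norm_num
      rw [pmean_add] at h3
      have := hprot r
      linarith
    have h5 : pmean (pairLaw P W δ) (fun c : Fin K → Block 𝒳 𝒴 L × Block 𝒳 𝒴 L =>
        if (Fintype.card (Fin K) : ℝ) - t ≤ ((Finset.univ.filter fun k =>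
          BothWrong (pairGuess φ e r c k) (c k)).card : ℝ) then 1 else 0) ≤
        pmean (pairLaw P W δ) (fun c : Fin K → Block 𝒳 𝒴 L × Block 𝒳 𝒴 L =>
          if G (joinBlocks e c r) then 1 else 0) := by
      refine pmean_ite_mono hρ0 fun c hc => ?_
      rw [Fintype.card_fin] at hc
      have h6 : (2 : ℝ) * ((Finset.univ.filter fun k =>
          BothWrong (pairGuess φ e r c k) (c k)).card : ℝ) ≤
          ((Finset.univ.filter fun i =>
            reconstruct φ (joinBlocks e c r) i ≠ (joinBlocks e c r i).1).card : ℝ) := by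
        exact_mod_cast two_mul_card_bothWrong_le φ e r c
      simp only [hG]
      linarith
    have h7 := pmean_le_pow_mul_pmean (ι := Fin K) hρ0
      (pairLaw_le_blockLaw_mul hP hPpos hW hd h)
      (F := fun c => if G (joinBlocks e c r) then 1 else 0) fun c => by split_ifs <;> norm_num
    rw [Fintype.card_fin] at h1 h7
    -- Per pair, one factor 2 is the choice of orientation and the other comes from
    -- `pairLaw_le_blockLaw_mul`.
    have h8 : (4 * Real.exp ((2 * psi₂ P W + δ) * L)) ^ K =
        2 ^ K * (2 * Real.exp ((2 * psi₂ P W + δ) * L)) ^ K := by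
      rw [← mul_pow]; ring_nf
    rw [h8, mul_assoc]
    rw [Fintype.card_fin] at h5
    exact h2.trans (h1.trans (mul_le_mul_of_nonneg_left (h5.trans h7) (by positivity)))
  refine le_trans ?_ (mul_le_mul_of_nonneg_left hFP (by positivity))
  rw [pmean_eq_pmean_joinBlocks q e, ← pmean_const_mul,
    ← pmean_const (ι := Fin R) (sum_blockLaw hP hW) (1 / 2)]
  exact pmean_mono hq0 hrest

end PairedBlocks

end SeqReorder

namespace SeqReorder

/-! ### Protected pairs are few: collisions and hits -/

section Protection

open scoped Classical

variable {𝒳 𝒴 : Type*} [Fintype 𝒳] [Fintype 𝒴] {P : 𝒳 → ℝ} {W : 𝒳 → 𝒴 → ℝ} {M L K R : ℕ}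

theorem two_mul_add_eq_of_equiv (e : (Fin K ⊕ Fin K) ⊕ Fin R ≃ Fin M) : 2 * K + R = M := by
  have := Fintype.card_congr e
  simp only [Fintype.card_sum, Fintype.card_fin] at this
  omega

omit [Fintype 𝒳] [Fintype 𝒴] in
/-- A pair protected against a maximum likelihood reconstruction has equal inputs or shares an
input with another block. -/
theorem Protected.collision {φ : Reconstruction 𝒳 𝒴 M L} (hφ : IsML W φ)
    (e : (Fin K ⊕ Fin K) ⊕ Fin R ≃ Fin M) (r : Fin R → Block 𝒳 𝒴 L)
    (c : Fin K → Block 𝒳 𝒴 L × Block 𝒳 𝒴 L) (k : Fin K)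
    (h : Protected (pairGuess φ e r c k) (c k)) :
    (c k).1.1 = (c k).2.1 ∨ ∃ u, ((c k).1.1 = u ∨ (c k).2.1 = u) ∧
      (u ∈ Finset.univ.image (fun j => (r j).1) ∨
        ∃ k' ≠ k, (c k').1.1 = u ∨ (c k').2.1 = u) := by
  by_cases huv : (c k).1.1 = (c k).2.1
  · exact Or.inl huv
  right
  set x : Fin M → Fin L → 𝒳 := fun i => (joinBlocks e c r i).1 with hx
  obtain ⟨π, hπ⟩ := (hφ x fun i => (joinBlocks e c r i).2).1
  have hg : pairGuess φ e r c k = (x (π (e (.inl (.inl k)))), x (π (e (.inl (.inr k))))) := by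
    have : reconstruct φ (joinBlocks e c r) = x ∘ π := hπ
    unfold pairGuess
    rw [this]
    rfl
  rw [hg] at h
  set p₁ := π (e (.inl (.inl k))) with hp₁
  set p₂ := π (e (.inl (.inr k))) with hp₂
  have hp : p₁ ≠ p₂ := by
    intro h'
    have := e.injective (π.injective h')
    simp at this
  -- In each of the two orders the guess has to agree somewhere. As the two inputs differ, this is
  -- possible only if the guess puts the same one of them at both positions.
  have hu : ∃ u, ((c k).1.1 = u ∨ (c k).2.1 = u) ∧ x p₁ = u ∧ x p₂ = u := by
    unfold Protected BothWrong at h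
    simp only [flipInput] at h
    by_cases h1 : x p₁ = (c k).1.1
    · have h2 : x p₂ = (c k).1.1 := by
        by_contra h3
        exact h.2 ⟨fun h4 => huv (h1.symm.trans h4), h3⟩
      exact ⟨_, Or.inl rfl, h1, h2⟩
    · have h2 : x p₂ = (c k).2.1 := by
        by_contra h3
        exact h.1 ⟨h1, h3⟩
      have h3 : x p₁ = (c k).2.1 := by
        by_contra h4
        exact h.2 ⟨h4, fun h5 => huv (h5.symm.trans h2)⟩
      exact ⟨_, Or.inr rfl, h3, h2⟩
  obtain ⟨u, hu, hu1, hu2⟩ := hu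
  refine ⟨u, hu, ?_⟩
  by_contra hcon
  push Not at hcon
  obtain ⟨hr, hk⟩ := hcon
  -- Absent a collision, only pair k contains u. It contains u just once, whereas the reordering
  -- draws u from the two distinct positions p₁ and p₂.
  have hpos : ∀ p, x p = u → e.symm p = .inl (.inl k) ∧ (c k).1.1 = u ∨
      e.symm p = .inl (.inr k) ∧ (c k).2.1 = u := by
    intro p hpu
    simp only [hx, joinBlocks] at hpu
    rcases he : e.symm p with (k' | k') | j
    · rw [he] at hpu
      simp only [Sum.elim_inl] at hpu
      by_cases hk' : k' = k
      · subst hk'; exact Or.inl ⟨rfl, hpu⟩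
      · exact absurd hpu (hk k' hk').1
    · rw [he] at hpu
      simp only [Sum.elim_inl, Sum.elim_inr] at hpu
      by_cases hk' : k' = k
      · subst hk'; exact Or.inr ⟨rfl, hpu⟩
      · exact absurd hpu (hk k' hk').2
    · rw [he] at hpu
      simp only [Sum.elim_inr] at hpu
      exact absurd (Finset.mem_image.2 ⟨j, Finset.mem_univ _, hpu⟩) hr
  rcases hpos p₁ hu1 with ⟨h1, h1'⟩ | ⟨h1, h1'⟩ <;> rcases hpos p₂ hu2 with ⟨h2, h2'⟩ | ⟨h2, h2'⟩
  · exact hp (e.symm.injective (h1.trans h2.symm))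
  · exact huv (h1'.trans h2'.symm)
  · exact huv (h2'.trans h1'.symm)
  · exact hp (e.symm.injective (h1.trans h2.symm))

/-- Markov's inequality for collisions. The fragments of the remaining blocks and of the pairs
number at most R + 2K = M, which gives the factor M in front of the largest probability of a single
fragment. -/
theorem pmean_protected_le_of_rare (hP : P ∈ stdSimplex ℝ 𝒳) (hPpos : ∀ a, 0 < P a)
    (hW : ∀ a, W a ∈ stdSimplex ℝ 𝒴) (hd : ∀ a b, bhattacharyyaDist W a b < ⊤) {δ t p₀ : ℝ}
    (h : 1 / 2 ≤ ∑ ω : Block 𝒳 𝒴 L × Block 𝒳 𝒴 L, blockTilted P W ω *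
      (if TypicalPair P W δ ω then 1 else 0))
    (hp₀ : ∑ ω : Block 𝒳 𝒴 L × Block 𝒳 𝒴 L, blockTilted P W ω *
      (if ω.1.1 = ω.2.1 then 1 else 0) ≤ p₀) (ht : 0 < t)
    {φ : Reconstruction 𝒳 𝒴 M L} (hφ : IsML W φ) (e : (Fin K ⊕ Fin K) ⊕ Fin R ≃ Fin M)
    (r : Fin R → Block 𝒳 𝒴 L) :
    pmean (pairLaw P W δ) (fun c : Fin K → Block 𝒳 𝒴 L × Block 𝒳 𝒴 L =>
      if t ≤ ((Finset.univ.filter fun k => Protected (pairGuess φ e r c k) (c k)).card : ℝ)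
        then 1 else 0) ≤
      K * (2 * p₀ + 4 * M * Real.exp (-(tiltedEntropy P W - δ) * L)) / t := by
  have h1 := sum_pairLaw_input_le hP hPpos hW hd h
  have hcol := pmean_many_collisions_le (κ := Fin K) (pairLaw_nonneg (W := W) hP hPpos hd)
    (sum_pairLaw h) (p₀ := 2 * p₀) (p₁ := 2 * Real.exp (-(tiltedEntropy P W - δ) * L))
    (by positivity)
    ((sum_pairLaw_mul_le hP hPpos hd h fun ω => by split_ifs <;> norm_num).trans
      (mul_le_mul_of_nonneg_left hp₀ zero_le_two)) h1
    (fun u => (sum_pairLaw_input_snd u).trans_le (h1 u))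
    (Finset.univ.image fun j => (r j).1)
    (fun c k => Protected (pairGuess φ e r c k) (c k))
    (fun c k hc => hc.collision hφ) ht
  refine (pmean_ite_mono (pairLaw_nonneg (W := W) hP hPpos hd) fun _ h => h).trans
    (hcol.trans ?_)
  rw [Fintype.card_fin]
  refine div_le_div_of_nonneg_right (mul_le_mul_of_nonneg_left ?_ (Nat.cast_nonneg K)) ht.le
  have hS : ((Finset.univ.image fun j => (r j).1).card : ℝ) + 2 * K ≤ M := by
    have h2 : (Finset.univ.image fun j => (r j).1).card ≤ R := by
      refine Finset.card_image_le.trans ?_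
      simp
    have h3 := two_mul_add_eq_of_equiv e
    have h4 : (Finset.univ.image fun j => (r j).1).card + 2 * K ≤ M := by omega
    exact_mod_cast h4
  have h5 := mul_le_mul_of_nonneg_right hS (Real.exp_pos (-(tiltedEntropy P W - δ) * L)).le
  linarith

/-- The guess sees the true inputs only through the multiset of fragments. With the remaining blocks
fixed and the paired fragments typical, this multiset is counted by the multisets of size 2K of
typical fragments, over which a union bound is taken. -/
theorem pmean_protected_le_of_frequent (hP : P ∈ stdSimplex ℝ 𝒳) (hPpos : ∀ a, 0 < P a)
    (hd : ∀ a b, bhattacharyyaDist W a b < ⊤) {δ t γ : ℝ}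
    (h : 1 / 2 ≤ ∑ ω : Block 𝒳 𝒴 L × Block 𝒳 𝒴 L, blockTilted P W ω *
      (if TypicalPair P W δ ω then 1 else 0))
    (hγ0 : 0 < γ) (hγ1 : γ ≤ 1) (hγ : 4 * (∑ y, bestGuess P W y) ^ L ≤ γ)
    (φ : Reconstruction 𝒳 𝒴 M L) (e : (Fin K ⊕ Fin K) ⊕ Fin R ≃ Fin M)
    (r : Fin R → Block 𝒳 𝒴 L) :
    pmean (pairLaw P W δ) (fun c : Fin K → Block 𝒳 𝒴 L × Block 𝒳 𝒴 L =>
      if t ≤ ((Finset.univ.filter fun k => Protected (pairGuess φ e r c k) (c k)).card : ℝ)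
        then 1 else 0) ≤
      (Nat.multichoose (typicalInputs P W L δ).card (2 * K) : ℝ) * (2 ^ K * γ ^ t) := by
  have hρ0 := pairLaw_nonneg (W := W) (L := L) (δ := δ) hP hPpos hd
  set S := typicalInputs P W L δ with hS
  set A : Finset (Multiset (Fin L → 𝒳)) := (Finset.univ : Finset (Sym S (2 * K))).image
    (fun s : Sym S (2 * K) => s.1.map Subtype.val + ∑ j, {(r j).1}) with hA
  have hAcard : (A.card : ℝ) ≤ Nat.multichoose S.card (2 * K) := by
    have h1 : A.card ≤ Fintype.card (Sym S (2 * K)) := Finset.card_image_le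
    rw [Sym.card_sym_eq_multichoose, Fintype.card_coe] at h1
    exact_mod_cast h1
  set l : (Fin K → Block 𝒳 𝒴 L × Block 𝒳 𝒴 L) → Multiset (Fin L → 𝒳) := fun c =>
    fragments fun i => (joinBlocks e c r i).1 with hl
  have hlA : ∀ c, (∀ k, pairLaw P W δ (c k) ≠ 0) → l c ∈ A := by
    intro c hc
    simp only [hl]
    rw [fragments_joinBlocks]
    set m : Multiset (Fin L → 𝒳) := ∑ k, (({(c k).1.1} : Multiset (Fin L → 𝒳)) + {(c k).2.1})
      with hm
    have hmS : ∀ u ∈ m, u ∈ S := by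
      intro u hu
      obtain ⟨k, -, hk⟩ := Multiset.mem_sum.1 hu
      have ht := (typicalPair_of_pairLaw (hc k)).2
      rcases Multiset.mem_add.1 hk with hk | hk
      · rw [Multiset.mem_singleton.1 hk]; exact ht.2.1
      · rw [Multiset.mem_singleton.1 hk]; exact ht.2.2
    have hcard : m.card = 2 * K := by
      rw [hm, Multiset.card_sum]
      simp [mul_comm]
    refine Finset.mem_image.2 ⟨⟨m.pmap Subtype.mk hmS, by rw [Multiset.card_pmap, hcard]⟩,
      Finset.mem_univ _, ?_⟩
    change (m.pmap Subtype.mk hmS).map Subtype.val + _ = _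
    rw [Multiset.map_pmap, Multiset.pmap_eq_map, Multiset.map_id']
  -- With the multiset as a label, the guess becomes a function of the outputs of the pairs, as the
  -- Chernoff bound requires.
  set Γ : Multiset (Fin L → 𝒳) → (Fin K → (Fin L → 𝒴) × (Fin L → 𝒴)) → Fin K →
      (Fin L → 𝒳) × (Fin L → 𝒳) := fun m y k =>
    (φ m (joinBlocks e y fun j => (r j).2) (e (.inl (.inl k))),
      φ m (joinBlocks e y fun j => (r j).2) (e (.inl (.inr k)))) with hΓ
  have hguess : ∀ c, pairGuess φ e r c = Γ (l c) fun k => ((c k).1.2, (c k).2.2) := by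
    intro c
    have hy : (fun i => (joinBlocks e c r i).2) =
        joinBlocks e (fun k => ((c k).1.2, (c k).2.2)) fun j => (r j).2 := by
      ext i : 1
      unfold joinBlocks
      rcases e.symm i with (k | k) | j <;> rfl
    ext k : 1
    simp only [pairGuess, reconstruct, hΓ, hl]
    rw [hy]
  have hhits := pmean_many_hits_le_of_label (κ := Fin K) hρ0 (sum_pairLaw h)
    (h := fun y => 4 * ∏ j, bestGuess P W (y.1 j, y.2 j))
    (fun y => mul_nonneg (by norm_num) (Finset.prod_nonneg fun j _ =>
      bestGuess_nonneg hP hPpos hd _)) hγ0 hγ1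
    (fun g y => sum_pairLaw_hit_le hP hPpos hd h g y)
    (by rw [← Finset.mul_sum, sum_prod_bestGuess]; exact hγ) A l hlA Γ t
  refine (pmean_ite_mono hρ0 fun c hc => ?_).trans
    (hhits.trans ?_)
  · refine hc.trans ?_
    rw [hguess]
    exact_mod_cast Finset.card_le_card
      (Finset.monotone_filter_right _ fun k _ hk => Protected.hit hk)
  · rw [Fintype.card_fin]
    exact mul_le_mul_of_nonneg_right hAcard
      (mul_nonneg (by positivity) (Real.rpow_nonneg hγ0.le _))

end Protection

end SeqReorder

namespace SeqReorder

/-! ### Asymptotic tools and the bound at level zero -/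

section Asymptotics

open scoped Classical

/-- A bound that holds up to every positive error holds up to a vanishing error. -/
theorem exists_tendsto_zero_of_forall_pos {p : ℕ → ℝ → Prop}
    (hmono : ∀ᶠ M in atTop, ∀ a b, a ≤ b → p M a → p M b)
    (h : ∀ η > 0, ∀ᶠ M in atTop, p M η) :
    ∃ ε : ℕ → ℝ, Tendsto ε atTop (𝓝 0) ∧ ∀ᶠ M in atTop, p M (ε M) := by
  set S : ℕ → Set ℝ := fun M => {η | 0 < η ∧ p M η} with hS
  have hbdd : ∀ M, BddBelow (S M) := fun M => ⟨0, fun _ hη => hη.1.le⟩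
  -- The infimum of the admissible errors need not be attained, so a vanishing positive amount is
  -- added.
  refine ⟨fun M => sInf (S M) + 1 / ((M : ℝ) + 1), ?_, ?_⟩
  · have h1 : Tendsto (fun M => sInf (S M)) atTop (𝓝 0) := by
      rw [Metric.tendsto_atTop']
      intro η hη
      obtain ⟨N, hN⟩ := eventually_atTop.1 (h (η / 2) (half_pos hη))
      refine ⟨N, fun M hM => ?_⟩
      have h2 : sInf (S M) ≤ η / 2 := csInf_le (hbdd M) ⟨half_pos hη, hN M hM.le⟩
      have h3 : 0 ≤ sInf (S M) := Real.sInf_nonneg fun _ hη => hη.1.le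
      rw [Real.dist_eq, sub_zero, abs_of_nonneg h3]
      linarith
    simpa using h1.add tendsto_one_div_add_atTop_nhds_zero_nat
  · filter_upwards [hmono, h 1 one_pos] with M hM h1
    have hlt : sInf (S M) < sInf (S M) + 1 / ((M : ℝ) + 1) := by
      have : (0 : ℝ) < 1 / ((M : ℝ) + 1) := by positivity
      linarith
    obtain ⟨s, hs, hs'⟩ := exists_lt_of_csInf_lt (s := S M) ⟨1, one_pos, h1⟩ hlt
    exact hM s _ hs'.le hs.2

theorem tendsto_log_natCast_atTop : Tendsto (fun M : ℕ => Real.log M) atTop atTop :=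
  Real.tendsto_log_atTop.comp tendsto_natCast_atTop_atTop

variable {L : ℕ → ℕ} {β : ℝ}

theorem eventually_mul_log_le (hL : Tendsto (fun M : ℕ => (L M : ℝ) / Real.log M) atTop (𝓝 β))
    {b : ℝ} (hb : b < β) : ∀ᶠ M : ℕ in atTop, b * Real.log M ≤ L M := by
  filter_upwards [hL.eventually_const_le hb, tendsto_log_natCast_atTop.eventually_gt_atTop 0]
    with M h1 h2
  rwa [le_div_iff₀ h2] at h1

theorem eventually_le_mul_log (hL : Tendsto (fun M : ℕ => (L M : ℝ) / Real.log M) atTop (𝓝 β))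
    {b : ℝ} (hb : β < b) : ∀ᶠ M : ℕ in atTop, L M ≤ b * Real.log M := by
  filter_upwards [hL.eventually_le_const hb, tendsto_log_natCast_atTop.eventually_gt_atTop 0]
    with M h1 h2
  rwa [div_le_iff₀ h2] at h1

theorem tendsto_length_atTop (hL : Tendsto (fun M : ℕ => (L M : ℝ) / Real.log M) atTop (𝓝 β))
    (hβ : 0 < β) : Tendsto L atTop atTop := by
  rw [← tendsto_natCast_atTop_iff (R := ℝ)]
  exact tendsto_atTop_mono' _ (eventually_mul_log_le hL (half_lt_self hβ))
    (tendsto_log_natCast_atTop.const_mul_atTop (half_pos hβ))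

/-- The left side is at most M^(1 - ab), which tends to zero. -/
theorem eventually_mul_exp_le {a b c : ℝ} (ha : 0 ≤ a) (hab : 1 < a * b) (hc : 0 < c)
    (hb : ∀ᶠ M : ℕ in atTop, b * Real.log M ≤ L M) :
    ∀ᶠ M : ℕ in atTop, M * Real.exp (-a * L M) ≤ c := by
  have h1 := (tendsto_log_natCast_atTop.const_mul_atTop (sub_pos.2 hab)).eventually_ge_atTop
    (-Real.log c)
  filter_upwards [hb, h1, eventually_gt_atTop 0] with M h2 h3 h4
  have hM : (0 : ℝ) < M := by exact_mod_cast h4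
  rw [← Real.exp_log hM, ← Real.exp_add, ← Real.le_log_iff_exp_le hc]
  have := mul_le_mul_of_nonneg_left h2 ha
  linarith

variable {𝒳 𝒴 : Type*} [Fintype 𝒳] [Fintype 𝒴] {P : 𝒳 → ℝ} {W : 𝒳 → 𝒴 → ℝ}

theorem eventually_le_FP_zero (hP : P ∈ stdSimplex ℝ 𝒳) (hPpos : ∀ a, 0 < P a)
    (hW : ∀ a, W a ∈ stdSimplex ℝ 𝒴) (hd : ∀ a b, bhattacharyyaDist W a b < ⊤)
    (hψ : 0 < psi₂ P W) (hβ : 1 / psi₂ P W < β)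
    (hL : Tendsto (fun M : ℕ => (L M : ℝ) / Real.log M) atTop (𝓝 β)) {η : ℝ} (hη : 0 < η) :
    ∀ᶠ M : ℕ in atTop, ∀ φ : Reconstruction 𝒳 𝒴 M (L M),
      (M : ℝ) ^ (2 * (1 - β * psi₂ P W) - η) ≤ FP P W φ 0 := by
  set ψ := psi₂ P W with hψdef
  have hβ0 : 0 < β := (one_div_pos.2 hψ).trans hβ
  have hβψ : 1 < ψ * β := by rw [div_lt_iff₀ hψ] at hβ; linarith
  have hne := exists_ne_of_psi₂_pos hP hPpos hW hd hψ
  have hcont1 : Tendsto (fun δ : ℝ => (ψ - 2 * δ) * (β - δ)) (𝓝[>] 0) (𝓝 (ψ * β)) := by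
    have : Continuous fun δ : ℝ => (ψ - 2 * δ) * (β - δ) := by fun_prop
    simpa using (this.tendsto 0).mono_left nhdsWithin_le_nhds
  have hcont2 : Tendsto (fun δ : ℝ => (2 * ψ + 2 * δ) * (β + δ)) (𝓝[>] 0) (𝓝 (2 * ψ * β)) := by
    have : Continuous fun δ : ℝ => (2 * ψ + 2 * δ) * (β + δ) := by fun_prop
    simpa using (this.tendsto 0).mono_left nhdsWithin_le_nhds
  have hcont3 : Tendsto (fun δ : ℝ => ψ - 2 * δ) (𝓝[>] 0) (𝓝 ψ) := by
    have : Continuous fun δ : ℝ => ψ - 2 * δ := by fun_prop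
    simpa using (this.tendsto 0).mono_left nhdsWithin_le_nhds
  -- A single δ serves both needs: `h1` keeps M κ small, using βψ₂ > 1, and `h2` keeps the final
  -- exponent within η.
  obtain ⟨δ, h1, h2, h3, hδ⟩ := ((hcont1.eventually_const_lt hβψ).and
    ((hcont2.eventually_lt_const (u := 2 * ψ * β + η) (by linarith)).and
    ((hcont3.eventually_const_lt hψ).and self_mem_nhdsWithin))).exists
  have hlog := (tendsto_log_natCast_atTop.const_mul_atTop (sub_pos.2 h2)).eventually_ge_atTop
    (Real.log 48)
  filter_upwards [(tendsto_length_atTop hL hβ0).eventually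
      (eventually_half_le_sum_confusable hP hPpos hW hd hne hδ),
    eventually_mul_exp_le h3.le h1 (by norm_num : (0 : ℝ) < 1 / 4)
      (eventually_mul_log_le hL (sub_lt_self β hδ)),
    eventually_le_mul_log hL (lt_add_of_pos_right β hδ), hlog, eventually_ge_atTop 2]
    with M hhalf hκ hup hlogM hM φ
  refine le_trans ?_ (le_FP_zero hP hPpos hW hd hδ.le hhalf hM hκ φ)
  have hM0 : (0 : ℝ) < M := by
    have : 0 < M := by omega
    exact_mod_cast this
  have e1 : (M : ℝ) ^ 2 / 48 = Real.exp (2 * Real.log M - Real.log 48) := by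
    rw [Real.exp_sub, Real.exp_log (by norm_num), mul_comm, Real.exp_mul, Real.exp_log hM0]
    norm_cast
  rw [e1, ← Real.exp_add, Real.rpow_def_of_pos hM0]
  refine Real.exp_le_exp.2 ?_
  have h4 := mul_le_mul_of_nonneg_left hup (by linarith : 0 ≤ 2 * ψ + 2 * δ)
  linarith

theorem tiltedEntropy_nonneg (hP : P ∈ stdSimplex ℝ 𝒳) (hPpos : ∀ a, 0 < P a)
    (hW : ∀ a, W a ∈ stdSimplex ℝ 𝒴) (hd : ∀ a b, bhattacharyyaDist W a b < ⊤) :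
    0 ≤ tiltedEntropy P W := by
  have hpos := tiltedInput_pos hP hPpos hW hd
  refine Finset.sum_nonneg fun ω _ => mul_nonneg (tiltedLaw_nonneg hP hPpos hd ω) ?_
  refine neg_nonneg.2 (Real.log_nonpos (hpos _).le ?_)
  rw [← sum_tiltedInput hP hPpos hW hd]
  exact Finset.single_le_sum (f := tiltedInput P W) (fun a _ => (hpos a).le) (Finset.mem_univ _)

/-- The binomial coefficient is at most (N + n)^n / n!, and n^n / n! ≤ exp n. -/
theorem multichoose_le_pow (N : ℕ) {n : ℕ} (hn : 0 < n) :
    (N.multichoose n : ℝ) ≤ (Real.exp 1 * ((N + n) / n)) ^ n := by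
  have hn' : (0 : ℝ) < n := by exact_mod_cast hn
  rw [Nat.multichoose_eq]
  have h1 := Nat.choose_le_pow_div (α := ℝ) n (N + n - 1)
  have h2 := Real.pow_div_factorial_le_exp (x := n) hn'.le n
  have h3 : ((N + n - 1 : ℕ) : ℝ) ^ n ≤ ((N : ℝ) + n) ^ n := by
    refine pow_le_pow_left₀ (Nat.cast_nonneg _) ?_ n
    have : N + n - 1 ≤ N + n := Nat.sub_le _ _
    exact_mod_cast this
  have hf : (0 : ℝ) < n.factorial := by exact_mod_cast n.factorial_pos
  rw [mul_pow, ← Real.exp_nat_mul, mul_one, div_pow]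
  refine h1.trans ((div_le_div_of_nonneg_right h3 hf.le).trans ?_)
  rw [div_le_iff₀ hf] at h2
  rw [div_le_iff₀ hf]
  have h4 : (0 : ℝ) ≤ ((N : ℝ) + n) ^ n / n ^ n := by positivity
  calc ((N : ℝ) + n) ^ n = ((N : ℝ) + n) ^ n / n ^ n * n ^ n := by field_simp
    _ ≤ ((N : ℝ) + n) ^ n / n ^ n * (Real.exp n * n.factorial) :=
        mul_le_mul_of_nonneg_left h2 h4
    _ = _ := by ring

end Asymptotics

end SeqReorder

namespace SeqReorder

/-! ### The two entropy regimes and the bound at positive levels -/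

section Asymptotics

open scoped Classical

variable {L : ℕ → ℕ} {β : ℝ}
variable {𝒳 𝒴 : Type*} [Fintype 𝒳] [Fintype 𝒴] {P : 𝒳 → ℝ} {W : 𝒳 → 𝒴 → ℝ}

/-- A maximum likelihood reconstruction rarely protects more than a small fraction of `K` pairs
from a double failure. -/
def RarelyProtects (P : 𝒳 → ℝ) (W : 𝒳 → 𝒴 → ℝ) (M L : ℕ) (δ σ ξ : ℝ) : Prop :=
  ∀ (K R : ℕ) (e : (Fin K ⊕ Fin K) ⊕ Fin R ≃ Fin M) (φ : Reconstruction 𝒳 𝒴 M L), IsML W φ →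
    0 < K → ξ * M ≤ 2 * K → ∀ r : Fin R → Block 𝒳 𝒴 L,
    pmean (pairLaw P W δ) (fun c : Fin K → Block 𝒳 𝒴 L × Block 𝒳 𝒴 L =>
      if σ * K ≤ ((Finset.univ.filter fun k => Protected (pairGuess φ e r c k) (c k)).card : ℝ)
        then 1 else 0) ≤ 1 / 2

/-- A fragment has probability about exp(-HL) = M^(-βH + o(1)), which is o(1/M), so collisions
involve a vanishing fraction of the pairs. The choices σ/8 and σ/16 add up to 2 · σ/8 + 4 · σ/16 =
σ/2, which Markov's inequality at level σK turns into 1/2. -/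
theorem eventually_rarelyProtects_of_one_lt (hP : P ∈ stdSimplex ℝ 𝒳) (hPpos : ∀ a, 0 < P a)
    (hW : ∀ a, W a ∈ stdSimplex ℝ 𝒴) (hd : ∀ a b, bhattacharyyaDist W a b < ⊤)
    (hne : ∃ a b : 𝒳, a ≠ b) (hβ : 0 < β)
    (hL : Tendsto (fun M : ℕ => (L M : ℝ) / Real.log M) atTop (𝓝 β))
    (hH : 1 < tiltedEntropy P W * β) {σ : ℝ} (hσ : 0 < σ) (ξ : ℝ) :
    ∀ᶠ δ in 𝓝[>] 0, ∀ᶠ M in atTop, RarelyProtects P W M (L M) δ σ ξ := by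
  set H := tiltedEntropy P W with hHdef
  have hH0 : 0 < H := by
    by_contra h
    nlinarith [not_lt.1 h]
  have hcont1 : Tendsto (fun δ : ℝ => (H - δ) * (β - δ)) (𝓝[>] 0) (𝓝 (H * β)) := by
    have : Continuous fun δ : ℝ => (H - δ) * (β - δ) := by fun_prop
    simpa using (this.tendsto 0).mono_left nhdsWithin_le_nhds
  have hcont2 : Tendsto (fun δ : ℝ => H - δ) (𝓝[>] 0) (𝓝 H) := by
    have : Continuous fun δ : ℝ => H - δ := by fun_prop
    simpa using (this.tendsto 0).mono_left nhdsWithin_le_nhds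
  filter_upwards [hcont1.eventually_const_lt hH, hcont2.eventually_const_lt hH0,
    self_mem_nhdsWithin] with δ h1 h2 hδ
  rw [Set.mem_Ioi] at hδ
  have hlen := tendsto_length_atTop hL hβ
  filter_upwards [hlen.eventually (eventually_half_le_sum_typicalPair hP hPpos hW hd hδ),
    hlen.eventually (eventually_sum_blockTilted_diag_le hP hPpos hW hd hne
      (by positivity : 0 < σ / 8)),
    eventually_mul_exp_le h2.le h1 (by positivity : 0 < σ / 16)
      (eventually_mul_log_le hL (sub_lt_self β hδ))] with M hhalf hdiag hexp
  intro K R e φ hφ hK _ r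
  have hK' : (0 : ℝ) < K := by exact_mod_cast hK
  refine (pmean_protected_le_of_rare hP hPpos hW hd hhalf hdiag (mul_pos hσ hK') hφ e r).trans ?_
  rw [div_le_iff₀ (mul_pos hσ hK')]
  have : 2 * (σ / 8) + 4 * M * Real.exp (-(H - δ) * L M) ≤ σ / 2 := by linarith
  have := mul_le_mul_of_nonneg_left this hK'.le
  linarith

/-- With at most M^(1+δ') typical fragments and at least ξM paired ones, the multisets contribute a
factor of order M^(2δ') per pair, while a σ-fraction of hits contributes at most M^(-σκ(β-δ)) up to
constants. For small δ the second wins. -/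
theorem eventually_rarelyProtects_of_le_one (hP : P ∈ stdSimplex ℝ 𝒳) (hPpos : ∀ a, 0 < P a)
    (hW : ∀ a, W a ∈ stdSimplex ℝ 𝒴) (hd : ∀ a b, bhattacharyyaDist W a b < ⊤)
    (hne : ∃ a b : 𝒳, a ≠ b) (hβ : 0 < β)
    (hL : Tendsto (fun M : ℕ => (L M : ℝ) / Real.log M) atTop (𝓝 β))
    (hH : tiltedEntropy P W * β ≤ 1) {σ ξ : ℝ} (hσ : 0 < σ) (hξ : 0 < ξ) :
    ∀ᶠ δ in 𝓝[>] 0, ∀ᶠ M in atTop, RarelyProtects P W M (L M) δ σ ξ := by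
  set H := tiltedEntropy P W with hHdef
  have hH0 : 0 ≤ H := tiltedEntropy_nonneg hP hPpos hW hd
  -- The maximum with 1/2 keeps the base positive, so that its logarithm is meaningful.
  set γ₀ : ℝ := max (∑ y, bestGuess P W y) (1 / 2) with hγ₀
  have hγ₀0 : 0 < γ₀ := lt_max_of_lt_right (by norm_num)
  have hγ₀1 : γ₀ < 1 := max_lt (sum_bestGuess_lt_one hP hPpos hW hd hne) (by norm_num)
  set κ : ℝ := -Real.log γ₀ with hκ
  have hκ0 : 0 < κ := neg_pos.2 (Real.log_neg hγ₀0 hγ₀1)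
  have hcont : Tendsto (fun δ : ℝ => σ * κ * (β - δ) - 2 * (δ * (H + β + δ))) (𝓝[>] 0)
      (𝓝 (σ * κ * β)) := by
    have : Continuous fun δ : ℝ => σ * κ * (β - δ) - 2 * (δ * (H + β + δ)) := by fun_prop
    simpa using (this.tendsto 0).mono_left nhdsWithin_le_nhds
  filter_upwards [hcont.eventually_const_lt (by positivity : 0 < σ * κ * β),
    self_mem_nhdsWithin] with δ h1 hδ
  rw [Set.mem_Ioi] at hδ
  set δ' := δ * (H + β + δ) with hδ'
  have hδ'0 : 0 < δ' := by positivity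
  have hlen := tendsto_length_atTop hL hβ
  -- The constants of one pair: (2e/ξ)² from the multisets times 2 from the Chernoff bound, and 4^σ
  -- from the hit probability.
  set C : ℝ := Real.log (8 * Real.exp 1 ^ 2 / ξ ^ 2) + σ * Real.log 4 with hC
  have hlog := (tendsto_log_natCast_atTop.const_mul_atTop h1).eventually_ge_atTop
    (C + Real.log 2)
  have hlenR : Tendsto (fun M => (L M : ℝ)) atTop atTop :=
    tendsto_natCast_atTop_atTop.comp hlen
  have hlog4 := (hlenR.const_mul_atTop hκ0).eventually_ge_atTop (Real.log 4)
  filter_upwards [hlen.eventually (eventually_half_le_sum_typicalPair hP hPpos hW hd hδ),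
    eventually_mul_log_le hL (sub_lt_self β hδ),
    eventually_le_mul_log hL (lt_add_of_pos_right β hδ), hlog, hlog4, eventually_ge_atTop 1]
    with M hhalf hlow hup hlogM hlog4M hM
  intro K R e φ _ hK hξK r
  have hM0 : (0 : ℝ) < M := by exact_mod_cast hM
  have hM1 : (1 : ℝ) ≤ M := by exact_mod_cast hM
  have hlogM0 : 0 ≤ Real.log M := Real.log_nonneg hM1
  set γ : ℝ := Real.exp (Real.log 4 - κ * L M) with hγ
  have hγle : 4 * (∑ y, bestGuess P W y) ^ L M ≤ γ := by
    have h2 : 0 ≤ ∑ y, bestGuess P W y :=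
      Finset.sum_nonneg fun y _ => bestGuess_nonneg hP hPpos hd y
    have h3 : (∑ y, bestGuess P W y) ^ L M ≤ γ₀ ^ L M :=
      pow_le_pow_left₀ h2 (le_max_left _ _) _
    have h4 : γ = 4 * γ₀ ^ L M := by
      rw [hγ, sub_eq_add_neg, Real.exp_add, Real.exp_log (by norm_num), hκ, neg_mul, neg_neg,
        mul_comm (Real.log γ₀), Real.exp_nat_mul, Real.exp_log hγ₀0]
    linarith
  have hγ1 : γ ≤ 1 := Real.exp_le_one_iff.2 (by linarith)
  refine (pmean_protected_le_of_frequent hP hPpos hd hhalf (Real.exp_pos _) hγ1 hγle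
    φ e r).trans ?_
  set n := 2 * K with hn
  have hn0 : 0 < n := by omega
  have hn0' : (0 : ℝ) < n := by exact_mod_cast hn0
  have hnM : (n : ℝ) ≤ M := by
    have := two_mul_add_eq_of_equiv e
    have : n ≤ M := by omega
    exact_mod_cast this
  have hnξ : ξ * M ≤ n := by rw [hn]; push_cast; exact hξK
  set N := (typicalInputs P W (L M) δ).card with hN
  set D := Real.exp (δ' * Real.log M) with hD
  have hD1 : 1 ≤ D := Real.one_le_exp (by positivity)
  have hNle : (N : ℝ) ≤ M * D := by
    refine (card_typicalInputs_le hP hPpos hW hd _ _).trans ?_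
    rw [hD, ← Real.exp_log hM0, ← Real.exp_add, Real.log_exp]
    refine Real.exp_le_exp.2 ?_
    have h2 := mul_le_mul_of_nonneg_left hup (by positivity : 0 ≤ H + δ)
    have h3 : (H + δ) * (β + δ) = H * β + δ' := by rw [hδ']; ring
    have h4 := mul_le_mul_of_nonneg_right hH hlogM0
    calc (H + δ) * L M ≤ (H + δ) * (β + δ) * Real.log M := by linarith
      _ = H * β * Real.log M + δ' * Real.log M := by rw [h3]; ring
      _ ≤ _ := by linarith
  -- Here the positive level enters: the paired fragments number at least ξM, so the number of
  -- typical ones per paired fragment is at most D/ξ.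
  have hratio : ((N : ℝ) + n) / n ≤ 2 * D / ξ := by
    rw [div_le_div_iff₀ hn0' hξ]
    have h2 : (M : ℝ) ≤ M * D := le_mul_of_one_le_right hM0.le hD1
    have h3 := mul_le_mul_of_nonneg_right hnξ (zero_le_one.trans hD1)
    nlinarith
  have hmulti : (N.multichoose n : ℝ) ≤ ((Real.exp 1 * (2 * D / ξ)) ^ 2) ^ K := by
    rw [← pow_mul, ← hn]
    refine (multichoose_le_pow N hn0).trans (pow_le_pow_left₀ (by positivity) ?_ n)
    exact mul_le_mul_of_nonneg_left hratio (Real.exp_pos 1).le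
  have hγpow : γ ^ (σ * K) = (Real.exp (σ * (Real.log 4 - κ * L M))) ^ K := by
    rw [Real.rpow_mul (Real.exp_pos _).le, Real.rpow_natCast, ← Real.exp_mul, mul_comm σ]
  have hbase : (Real.exp 1 * (2 * D / ξ)) ^ 2 * (2 * Real.exp (σ * (Real.log 4 - κ * L M)))
      ≤ 1 / 2 := by
    have e1 : (Real.exp 1 * (2 * D / ξ)) ^ 2 * (2 * Real.exp (σ * (Real.log 4 - κ * L M))) =
        Real.exp (C + 2 * δ' * Real.log M - σ * κ * L M) := by
      have e2 : C + 2 * δ' * Real.log M - σ * κ * L M =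
          Real.log (8 * Real.exp 1 ^ 2 / ξ ^ 2) + (δ' * Real.log M + δ' * Real.log M) +
            σ * (Real.log 4 - κ * L M) := by rw [hC]; ring
      rw [e2, Real.exp_add, Real.exp_add, Real.exp_add, Real.exp_log (by positivity), ← hD]
      field_simp
      ring
    have e3 : (1 : ℝ) / 2 = Real.exp (-Real.log 2) := by
      rw [Real.exp_neg, Real.exp_log (by norm_num), one_div]
    rw [e1, e3]
    refine Real.exp_le_exp.2 ?_
    have h2 := mul_le_mul_of_nonneg_left hlow (by positivity : 0 ≤ σ * κ)
    linarith
  calc (N.multichoose n : ℝ) * (2 ^ K * γ ^ (σ * K))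
      ≤ ((Real.exp 1 * (2 * D / ξ)) ^ 2) ^ K * (2 ^ K * γ ^ (σ * K)) :=
        mul_le_mul_of_nonneg_right hmulti
          (mul_nonneg (by positivity) (Real.rpow_nonneg (Real.exp_pos _).le _))
    _ = ((Real.exp 1 * (2 * D / ξ)) ^ 2 *
          (2 * Real.exp (σ * (Real.log 4 - κ * L M)))) ^ K := by
        rw [hγpow, ← mul_pow, ← mul_pow]
    _ ≤ (1 / 2) ^ K := pow_le_pow_left₀ (by positivity) hbase K
    _ ≤ 1 / 2 := pow_le_of_le_one (by norm_num) (by norm_num) hK.ne'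

theorem eventually_le_FP (hP : P ∈ stdSimplex ℝ 𝒳) (hPpos : ∀ a, 0 < P a)
    (hW : ∀ a, W a ∈ stdSimplex ℝ 𝒴) (hd : ∀ a b, bhattacharyyaDist W a b < ⊤)
    (hψ : 0 < psi₂ P W) (hβ : 1 / psi₂ P W < β)
    (hL : Tendsto (fun M : ℕ => (L M : ℝ) / Real.log M) atTop (𝓝 β)) {ξ η : ℝ} (hξ0 : 0 < ξ)
    (hξ1 : ξ < 1) (hη : 0 < η) :
    ∀ᶠ M : ℕ in atTop, ∀ φ : Reconstruction 𝒳 𝒴 M (L M), IsML W φ →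
      Real.exp (-(ξ * M * Real.log M * (β * psi₂ P W + η))) ≤ FP P W φ ξ := by
  set ψ := psi₂ P W with hψdef
  have hβ0 : 0 < β := (one_div_pos.2 hψ).trans hβ
  have hne := exists_ne_of_psi₂_pos hP hPpos hW hd hψ
  have hcontσ : ContinuousAt (fun σ : ℝ => ξ / (1 - σ)) 0 :=
    ContinuousAt.div continuousAt_const (by fun_prop) (by norm_num)
  have hlimσ : Tendsto (fun σ : ℝ => ξ / (1 - σ)) (𝓝[>] 0) (𝓝 ξ) := by
    simpa using hcontσ.tendsto.mono_left nhdsWithin_le_nhds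
  have hlt : ξ * (β * ψ) < ξ * (β * ψ + η) := by nlinarith
  have hσlt : ∀ᶠ σ in 𝓝[>] (0 : ℝ), σ < 1 :=
    mem_nhdsWithin_of_mem_nhds (Iio_mem_nhds one_pos)
  have hσpos : ∀ᶠ σ in 𝓝[>] (0 : ℝ), 0 < σ := self_mem_nhdsWithin
  obtain ⟨σ, hs1, hs2, hσ1, hσ⟩ := ((hlimσ.eventually_lt_const hξ1).and
    (((hlimσ.mul_const (β * ψ)).eventually_lt_const hlt).and (hσlt.and hσpos))).exists
  -- About aM pairs are used, slightly more than ξM/2, so that ξM failures remain after σK pairs are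
  -- given up as protected. The bound ξ/(1 - σ) < 1 leaves room for 2K positions.
  set a : ℝ := ξ / (1 - σ) / 2 with ha
  have hσ' : 0 < 1 - σ := sub_pos.2 hσ1
  have ha0 : 0 < a := by positivity
  have haξ : 2 * (1 - σ) * a = ξ := by rw [ha]; field_simp
  have haψ : a * (2 * ψ * β) < ξ * (β * ψ + η) := by
    rwa [show a * (2 * ψ * β) = ξ / (1 - σ) * (β * ψ) by rw [ha]; ring]
  have hrare : ∀ᶠ δ in 𝓝[>] 0, ∀ᶠ M in atTop, RarelyProtects P W M (L M) δ σ ξ := by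
    rcases le_or_gt (tiltedEntropy P W * β) 1 with hH | hH
    · exact eventually_rarelyProtects_of_le_one hP hPpos hW hd hne hβ0 hL hH hσ hξ0
    · exact eventually_rarelyProtects_of_one_lt hP hPpos hW hd hne hβ0 hL hH hσ ξ
  have hlimδ : Tendsto (fun δ : ℝ => (a + δ) * ((2 * ψ + δ) * (β + δ) + δ) + δ) (𝓝[>] 0)
      (𝓝 (a * (2 * ψ * β))) := by
    have : Continuous fun δ : ℝ => (a + δ) * ((2 * ψ + δ) * (β + δ) + δ) + δ := by fun_prop
    simpa using (this.tendsto 0).mono_left nhdsWithin_le_nhds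
  have hlimδ' : Tendsto (fun δ : ℝ => 2 * (a + δ)) (𝓝[>] 0) (𝓝 (2 * a)) := by
    have : Continuous fun δ : ℝ => 2 * (a + δ) := by fun_prop
    simpa using (this.tendsto 0).mono_left nhdsWithin_le_nhds
  have hδpos : ∀ᶠ δ in 𝓝[>] (0 : ℝ), 0 < δ := self_mem_nhdsWithin
  obtain ⟨δ, hrare, hδexp, hδa, hδ⟩ := (hrare.and
    ((hlimδ.eventually_lt_const haψ).and
    ((hlimδ'.eventually_lt_const (by linarith : 2 * a < 1)).and hδpos))).exists
  have hMR : Tendsto (fun M : ℕ => (M : ℝ)) atTop atTop := tendsto_natCast_atTop_atTop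
  filter_upwards [hrare, (tendsto_length_atTop hL hβ0).eventually
      (eventually_half_le_sum_typicalPair hP hPpos hW hd hδ),
    eventually_le_mul_log hL (lt_add_of_pos_right β hδ),
    (hMR.const_mul_atTop hδ).eventually_ge_atTop 1,
    (tendsto_log_natCast_atTop.const_mul_atTop hδ).eventually_ge_atTop (Real.log 4),
    eventually_ge_atTop 1] with M hprot hhalf hup hδM hlog4 hM φ hφ
  have hM1 : (1 : ℝ) ≤ M := by exact_mod_cast hM
  have hM0 : (0 : ℝ) < M := one_pos.trans_le hM1
  have hlog0 : 0 ≤ Real.log M := Real.log_nonneg hM1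
  -- The rounding error is absorbed by δM ≥ 1.
  set K : ℕ := ⌈a * M⌉₊ with hK
  have hKlow : a * M ≤ K := Nat.le_ceil _
  have hKup : (K : ℝ) ≤ (a + δ) * M := by
    linarith [(Nat.ceil_lt_add_one (by positivity : 0 ≤ a * M)).le]
  have hK0 : 0 < K := Nat.ceil_pos.2 (by positivity)
  have hK0' : (0 : ℝ) < K := by exact_mod_cast hK0
  have h2K : 2 * K ≤ M := by
    have h1 : (2 * K : ℝ) ≤ M := by nlinarith
    exact_mod_cast h1
  have hξK : ξ * M ≤ 2 * (K - σ * K) := by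
    rw [← haξ]
    nlinarith
  have hcard : Fintype.card ((Fin K ⊕ Fin K) ⊕ Fin (M - 2 * K)) = Fintype.card (Fin M) := by
    simp only [Fintype.card_sum, Fintype.card_fin]
    omega
  have e := Fintype.equivOfCardEq hcard
  have hmain := le_FP_of_protected hP hPpos hW hd hhalf φ e
    (hprot K _ e φ hφ hK0 (hξK.trans (by nlinarith))) (by nlinarith) hξK
  have hlog2 : Real.log 2 ≤ Real.log 4 := Real.log_le_log (by norm_num) (by norm_num)
  have hexp : Real.log 2 + K * (Real.log 4 + (2 * ψ + δ) * L M) ≤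
      ξ * M * Real.log M * (β * ψ + η) := by
    have h1 : Real.log 4 + (2 * ψ + δ) * L M ≤
        ((2 * ψ + δ) * (β + δ) + δ) * Real.log M := by
      have := mul_le_mul_of_nonneg_left hup (by positivity : 0 ≤ 2 * ψ + δ)
      linarith
    have h2 : Real.log 2 ≤ δ * (M * Real.log M) := by
      have := mul_le_mul_of_nonneg_right hM1 hlog0
      nlinarith
    have h3 : K * (Real.log 4 + (2 * ψ + δ) * L M) ≤
        (a + δ) * M * (((2 * ψ + δ) * (β + δ) + δ) * Real.log M) :=
      mul_le_mul hKup h1 (add_nonneg (Real.log_nonneg (by norm_num)) (by positivity))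
        (by positivity)
    have h4 := mul_le_mul_of_nonneg_right hδexp.le (mul_nonneg hM0.le hlog0)
    linarith
  have hpow : (4 * Real.exp ((2 * ψ + δ) * L M)) ^ K =
      Real.exp (K * (Real.log 4 + (2 * ψ + δ) * L M)) := by
    rw [Real.exp_nat_mul, Real.exp_add, Real.exp_log (by norm_num)]
  rw [hpow] at hmain
  calc Real.exp (-(ξ * M * Real.log M * (β * ψ + η)))
      ≤ Real.exp (-(K * (Real.log 4 + (2 * ψ + δ) * L M))) * (1 / 2) := by
        have h2 : (1 : ℝ) / 2 = Real.exp (-Real.log 2) := by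
          rw [Real.exp_neg, Real.exp_log (by norm_num), one_div]
        rw [h2, ← Real.exp_add]
        exact Real.exp_le_exp.2 (by linarith)
    _ ≤ Real.exp (-(K * (Real.log 4 + (2 * ψ + δ) * L M))) *
          (Real.exp (K * (Real.log 4 + (2 * ψ + δ) * L M)) * FP P W φ ξ) :=
        mul_le_mul_of_nonneg_left hmain (Real.exp_pos _).le
    _ = FP P W φ ξ := by rw [← mul_assoc, ← Real.exp_add, neg_add_cancel, Real.exp_zero, one_mul]

end Asymptotics

end SeqReorder

/-! ### The theorem, with vanishing error terms -/

theorem theorem2 {𝒳 𝒴 : Type*} [Fintype 𝒳] [Fintype 𝒴]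
    (P : 𝒳 → ℝ) (W : 𝒳 → 𝒴 → ℝ)
    (hP : P ∈ stdSimplex ℝ 𝒳) (hPpos : ∀ a, 0 < P a) (hW : ∀ a, W a ∈ stdSimplex ℝ 𝒴)
    (hd : ∀ a b, SeqReorder.bhattacharyyaDist W a b < ⊤)
    (hψH : SeqReorder.psi₂ P W < 1 / 2 * SeqReorder.collisionEntropy P)
    (hψ : 0 < SeqReorder.psi₂ P W) (β : ℝ) (hβ : 1 / SeqReorder.psi₂ P W < β)
    (L : ℕ → ℕ) (hL : Tendsto (fun M : ℕ => (L M : ℝ) / Real.log M) atTop (𝓝 β)) :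
    (∃ ε : ℕ → ℝ, Tendsto ε atTop (𝓝 0) ∧
      ∀ᶠ M : ℕ in atTop, ∀ φ : SeqReorder.Reconstruction 𝒳 𝒴 M (L M), SeqReorder.IsML W φ →
        (M : ℝ) ^ (2 * (1 - β * SeqReorder.psi₂ P W) + ε M) ≤ SeqReorder.FP P W φ 0) ∧
    (∀ ξ : ℝ, 0 < ξ → ξ < 1 → ∃ ε : ℕ → ℝ, Tendsto ε atTop (𝓝 0) ∧
      ∀ᶠ M : ℕ in atTop, ∀ φ : SeqReorder.Reconstruction 𝒳 𝒴 M (L M), SeqReorder.IsML W φ →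
        Real.exp (-(ξ * M * Real.log M * (β * SeqReorder.psi₂ P W + ε M))) ≤
          SeqReorder.FP P W φ ξ) := by
  have hlog : ∀ᶠ M : ℕ in atTop, (1 : ℝ) ≤ M :=
    (eventually_ge_atTop 1).mono fun M hM => by exact_mod_cast hM
  refine ⟨?_, fun ξ hξ0 hξ1 => ?_⟩
  -- The quantifier over the algorithms is part of the property `p`, so one error sequence serves
  -- them all.
  · obtain ⟨ε, hε, h⟩ := SeqReorder.exists_tendsto_zero_of_forall_pos
      (p := fun M η => ∀ φ : SeqReorder.Reconstruction 𝒳 𝒴 M (L M), SeqReorder.IsML W φ →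
        (M : ℝ) ^ (2 * (1 - β * SeqReorder.psi₂ P W) - η) ≤ SeqReorder.FP P W φ 0)
      (hlog.mono fun M hM a b hab h φ hφ =>
        (Real.rpow_le_rpow_of_exponent_le hM (by linarith)).trans (h φ hφ))
      fun η hη => (SeqReorder.eventually_le_FP_zero hP hPpos hW hd hψ hβ hL hη).mono
        fun M h φ _ => h φ
    exact ⟨fun M => -ε M, by simpa using hε.neg, by simpa only [← sub_eq_add_neg] using h⟩
  · exact SeqReorder.exists_tendsto_zero_of_forall_pos
      (p := fun M η => ∀ φ : SeqReorder.Reconstruction 𝒳 𝒴 M (L M), SeqReorder.IsML W φ →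
        Real.exp (-(ξ * M * Real.log M * (β * SeqReorder.psi₂ P W + η))) ≤
          SeqReorder.FP P W φ ξ)
      (hlog.mono fun M hM a b hab h φ hφ => by
        refine le_trans (Real.exp_le_exp.2 (neg_le_neg ?_)) (h φ hφ)
        have := Real.log_nonneg hM
        gcongr)
      fun η hη => SeqReorder.eventually_le_FP hP hPpos hW hd hψ hβ hL hξ0 hξ1 hη
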